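/- Logarithms are to base $2$. A deterministic finite automaton (DFA) here has a total transition function $\delta$, state set of size $n$, and alphabet $\{0,\dots,\sigma-1\}$ with $\sigma\ge 2$; it is initially connected if every state is reachable from the initial state. The model of computation is the word RAM with $w$-bit words, where $w\ge c\log(\sigma n)$ for a suitable absolute constant $c$. An encoding of a DFA is a bit string from which (for given $n$, $\sigma$) the DFA can be recovered up to renaming its states; it is kept in read-only memory, packed into words. An input string $x$ is read once from left to right, one letter at a time, and the working space is the set of registers of the program, each of one word. (1) There are an absolute constant $C$, one fixed program using a constant number of words of working space (the same program for all $n$, $\sigma$, $w$ and all automata), and an assignment to every initially connected DFA $\mathcal D$ with $n$ states over $\sigma$ letters of an encoding of at most $$(\sigma-1)\,n\log n + C\,n\log\sigma$$ bits, such that the program, given the encoding of $\mathcal D$ in memory and any string $x$ over the alphabet as input, decides whether $\mathcal D$ accepts $x$ in at most $C(|x|\log\sigma+1)$ steps. (2) Suppose moreover that one state of $\mathcal D$ is designated as the failure state, and let $N$ be the number of pairs $(q,a)$ of a state and a letter such that $\delta(q,a)$ is not the failure state. If $1\le N<\sigma n$, then the same holds (with a suitable encoding, program and absolute constants) with the space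 bound improved to $$(N-n)\log n + C\,N\log\sigma$$ bits. -/

import Mathlib

/-! ### A word RAM with `w`-bit words

The data structure is a bit string, stored in a read-only memory that is packed into `w`-bit words.
The input string is read once, letter by letter. The only writable storage consists of the
registers of the program, each holding one word. -/

namespace WordRAM

/-- The arithmetic and logical word operations. -/
inductive Op where
  | add | sub | mul | div | mod
  | and | or | xor | shl | shr
  | lt | eq

/-- All operations are on unsigned `w`-bit words, with overflow discarded;
comparisons return `1` or `0`. -/
def Op.eval {w : ℕ} : Op → BitVec w → BitVec w → BitVec w
  | .add, a, b => a + b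
  | .sub, a, b => a - b
  | .mul, a, b => a * b
  | .div, a, b => a / b
  | .mod, a, b => a % b
  | .and, a, b => a &&& b
  | .or, a, b => a ||| b
  | .xor, a, b => a ^^^ b
  | .shl, a, b => a <<< b
  | .shr, a, b => a >>> b
  | .lt, a, b => if a.toNat < b.toNat then 1 else 0
  | .eq, a, b => if a = b then 1 else 0

/-- Programs with `k` registers. A program does not depend on the word length `w`. -/
inductive Prog (k : ℕ) where
  /-- `r := c`, for a numeral `c` of the program text. -/
  | const (r : Fin k) (c : ℕ)
  /-- `r := w`, the word length of the machine. -/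
  | wordLength (r : Fin k)
  /-- `r := a o b`. -/
  | op (o : Op) (r a b : Fin k)
  /-- `r :=` the word of the read-only memory at address `a`. -/
  | load (r a : Fin k)
  /-- If an input letter is left, move the next one into `r` and set `e := 1`;
  at the end of the input set `e := 0`. -/
  | next (r e : Fin k)
  /-- Sequential composition. -/
  | seq (p q : Prog k)
  /-- Run `p` if `r ≠ 0` and `q` if `r = 0`. -/
  | branch (r : Fin k) (p q : Prog k)
  /-- Run `p` as long as `r ≠ 0`. -/
  | loop (r : Fin k) (p : Prog k)

/-- A configuration: the contents of the `k` registers, and the unread part of the input. -/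
structure Config (k w : ℕ) where
  regs : Fin k → BitVec w
  input : List (BitVec w)

/-- Assignment of a word to a register. -/
def Config.set {k w : ℕ} (s : Config k w) (r : Fin k) (v : BitVec w) : Config k w :=
  { s with regs := Function.update s.regs r v }

/-- The word at address `j` of the memory that holds the bit string `m`: its bits are the bits
`j * w, …, j * w + w - 1` of `m`, the least significant one first, filled up with zeros after the
end of `m`. -/
def word (w : ℕ) (m : List Bool) (j : ℕ) : BitVec w :=
  BitVec.ofFnLE fun i : Fin w => m.getD (j * w + i) false

/-- `Exec m p s s' t`: with the bit string `m` in memory, the program `p` started in the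
configuration `s` halts in the configuration `s'` after exactly `t` steps. Each elementary
instruction and each test of a register is one step. -/
inductive Exec {k w : ℕ} (m : List Bool) : Prog k → Config k w → Config k w → ℕ → Prop
  | const (r : Fin k) (c : ℕ) (s : Config k w) :
      Exec m (.const r c) s (s.set r (BitVec.ofNat w c)) 1
  | wordLength (r : Fin k) (s : Config k w) :
      Exec m (.wordLength r) s (s.set r (BitVec.ofNat w w)) 1
  | op (o : Op) (r a b : Fin k) (s : Config k w) :
      Exec m (.op o r a b) s (s.set r (o.eval (s.regs a) (s.regs b))) 1
  | load (r a : Fin k) (s : Config k w) :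
      Exec m (.load r a) s (s.set r (word w m (s.regs a).toNat)) 1
  | next_cons (r e : Fin k) (f : Fin k → BitVec w) (a : BitVec w) (x : List (BitVec w)) :
      Exec m (.next r e) ⟨f, a :: x⟩ ((Config.set ⟨f, x⟩ r a).set e 1) 1
  | next_nil (r e : Fin k) (f : Fin k → BitVec w) :
      Exec m (.next r e) ⟨f, []⟩ (Config.set ⟨f, []⟩ e 0) 1
  | seq {p q : Prog k} {s s₁ s₂ : Config k w} {t₁ t₂ : ℕ} :
      Exec m p s s₁ t₁ → Exec m q s₁ s₂ t₂ → Exec m (.seq p q) s s₂ (t₁ + t₂)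
  | branch_true {r : Fin k} {p q : Prog k} {s s' : Config k w} {t : ℕ} :
      s.regs r ≠ 0 → Exec m p s s' t → Exec m (.branch r p q) s s' (t + 1)
  | branch_false {r : Fin k} {p q : Prog k} {s s' : Config k w} {t : ℕ} :
      s.regs r = 0 → Exec m q s s' t → Exec m (.branch r p q) s s' (t + 1)
  | loop_true {r : Fin k} {p : Prog k} {s s₁ s₂ : Config k w} {t₁ t₂ : ℕ} :
      s.regs r ≠ 0 → Exec m p s s₁ t₁ → Exec m (.loop r p) s₁ s₂ t₂ →
        Exec m (.loop r p) s s₂ (t₁ + t₂ + 1)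
  | loop_false {r : Fin k} {p : Prog k} {s : Config k w} :
      s.regs r = 0 → Exec m (.loop r p) s s 1

/-- The initial configuration: all registers are zero and the input is the string `x`,
whose letters are handed over as numbers below `σ`. -/
def initial (k w : ℕ) {σ : ℕ} (x : List (Fin σ)) : Config k w :=
  ⟨fun _ => 0, x.map fun a => BitVec.ofNat w a⟩

/-- On the machine with `w`-bit words, with the bit string `m` in memory, the program `p` run on
the input `x` halts after at most `t` steps, and its answer, which is whether register `0` is then
nonzero, is the truth value of `b`. -/
def Decides {k : ℕ} (p : Prog (k + 1)) (w : ℕ) (m : List Bool) {σ : ℕ} (x : List (Fin σ))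
    (t : ℝ) (b : Prop) : Prop :=
  ∃ (s : Config (k + 1) w) (T : ℕ),
    Exec m p (initial (k + 1) w x) s T ∧ (T : ℝ) ≤ t ∧ (s.regs 0 ≠ 0 ↔ b)

end WordRAM

/-- Every state is reachable from the initial state. -/
def DFA.InitiallyConnected {α Q : Type*} (A : DFA α Q) : Prop :=
  ∀ q : Q, ∃ x : List α, A.eval x = q

/-- `A` and `B` are the same automaton up to a renaming of the states. -/
def DFA.Isomorphic {α Q R : Type*} (A : DFA α Q) (B : DFA α R) : Prop :=
  ∃ e : Q ≃ R, DFA.reindex e A = B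

/-- The number of transitions that do not lead to the failure state `f`. -/
def DFA.numNonFailure {n σ : ℕ} (A : DFA (Fin σ) (Fin n)) (f : Fin n) : ℕ :=
  (Finset.univ.filter fun p : Fin n × Fin σ => A.step p.1 p.2 ≠ f).card

/-!
# Succinct encodings of deterministic automata

**The shape of the encoding.** The states are numbered by the first word that leads to them, in the
order by length and then lexicographically. The pairs of a state and a letter are numbered by
`t = σ * q + a`. For each state `j + 1`, the last step of its first word is a transition, its tree
transition, and the numbers `τ j` of the tree transitions increase with `j` (`exists_numbering`).
So the target of a tree transition is determined by its rank in the sequence `τ`, and only the other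
`(σ - 1) * n + 1` transitions need an explicit target of `log n` bits. The sequence `τ` itself is
stored in `O(n log σ)` bits as a dictionary with samples of the prefix sums of the out-degrees in
the tree, the out-degrees between the samples, a table for sums of several small fields of one word,
and the letters. A query is a binary search for the letter among the tree transitions of one state
(`wp_search`), which takes `O(log σ)` steps.

**The explicit targets.** For the first encoding, fields of `⌈log n⌉` bits would waste up to one
bit for each of more than `(σ - 1) * n` entries, which is too much. The targets are grouped into
blocks, numbers below `X = n ^ k` with `X ≥ σ ^ 2`, and the blocks are stored in a forest: a node
of the forest with a block `x` and the spills of two children keeps the part `x % A` together with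
the spills in a field of a fixed width, and passes on the spill `x / A` to its own parent. The base
`A ≥ σ` is chosen so that the field is almost fully used, and the loss is `O(1 / σ)` bits at each
node (`width_add_logb_le`). The forest has `O(log σ)` levels, above which the few remaining spills
and blocks are stored in fields of their own. The parameters of each level can be computed from the
ones of the level below, so that access to a block takes `O(log σ)` steps (`wp_readBlock`). For the
second encoding, the failure state is the default, and only the `N - n + O(1)` other transitions are
explicit (`exists_explicit`). They are found by a second dictionary of the same kind, and their
targets are stored in fields of `⌈log n⌉` bits.

**The machine.** All numbers in the programs are bounded by some `S = 2 ^ L` with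
`L = O(log (σ * n))`, and a bounded power of `S` is less than `2 ^ w`. Programs are written as
expressions and structured code over natural numbers, and `WP` asserts that the compiled code
simulates them with a bounded number of loop iterations, each of which takes a constant number of
steps. The number `L` stands in unary at the start of the memory, where it can be read with a
constant number of word operations.

**Recovering the automaton.** The machine is deterministic, and before it answers, a register holds
the number of the state that has been reached. So two automata with the same encoding have the same
numbers for the states reached by each word, and the same answers, and hence are isomorphic
(`Simulates.isomorphic`).
-/

namespace WordRAM

/-! ### Memory contents as numbers -/

/-- The natural number whose binary digits, least significant first, are the bits of `m`. -/
def num : List Bool → ℕ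
  | [] => 0
  | b :: m => Nat.bit b (num m)

theorem testBit_num (m : List Bool) (i : ℕ) : (num m).testBit i = m.getD i false := by
  induction m generalizing i with
  | nil => simp [num]
  | cons b m ih =>
    cases i with
    | zero => simp [num]
    | succ i => simp [num, Nat.testBit_bit_succ, ih]

theorem word_toNat (w : ℕ) (m : List Bool) (j : ℕ) :
    (word w m j).toNat = num m / 2 ^ (j * w) % 2 ^ w := by
  apply Nat.eq_of_testBit_eq
  intro i
  rw [Nat.testBit_mod_two_pow, Nat.testBit_div_two_pow, testBit_num, word, BitVec.toNat_ofFnLE,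
    Nat.testBit_ofBits]
  by_cases h : i < w <;> simp [h, add_comm]

/-- The number formed by the `l` bits of the memory `m` from address `p` on. -/
def rd (m : List Bool) (p l : ℕ) : ℕ := num m / 2 ^ p % 2 ^ l

theorem rd_lt (m : List Bool) (p l : ℕ) : rd m p l < 2 ^ l := Nat.mod_lt _ (by positivity)

theorem testBit_rd (m : List Bool) (p l i : ℕ) :
    (rd m p l).testBit i = (decide (i < l) && (num m).testBit (i + p)) := by
  rw [rd, Nat.testBit_mod_two_pow, Nat.testBit_div_two_pow]

/-- Two consecutive words, suitably shifted, contain any field of less than `w` bits. -/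
theorem words_toNat (w : ℕ) (m : List Bool) (p l : ℕ) (hl : l < w) :
    ((num m / 2 ^ (p / w * w) % 2 ^ w) >>> (p % w) |||
      ((num m / 2 ^ ((p / w + 1) * w) % 2 ^ w) <<< (w - p % w)) % 2 ^ w) % 2 ^ l = rd m p l := by
  apply Nat.eq_of_testBit_eq
  intro i
  rw [testBit_rd, Nat.testBit_mod_two_pow]
  by_cases hi : i < l
  · have hw : 0 < w := by omega
    have hs := Nat.mod_lt p hw
    have hp := Nat.div_add_mod p w
    simp only [hi, decide_true, Bool.true_and, Nat.testBit_or, Nat.testBit_shiftRight,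
      Nat.testBit_mod_two_pow, Nat.testBit_shiftLeft, Nat.testBit_div_two_pow]
    have hiw : i < w := by omega
    by_cases h : p % w + i < w
    · have h2 : ¬ (w - p % w ≤ i) := by omega
      simp only [h, decide_true, Bool.true_and, h2, decide_false, Bool.false_and, Bool.and_false,
        Bool.or_false]
      congr 1
      rw [mul_comm (p / w)]
      omega
    · have h2 : w - p % w ≤ i := by omega
      have h3 : i - (w - p % w) < w := by omega
      simp only [h, decide_false, Bool.false_and, h2, decide_true, Bool.true_and, hiw, h3,
        Bool.false_or]
      congr 1
      rw [add_mul, mul_comm (p / w), one_mul]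
      omega
  · simp [hi]

/-! ### Arithmetic of the word operations -/

/-- The operation on natural numbers that a word operation performs in the absence of overflow. -/
def Op.nat : Op → ℕ → ℕ → ℕ
  | .add, a, b => a + b
  | .sub, a, b => a - b
  | .mul, a, b => a * b
  | .div, a, b => a / b
  | .mod, a, b => a % b
  | .and, a, b => a &&& b
  | .or, a, b => a ||| b
  | .xor, a, b => a ^^^ b
  | .shl, a, b => a * 2 ^ b
  | .shr, a, b => a / 2 ^ b
  | .lt, a, b => if a < b then 1 else 0
  | .eq, a, b => if a = b then 1 else 0

/-- A condition under which `Op.nat` is correct and its value is controlled by the bound `S`;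
the bitwise operations are excluded because nothing is said about the size of their values. -/
def Op.Safe (S : ℕ) : Op → ℕ → ℕ → Prop
  | .sub, a, b => b ≤ a
  | .shl, a, b => a * 2 ^ b ≤ S
  | .or, _, _ => False
  | .xor, _, _ => False
  | _, _, _ => True

theorem Op.eval_toNat {w S : ℕ} (hw : 0 < w) (o : Op) (a b : BitVec w)
    (hs : o.Safe S a.toNat b.toNat) (hlt : o.nat a.toNat b.toNat < 2 ^ w) :
    (o.eval a b).toNat = o.nat a.toNat b.toNat := by
  have h1 : (1 : BitVec w).toNat = 1 := by
    have : 1 < 2 ^ w := Nat.one_lt_two_pow (by omega)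
    simp [Nat.mod_eq_of_lt this]
  cases o
  · exact (BitVec.toNat_add a b).trans (Nat.mod_eq_of_lt hlt)
  · have hs' : b.toNat ≤ a.toNat := hs
    simp only [Op.eval, Op.nat]
    exact BitVec.toNat_sub_of_le (by simpa [BitVec.le_def] using hs')
  · exact (BitVec.toNat_mul a b).trans (Nat.mod_eq_of_lt hlt)
  · simp [Op.eval, Op.nat]
  · simp [Op.eval, Op.nat]
  · simp [Op.eval, Op.nat]
  · simp [Op.eval, Op.nat]
  · simp [Op.eval, Op.nat]
  · simp only [Op.eval, Op.nat] at hlt ⊢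
    simp only [BitVec.shiftLeft_eq', BitVec.toNat_shiftLeft, Nat.shiftLeft_eq]
    exact Nat.mod_eq_of_lt hlt
  · simp [Op.eval, Op.nat, Nat.shiftRight_eq_div_pow]
  · simp only [Op.eval, Op.nat]
    split_ifs
    · exact h1
    · simp
  · simp only [Op.eval, Op.nat, ← BitVec.toNat_inj]
    split_ifs
    · exact h1
    · simp

/-- The degrees in `S` add up under every operation, so that the size of the value of an expression
is controlled by its shape alone. -/
theorem Op.nat_le {S : ℕ} (hS : 2 ≤ S) (o : Op) {a b i j : ℕ} (hi : 1 ≤ i) (hj : 1 ≤ j)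
    (ha : a ≤ S ^ i) (hb : b ≤ S ^ j) (hs : o.Safe S a b) : o.nat a b ≤ S ^ (i + j) := by
  have h1 : S ^ i ≤ S ^ (i + j) := Nat.pow_le_pow_right (by omega) (by omega)
  have h2 : 2 ≤ S ^ i := hS.trans (Nat.le_self_pow (by omega) S)
  have h3 : 2 ≤ S ^ j := hS.trans (Nat.le_self_pow (by omega) S)
  have h4 : S ≤ S ^ (i + j) := Nat.le_self_pow (by omega) S
  cases o
  · simp only [Op.nat, pow_add]; nlinarith
  · simp only [Op.nat]; omega
  · simp only [Op.nat, pow_add]; exact Nat.mul_le_mul ha hb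
  · exact (Nat.div_le_self a b).trans (ha.trans h1)
  · exact (Nat.mod_le a b).trans (ha.trans h1)
  · exact Nat.and_le_left.trans (ha.trans h1)
  · exact hs.elim
  · exact hs.elim
  · exact le_trans (show a * 2 ^ b ≤ S from hs) h4
  · exact (Nat.div_le_self a _).trans (ha.trans h1)
  · simp only [Op.nat]; split_ifs <;> omega
  · simp only [Op.nat]; split_ifs <;> omega

/-! ### Expressions -/

/-- Expressions over numbered variables; `read p l` is the number formed by the `l` bits of the
memory at the bit address `p`. -/
inductive Expr where
  | lit (c : ℕ)
  | var (x : ℕ)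
  | bin (o : Op) (a b : Expr)
  | read (p l : Expr)

namespace Expr

/-- The value of an expression, for the memory `m` and the values `v` of the variables. -/
def eval (m : List Bool) (v : ℕ → ℕ) : Expr → ℕ
  | lit c => c
  | var x => v x
  | bin o a b => o.nat (a.eval m v) (b.eval m v)
  | read p l => rd m (p.eval m v) (l.eval m v)

/-- A bound for the degree of the value of an expression as a polynomial in a bound for the
variables. -/
def deg : Expr → ℕ
  | lit _ => 1
  | var _ => 1
  | bin _ a b => a.deg + b.deg
  | read p l => p.deg + l.deg + 1

/-- The number of registers used for the evaluation. -/
def height : Expr → ℕ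
  | lit _ => 1
  | var _ => 1
  | bin _ a b => max a.height (b.height + 1)
  | read p l => max p.height (max (l.height + 1) 6)

/-- All variables of the expression are among the first `40` registers. -/
def Closed : Expr → Bool
  | lit _ => true
  | var x => decide (x < 40)
  | bin _ a b => a.Closed && b.Closed
  | read p l => p.Closed && l.Closed

/-- The side conditions for the correctness of the evaluation on words. -/
def Safe (S : ℕ) (m : List Bool) (v : ℕ → ℕ) : Expr → Prop
  | lit c => c ≤ S
  | var _ => True
  | bin o a b => a.Safe S m v ∧ b.Safe S m v ∧ o.Safe S (a.eval m v) (b.eval m v)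
  | read p l => p.Safe S m v ∧ l.Safe S m v ∧ 2 ^ (l.eval m v) ≤ S

theorem deg_pos (e : Expr) : 1 ≤ e.deg := by
  induction e <;> simp only [deg] <;> omega

theorem eval_le {S : ℕ} {m : List Bool} {v : ℕ → ℕ} (hS : 2 ≤ S) (hv : ∀ x < 40, v x ≤ S)
    (e : Expr) (hc : e.Closed = true) (hs : e.Safe S m v) : e.eval m v ≤ S ^ e.deg := by
  induction e with
  | lit c => simpa [eval, deg, Safe] using hs
  | var x => simpa [eval, deg] using hv x (by simpa [Closed] using hc)
  | bin o a b iha ihb =>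
    simp only [Closed, Bool.and_eq_true] at hc
    exact Op.nat_le hS o a.deg_pos b.deg_pos (iha hc.1 hs.1) (ihb hc.2 hs.2.1) hs.2.2
  | read p l =>
    have h1 := rd_lt m (p.eval m v) (l.eval m v)
    have h2 : S ≤ S ^ (read p l).deg := Nat.le_self_pow (by simp [deg]) S
    have h3 := hs.2.2
    simp only [eval]
    omega

end Expr

/-- Register number `i` of a program with `64` registers. -/
def reg (i : ℕ) : Fin (63 + 1) := Fin.ofNat 64 i

theorem reg_ne {i j : ℕ} (hi : i < 64) (hj : j < 64) (h : i ≠ j) : reg i ≠ reg j := by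
  intro e
  have := congrArg Fin.val e
  simp only [reg, Fin.ofNat] at this
  omega

/-- Code that extracts the bits of the memory at the address in register `d`, as many as register
`d + 1` says, into register `d`. -/
def fetch (d : ℕ) : Prog (63 + 1) :=
  .seq (.wordLength (reg (d + 2))) <|
  .seq (.op .div (reg (d + 3)) (reg d) (reg (d + 2))) <|
  .seq (.op .mod (reg d) (reg d) (reg (d + 2))) <|
  .seq (.load (reg (d + 4)) (reg (d + 3))) <|
  .seq (.op .shr (reg (d + 4)) (reg (d + 4)) (reg d)) <|
  .seq (.const (reg (d + 5)) 1) <|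
  .seq (.op .add (reg (d + 3)) (reg (d + 3)) (reg (d + 5))) <|
  .seq (.load (reg (d + 3)) (reg (d + 3))) <|
  .seq (.op .sub (reg (d + 2)) (reg (d + 2)) (reg d)) <|
  .seq (.op .shl (reg (d + 3)) (reg (d + 3)) (reg (d + 2))) <|
  .seq (.op .or (reg (d + 4)) (reg (d + 4)) (reg (d + 3))) <|
  .seq (.op .shl (reg (d + 5)) (reg (d + 5)) (reg (d + 1))) <|
  .op .mod (reg d) (reg (d + 4)) (reg (d + 5))

/-- Code that evaluates an expression into register `d`, with scratch registers above `d`. -/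
def Expr.code : Expr → ℕ → Prog (63 + 1)
  | .lit c, d => .const (reg d) c
  | .var x, d => .op .or (reg d) (reg x) (reg x)
  | .bin o a b, d => .seq (a.code d) (.seq (b.code (d + 1)) (.op o (reg d) (reg d) (reg (d + 1))))
  | .read p l, d => .seq (p.code d) (.seq (l.code (d + 1)) (fetch d))

/-- The field is put together from two consecutive words. The condition on its length makes sure
that it touches no third one. -/
theorem exec_fetch {w : ℕ} (m : List Bool) (hw : 1 < w) (d : ℕ) (hd : d + 6 ≤ 64)
    (s : Config (63 + 1) w)
    (hl : (s.regs (reg (d + 1))).toNat < w) :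
    ∃ s' t, Exec m (fetch d) s s' t ∧ (∀ i < d, s'.regs (reg i) = s.regs (reg i)) ∧
      s'.input = s.input ∧
      (s'.regs (reg d)).toNat =
        rd m (s.regs (reg d)).toNat (s.regs (reg (d + 1))).toNat := by
  have n01 : reg d ≠ reg (d + 1) := reg_ne (by omega) (by omega) (by omega)
  have n02 : reg d ≠ reg (d + 2) := reg_ne (by omega) (by omega) (by omega)
  have n03 : reg d ≠ reg (d + 3) := reg_ne (by omega) (by omega) (by omega)
  have n04 : reg d ≠ reg (d + 4) := reg_ne (by omega) (by omega) (by omega)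
  have n05 : reg d ≠ reg (d + 5) := reg_ne (by omega) (by omega) (by omega)
  have n12 : reg (d + 1) ≠ reg (d + 2) := reg_ne (by omega) (by omega) (by omega)
  have n13 : reg (d + 1) ≠ reg (d + 3) := reg_ne (by omega) (by omega) (by omega)
  have n14 : reg (d + 1) ≠ reg (d + 4) := reg_ne (by omega) (by omega) (by omega)
  have n15 : reg (d + 1) ≠ reg (d + 5) := reg_ne (by omega) (by omega) (by omega)
  have n23 : reg (d + 2) ≠ reg (d + 3) := reg_ne (by omega) (by omega) (by omega)
  have n24 : reg (d + 2) ≠ reg (d + 4) := reg_ne (by omega) (by omega) (by omega)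
  have n25 : reg (d + 2) ≠ reg (d + 5) := reg_ne (by omega) (by omega) (by omega)
  have n34 : reg (d + 3) ≠ reg (d + 4) := reg_ne (by omega) (by omega) (by omega)
  have n35 : reg (d + 3) ≠ reg (d + 5) := reg_ne (by omega) (by omega) (by omega)
  have n45 : reg (d + 4) ≠ reg (d + 5) := reg_ne (by omega) (by omega) (by omega)
  refine ⟨_, _, .seq (.wordLength _ _) <| .seq (.op ..) <| .seq (.op ..) <| .seq (.load ..) <|
    .seq (.op ..) <| .seq (.const ..) <| .seq (.op ..) <| .seq (.load ..) <| .seq (.op ..) <|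
    .seq (.op ..) <| .seq (.op ..) <| .seq (.op ..) (.op ..), ?_, rfl, ?_⟩
  · intro i hi
    have h0 : reg i ≠ reg d := reg_ne (by omega) (by omega) (by omega)
    have h2 : reg i ≠ reg (d + 2) := reg_ne (by omega) (by omega) (by omega)
    have h3 : reg i ≠ reg (d + 3) := reg_ne (by omega) (by omega) (by omega)
    have h4 : reg i ≠ reg (d + 4) := reg_ne (by omega) (by omega) (by omega)
    have h5 : reg i ≠ reg (d + 5) := reg_ne (by omega) (by omega) (by omega)
    simp [Config.set, h0, h2, h3, h4, h5]
  · simp only [Config.set, Function.update_self, Function.update_of_ne, ne_eq, n02, n03, n04,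
      n05, n12, n13, n14, n15, n23, n24, n25, n34, n35, n45, n01.symm, n02.symm, n03.symm,
      n23.symm, n24.symm, n25.symm, n34.symm, n35.symm, n45.symm, not_false_eq_true]
    generalize s.regs (reg d) = p at *
    generalize s.regs (reg (d + 1)) = l at *
    have hww : w < 2 ^ w := Nat.lt_two_pow_self
    have hw0 : 0 < w := by omega
    have h1w : 1 < 2 ^ w := Nat.one_lt_two_pow (by omega)
    have hW : (BitVec.ofNat w w).toNat = w := by simp [Nat.mod_eq_of_lt hww]
    have h1 : (BitVec.ofNat w 1).toNat = 1 := by simp [Nat.mod_eq_of_lt h1w]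
    have hs : (p % BitVec.ofNat w w).toNat = p.toNat % w := by rw [BitVec.toNat_umod, hW]
    have hq : (p / BitVec.ofNat w w).toNat = p.toNat / w := by rw [BitVec.toNat_udiv, hW]
    have hpw : p.toNat / w + 1 < 2 ^ w := by
      have hp := p.isLt
      have h2 : p.toNat / w ≤ p.toNat / 2 := Nat.div_le_div_left hw (by omega)
      have h3 : 2 ^ 2 ≤ 2 ^ w := Nat.pow_le_pow_right (by omega) hw
      omega
    have hq1 : (p / BitVec.ofNat w w + BitVec.ofNat w 1).toNat = p.toNat / w + 1 := by
      rw [BitVec.toNat_add, hq, h1, Nat.mod_eq_of_lt hpw]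
    have hsub : (BitVec.ofNat w w - p % BitVec.ofNat w w).toNat = w - p.toNat % w := by
      rw [BitVec.toNat_sub_of_le, hW, hs]
      rw [BitVec.le_def, hW, hs]
      exact (Nat.mod_lt _ hw0).le
    have hpow : (BitVec.ofNat w 1 <<< l.toNat).toNat = 2 ^ l.toNat := by
      rw [BitVec.toNat_shiftLeft, h1, Nat.shiftLeft_eq, one_mul,
        Nat.mod_eq_of_lt (Nat.pow_lt_pow_right (by omega) hl)]
    simp only [Op.eval, BitVec.shiftLeft_eq', BitVec.ushiftRight_eq', BitVec.toNat_umod, hpow,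
      BitVec.toNat_or, BitVec.toNat_ushiftRight, BitVec.toNat_shiftLeft, word_toNat, hq, hq1]
    rw [hsub, hW]
    exact words_toNat w m p.toNat l.toNat hl

/-! ### Structured programs and their total correctness -/

/-- The word length `w` is so large that polynomials of degree at most `64` in the bound `S` for the
variables do not overflow. -/
structure Wide (w S : ℕ) : Prop where
  two_le : 2 ≤ S
  lt : S ^ 64 < 2 ^ w

theorem Wide.one_lt {w S : ℕ} (h : Wide w S) : 1 < w := by
  by_contra hw
  have h1 : 2 ^ w ≤ 2 ^ 1 := Nat.pow_le_pow_right (by omega) (by omega)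
  have h2 : 2 ^ 64 ≤ S ^ 64 := Nat.pow_le_pow_left h.two_le 64
  have := h.lt
  norm_num at h1 h2
  omega

theorem Wide.pow_lt {w S : ℕ} (h : Wide w S) {d : ℕ} (hd : d ≤ 64) : S ^ d < 2 ^ w :=
  (Nat.pow_le_pow_right (by have := h.two_le; omega) hd).trans_lt h.lt

theorem Wide.le_lt {w S : ℕ} (h : Wide w S) {a : ℕ} (ha : a ≤ S) : a < 2 ^ w := by
  have := h.pow_lt (show 1 ≤ 64 by omega)
  rw [pow_one] at this
  omega

/-- If a closed expression has degree at most `64`, then none of its intermediate values overflows,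
and its code computes its value. -/
theorem exec_code {w S : ℕ} {m : List Bool} (hB : Wide w S) {v : ℕ → ℕ} (e : Expr) (d : ℕ)
    (hd : 40 ≤ d) (hh : d + e.height ≤ 64) (hc : e.Closed = true) (hs : e.Safe S m v)
    (hdeg : e.deg ≤ 64) (s : Config (63 + 1) w)
    (hv : ∀ x < 40, (s.regs (reg x)).toNat = v x ∧ v x ≤ S) :
    ∃ s' t, Exec m (e.code d) s s' t ∧ (∀ i < d, s'.regs (reg i) = s.regs (reg i)) ∧
      s'.input = s.input ∧ (s'.regs (reg d)).toNat = e.eval m v := by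
  induction e generalizing d s with
  | lit c =>
    refine ⟨_, _, .const _ _ _, ?_, rfl, ?_⟩
    · intro i hi
      simp only [Expr.height] at hh
      simp [Config.set, reg_ne (show i < 64 by omega) (show d < 64 by omega) hi.ne]
    · simp [Config.set, Expr.eval, Nat.mod_eq_of_lt (hB.le_lt hs)]
  | var x =>
    refine ⟨_, _, .op _ _ _ _ _, ?_, rfl, ?_⟩
    · intro i hi
      simp only [Expr.height] at hh
      simp [Config.set, reg_ne (show i < 64 by omega) (show d < 64 by omega) hi.ne]
    · simp [Config.set, Expr.eval, Op.eval, (hv x (by simpa [Expr.Closed] using hc)).1]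
  | bin o a b iha ihb =>
    simp only [Expr.Closed, Bool.and_eq_true] at hc
    simp only [Expr.height] at hh
    have hle := Expr.eval_le hB.two_le (fun x hx => (hv x hx).2) (.bin o a b)
      (by simpa [Expr.Closed] using hc) hs
    have hlt := hle.trans_lt (hB.pow_lt hdeg)
    simp only [Expr.deg] at hdeg
    obtain ⟨s1, t1, h1, f1, i1, v1⟩ := iha d hd (by omega) hc.1 hs.1 (by omega) s hv
    obtain ⟨s2, t2, h2, f2, i2, v2⟩ := ihb (d + 1) (by omega) (by omega) hc.2 hs.2.1 (by omega) s1
      (fun x hx => by rw [f1 x (by omega)]; exact hv x hx)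
    refine ⟨_, _, .seq h1 (.seq h2 (.op _ _ _ _ _)), ?_, ?_, ?_⟩
    · intro i hi
      simp only [Config.set]
      rw [Function.update_of_ne (reg_ne (by omega) (by omega) hi.ne), f2 i (by omega), f1 i hi]
    · simp [Config.set, i2, i1]
    · have e1 : (s2.regs (reg d)).toNat = a.eval m v := by rw [f2 d (by omega), v1]
      simp only [Config.set, Function.update_self]
      rw [Op.eval_toNat (S := S) (by have := hB.one_lt; omega), e1, v2]
      · rfl
      · rw [e1, v2]; exact hs.2.2
      · rw [e1, v2]; exact hlt
  | read p l ihp ihl =>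
    simp only [Expr.Closed, Bool.and_eq_true] at hc
    simp only [Expr.height] at hh
    simp only [Expr.deg] at hdeg
    obtain ⟨s1, t1, h1, f1, i1, v1⟩ := ihp d hd (by omega) hc.1 hs.1 (by omega) s hv
    obtain ⟨s2, t2, h2, f2, i2, v2⟩ := ihl (d + 1) (by omega) (by omega) hc.2 hs.2.1 (by omega) s1
      (fun x hx => by rw [f1 x (by omega)]; exact hv x hx)
    have hl : (s2.regs (reg (d + 1))).toNat < w := by
      rw [v2]
      exact (Nat.pow_lt_pow_iff_right (by omega : 1 < 2)).1 (hB.le_lt hs.2.2)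
    obtain ⟨s3, t3, h3, f3, i3, v3⟩ := exec_fetch m hB.one_lt d (by omega) s2 hl
    refine ⟨_, _, .seq h1 (.seq h2 h3), ?_, ?_, ?_⟩
    · intro i hi
      rw [f3 i hi, f2 i (by omega), f1 i hi]
    · rw [i3, i2, i1]
    · rw [v3, v2, f2 d (by omega), v1]
      rfl

/-- The size of a program; the running time is at most the size times one more than the number of
loop iterations. -/
def Prog.size {k : ℕ} : Prog k → ℕ
  | .const _ _ => 1
  | .wordLength _ => 1
  | .op _ _ _ _ => 1
  | .load _ _ => 1
  | .next _ _ => 1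
  | .seq p q => p.size + q.size
  | .branch _ p q => p.size + q.size + 1
  | .loop _ p => p.size + 1

/-- The program has no loops. -/
def Prog.Straight {k : ℕ} : Prog k → Prop
  | .seq p q => p.Straight ∧ q.Straight
  | .branch _ p q => p.Straight ∧ q.Straight
  | .loop _ _ => False
  | _ => True

theorem Exec.le_size {k w : ℕ} {m : List Bool} {p : Prog k} {s s' : Config k w} {t : ℕ}
    (h : Exec m p s s' t) (hp : p.Straight) : t ≤ p.size := by
  induction h with
  | seq _ _ ih1 ih2 => have := ih1 hp.1; have := ih2 hp.2; simp only [Prog.size]; omega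
  | branch_true _ _ ih => have := ih hp.1; simp only [Prog.size]; omega
  | branch_false _ _ ih => have := ih hp.2; simp only [Prog.size]; omega
  | loop_true => exact hp.elim
  | loop_false => exact hp.elim
  | _ => simp [Prog.size]

/-- Execution is deterministic. -/
theorem Exec.unique {k w : ℕ} {m : List Bool} {p : Prog k} {s s₁ s₂ : Config k w} {t₁ t₂ : ℕ}
    (h₁ : Exec m p s s₁ t₁) (h₂ : Exec m p s s₂ t₂) : s₁ = s₂ := by
  induction h₁ generalizing s₂ t₂ with
  | seq _ _ ih1 ih2 =>
    cases h₂ with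
    | seq a b => cases ih1 a; exact ih2 b
  | branch_true h _ ih =>
    cases h₂ with
    | branch_true _ a => exact ih a
    | branch_false h' _ => exact absurd h' h
  | branch_false h _ ih =>
    cases h₂ with
    | branch_true h' _ => exact absurd h h'
    | branch_false _ a => exact ih a
  | loop_true h _ _ ih1 ih2 =>
    cases h₂ with
    | loop_true _ a b => cases ih1 a; exact ih2 b
    | loop_false h' => exact absurd h' h
  | loop_false h =>
    cases h₂ with
    | loop_true h' _ _ => exact absurd h h'
    | loop_false _ => rfl
  | _ => cases h₂; rfl

theorem Expr.straight_code (e : Expr) (d : ℕ) : (e.code d).Straight := by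
  induction e generalizing d with
  | lit => trivial
  | var => trivial
  | bin o a b iha ihb => exact ⟨iha d, ihb (d + 1), trivial⟩
  | read p l ihp ihl =>
    exact ⟨ihp d, ihl (d + 1), by simp [fetch, Prog.Straight]⟩

/-- The state of a structured program: natural numbers as values of the variables, of which the
first `40` are held in registers, and the unread input. -/
structure State where
  v : ℕ → ℕ
  inp : List ℕ

/-- Assignment to a variable. -/
def State.set (s : State) (x a : ℕ) : State := ⟨Function.update s.v x a, s.inp⟩

@[simp] theorem State.set_v (s : State) (x a y : ℕ) :
    (s.set x a).v y = if y = x then a else s.v y := by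
  simp [State.set, Function.update_apply]

@[simp] theorem State.set_inp (s : State) (x a : ℕ) : (s.set x a).inp = s.inp := rfl

/-- The configuration `st` represents the state `s`, all of whose variables are at most `S`. -/
def Rep {w : ℕ} (S : ℕ) (st : Config (63 + 1) w) (s : State) : Prop :=
  (∀ x < 40, (st.regs (reg x)).toNat = s.v x ∧ s.v x ≤ S) ∧
    st.input = s.inp.map (BitVec.ofNat w)

/-- Total correctness: from the state `s`, the program reaches a state that satisfies `Q` within
`it` loop iterations. -/
def WP (w S : ℕ) (m : List Bool) (p : Prog (63 + 1)) (it : ℕ) (Q : State → Prop) (s : State) :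
    Prop :=
  ∀ st : Config (63 + 1) w, Rep S st s →
    ∃ st' t s', Exec m p st st' t ∧ t ≤ p.size * (it + 1) ∧ Rep S st' s' ∧ Q s'

/-- Assignment of the value of an expression. -/
def asg (x : ℕ) (e : Expr) : Prog (63 + 1) :=
  .seq (e.code 40) (.op .or (reg x) (reg 40) (reg 40))

/-- A case distinction on whether the value of an expression is nonzero. -/
def ite (e : Expr) (p q : Prog (63 + 1)) : Prog (63 + 1) :=
  .seq (e.code 40) (.branch (reg 40) p q)

/-- A loop that runs as long as the value of an expression is nonzero. -/
def whl (e : Expr) (p : Prog (63 + 1)) : Prog (63 + 1) :=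
  .seq (e.code 40) (.loop (reg 40) (.seq p (e.code 40)))

/-- The static conditions under which an expression can be evaluated. -/
def Expr.Ok (e : Expr) : Bool := decide (e.height ≤ 24) && e.Closed && decide (e.deg ≤ 64)

section rules

variable {w S : ℕ} {m : List Bool} {Q R : State → Prop} {s : State} {p q : Prog (63 + 1)} {e : Expr}

theorem Rep.code {st : Config (63 + 1) w} (hB : Wide w S) (h : Rep S st s) (hok : e.Ok = true)
    (hs : e.Safe S m s.v) :
    ∃ st' t, Exec m (e.code 40) st st' t ∧ t ≤ (e.code 40).size ∧ Rep S st' s ∧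
      (st'.regs (reg 40)).toNat = e.eval m s.v := by
  simp only [Expr.Ok, Bool.and_eq_true, decide_eq_true_eq] at hok
  obtain ⟨s1, t, h1, f1, i1, v1⟩ :=
    exec_code hB e 40 le_rfl (by omega) hok.1.2 hs hok.2 st h.1
  refine ⟨s1, t, h1, h1.le_size (e.straight_code 40), ⟨fun x hx => ?_, ?_⟩, v1⟩
  · rw [f1 x hx]; exact h.1 x hx
  · rw [i1]; exact h.2

theorem WP.mono {it it' : ℕ} (h : WP w S m p it Q s) (hi : it ≤ it') (hQ : ∀ s, Q s → R s) :
    WP w S m p it' R s := by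
  intro st hst
  obtain ⟨st', t, s', h1, h2, h3, h4⟩ := h st hst
  exact ⟨st', t, s', h1, h2.trans (Nat.mul_le_mul_left _ (by omega)), h3, hQ _ h4⟩

theorem WP.asg (hB : Wide w S) {x : ℕ} (a : ℕ) (hx : x < 40) (hok : e.Ok = true)
    (hs : e.Safe S m s.v) (ha : e.eval m s.v = a) (hS : a ≤ S) (hQ : Q (s.set x a)) :
    WP w S m (asg x e) 0 Q s := by
  intro st hst
  obtain ⟨s1, t, h1, h2, h3, h4⟩ := hst.code hB hok hs
  refine ⟨_, _, s.set x a, .seq h1 (.op _ _ _ _ _), ?_, ⟨fun y hy => ?_, h3.2⟩, hQ⟩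
  · simp only [WordRAM.asg, Prog.size]; omega
  · by_cases hxy : y = x
    · subst hxy; simp [Config.set, Op.eval, h4, ha, hS]
    · simp only [Config.set, State.set_v, hxy, if_false]
      rw [Function.update_of_ne (reg_ne (by omega) (by omega) hxy)]
      exact h3.1 y hy

theorem WP.seq {i j : ℕ} (h : WP w S m p i (fun s' => WP w S m q j Q s') s) :
    WP w S m (.seq p q) (i + j) Q s := by
  intro st hst
  obtain ⟨s1, t1, u1, h1, h2, h3, h4⟩ := h st hst
  obtain ⟨s2, t2, u2, g1, g2, g3, g4⟩ := h4 s1 h3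
  refine ⟨_, _, _, .seq h1 g1, ?_, g3, g4⟩
  simp only [Prog.size]
  have e1 : p.size * (i + 1) ≤ p.size * (i + j + 1) := Nat.mul_le_mul_left _ (by omega)
  have e2 : q.size * (j + 1) ≤ q.size * (i + j + 1) := Nat.mul_le_mul_left _ (by omega)
  rw [add_mul]
  omega

theorem WP.ite (hB : Wide w S) {i : ℕ} (hok : e.Ok = true) (hs : e.Safe S m s.v)
    (h1 : e.eval m s.v ≠ 0 → WP w S m p i Q s) (h2 : e.eval m s.v = 0 → WP w S m q i Q s) :
    WP w S m (ite e p q) i Q s := by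
  intro st hst
  obtain ⟨s1, t, g1, g2, g3, g4⟩ := hst.code hB hok hs
  by_cases h0 : e.eval m s.v = 0
  · obtain ⟨s2, t2, u2, a1, a2, a3, a4⟩ := h2 h0 s1 g3
    refine ⟨_, _, _, .seq g1 (.branch_false ?_ a1), ?_, a3, a4⟩
    · rw [← BitVec.toNat_inj, g4, h0]; simp
    · simp only [WordRAM.ite, Prog.size]
      nlinarith [Nat.zero_le (p.size * (i + 1)), Nat.zero_le ((e.code 40).size * i)]
  · obtain ⟨s2, t2, u2, a1, a2, a3, a4⟩ := h1 h0 s1 g3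
    refine ⟨_, _, _, .seq g1 (.branch_true ?_ a1), ?_, a3, a4⟩
    · intro h; apply h0; rw [← g4, h]; simp
    · simp only [WordRAM.ite, Prog.size]
      nlinarith [Nat.zero_le (q.size * (i + 1)), Nat.zero_le ((e.code 40).size * i)]

theorem WP.whl_false (hB : Wide w S) (hok : e.Ok = true) (hs : e.Safe S m s.v)
    (h0 : e.eval m s.v = 0) (hQ : Q s) : WP w S m (whl e p) 0 Q s := by
  intro st hst
  obtain ⟨s1, t, g1, g2, g3, g4⟩ := hst.code hB hok hs
  refine ⟨_, _, _, .seq g1 (.loop_false ?_), ?_, g3, hQ⟩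
  · rw [← BitVec.toNat_inj, g4, h0]; simp
  · simp only [whl, Prog.size]; omega

theorem WP.whl_true (hB : Wide w S) {i j : ℕ} (hok : e.Ok = true) (hs : e.Safe S m s.v)
    (h0 : e.eval m s.v ≠ 0) (h : WP w S m p i (fun s' => WP w S m (whl e p) j Q s') s) :
    WP w S m (whl e p) (i + 1 + j) Q s := by
  intro st hst
  obtain ⟨s1, t, g1, g2, g3, g4⟩ := hst.code hB hok hs
  obtain ⟨s2, t2, u2, a1, a2, a3, a4⟩ := h s1 g3
  obtain ⟨s3, t3, u3, b1, b2, b3, b4⟩ := a4 s2 a3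
  cases b1 with
  | seq c1 c2 =>
    refine ⟨_, _, _, .seq g1 (.loop_true ?_ (.seq a1 c1) c2), ?_, b3, b4⟩
    · intro h; apply h0; rw [← g4, h]; simp
    · simp only [whl, Prog.size] at b2 ⊢
      nlinarith [Nat.zero_le (p.size * (i + 1)), Nat.zero_le ((e.code 40).size * i)]

/-- The rule for loops: an invariant that is indexed by a bound for the number of iterations. -/
theorem WP.whl (hB : Wide w S) {b : ℕ} (I : ℕ → State → Prop) (hok : e.Ok = true)
    (hsafe : ∀ n s, I n s → e.Safe S m s.v)
    (hstep : ∀ n s, I n s → e.eval m s.v ≠ 0 → ∃ n', n = n' + 1 ∧ WP w S m p b (I n') s)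
    (hexit : ∀ n s, I n s → e.eval m s.v = 0 → Q s) {n : ℕ} (hI : I n s) :
    WP w S m (whl e p) (n * (b + 1)) Q s := by
  induction n generalizing s with
  | zero =>
    have h0 : e.eval m s.v = 0 := by
      by_contra h0
      obtain ⟨n', h, _⟩ := hstep _ _ hI h0
      omega
    exact (WP.whl_false hB hok (hsafe _ _ hI) h0 (hexit _ _ hI h0)).mono (by omega) fun _ => id
  | succ n ih =>
    by_cases h0 : e.eval m s.v = 0
    · exact (WP.whl_false hB hok (hsafe _ _ hI) h0 (hexit _ _ hI h0)).mono (by omega) fun _ => id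
    · obtain ⟨n', h, hw⟩ := hstep _ _ hI h0
      obtain rfl : n' = n := by omega
      refine (WP.whl_true hB hok (hsafe _ _ hI) h0
        (hw.mono le_rfl fun s' hs' => ih hs')).mono (le_of_eq ?_) fun _ => id
      ring

theorem WP.next_nil {r x : ℕ} (hx : x < 40) (hi : s.inp = [])
    (hQ : Q (s.set x 0)) : WP w S m (.next (reg r) (reg x)) 0 Q s := by
  intro st hst
  obtain ⟨f, inp⟩ := st
  have h2 : inp = [] := by have := hst.2; simpa [hi] using this
  subst h2
  refine ⟨_, _, s.set x 0, .next_nil _ _ _, by simp [Prog.size], ⟨fun y hy => ?_, ?_⟩, hQ⟩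
  · by_cases hxy : y = x
    · subst hxy; simp [Config.set]
    · simp only [Config.set, State.set_v, hxy, if_false]
      rw [Function.update_of_ne (reg_ne (by omega) (by omega) hxy)]
      exact hst.1 y hy
  · simp [Config.set, hi]

theorem WP.next_cons {r x a : ℕ} {l : List ℕ} (hB : Wide w S) (hr : r < 40) (hx : x < 40)
    (hi : s.inp = a :: l) (ha : a ≤ S) (hQ : Q ((State.set ⟨s.v, l⟩ r a).set x 1)) :
    WP w S m (.next (reg r) (reg x)) 0 Q s := by
  intro st hst
  obtain ⟨f, inp⟩ := st
  have h2 : inp = BitVec.ofNat w a :: l.map (BitVec.ofNat w) := by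
    have := hst.2; simpa [hi] using this
  subst h2
  have h1 : 1 ≤ S := by have := hB.two_le; omega
  refine ⟨_, _, (State.set ⟨s.v, l⟩ r a).set x 1, .next_cons _ _ _ _ _, by simp [Prog.size],
    ⟨fun y hy => ?_, ?_⟩, hQ⟩
  · by_cases hxy : y = x
    · subst hxy
      have := hB.le_lt h1
      simp [Config.set, Nat.mod_eq_of_lt this, h1]
    · simp only [Config.set, State.set_v, hxy, if_false]
      rw [Function.update_of_ne (reg_ne (by omega) (by omega) hxy)]
      by_cases hyr : y = r
      · subst hyr; simp [Nat.mod_eq_of_lt (hB.le_lt ha), ha]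
      · simp only [hyr, if_false]
        rw [Function.update_of_ne (reg_ne (by omega) (by omega) hyr)]
        exact hst.1 y hy
  · simp [Config.set]

end rules

/-! ### Layout of the memory -/

theorem num_append (a b : List Bool) : num (a ++ b) = num a + 2 ^ a.length * num b := by
  induction a with
  | nil => simp [num]
  | cons x a ih =>
    simp only [List.cons_append, num, ih, List.length_cons, Nat.bit_val, pow_succ]
    ring

theorem num_lt (a : List Bool) : num a < 2 ^ a.length := by
  induction a with
  | nil => simp [num]
  | cons x a ih =>
    simp only [num, List.length_cons, Nat.bit_val, pow_succ]
    have : x.toNat ≤ 1 := Bool.toNat_le x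
    omega

theorem rd_append_right (a b : List Bool) (p l : ℕ) : rd (a ++ b) (a.length + p) l = rd b p l := by
  rw [rd, rd, num_append, pow_add, ← Nat.div_div_eq_div_mul,
    Nat.add_mul_div_left _ _ (by positivity), Nat.div_eq_of_lt (num_lt a), zero_add]

theorem rd_append_left (a b : List Bool) {p l : ℕ} (h : p + l ≤ a.length) :
    rd (a ++ b) p l = rd a p l := by
  apply Nat.eq_of_testBit_eq
  intro i
  rw [testBit_rd, testBit_rd]
  by_cases hi : i < l
  · rw [testBit_num, testBit_num, List.getD_append _ _ _ _ (by omega)]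
  · simp [hi]

/-- The `w` low bits of `a`. -/
def bits (w a : ℕ) : List Bool := (List.range w).map a.testBit

@[simp] theorem length_bits (w a : ℕ) : (bits w a).length = w := by simp [bits]

theorem num_bits {w a : ℕ} (h : a < 2 ^ w) : num (bits w a) = a := by
  apply Nat.eq_of_testBit_eq
  intro i
  rw [testBit_num, bits]
  by_cases hi : i < w
  · simp [List.getD_eq_getElem?_getD, hi]
  · have : a.testBit i = false :=
      Nat.testBit_lt_two_pow (h.trans_le (Nat.pow_le_pow_right (by omega) (by omega)))
    simp [List.getD_eq_getElem?_getD, hi, this]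

theorem rd_bits {w a : ℕ} (h : a < 2 ^ w) : rd (bits w a) 0 w = a := by
  rw [rd, num_bits h, pow_zero, Nat.div_one, Nat.mod_eq_of_lt h]

/-- An array of `c` fields of `w` bits. -/
def arr (w : ℕ) : ℕ → (ℕ → ℕ) → List Bool
  | 0, _ => []
  | c + 1, f => bits w (f 0) ++ arr w c fun i => f (i + 1)

@[simp] theorem length_arr (w c : ℕ) (f : ℕ → ℕ) : (arr w c f).length = c * w := by
  induction c generalizing f with
  | zero => simp [arr]
  | succ c ih => simp [arr, ih]; ring

theorem rd_arr {w c : ℕ} {f : ℕ → ℕ} {i : ℕ} (hi : i < c) (h : f i < 2 ^ w) :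
    rd (arr w c f) (i * w) w = f i := by
  induction c generalizing f i with
  | zero => omega
  | succ c ih =>
    cases i with
    | zero =>
      rw [arr, zero_mul, rd_append_left _ _ (by simp), rd_bits h]
    | succ i =>
      have := rd_append_right (bits w (f 0)) (arr w c fun i => f (i + 1)) (i * w) w
      rw [length_bits] at this
      rw [arr, add_mul, one_mul, add_comm, this]
      exact ih (by omega) h

/-- The list `a` occurs in `m` at the address `p`. -/
def Holds (m : List Bool) (p : ℕ) (a : List Bool) : Prop :=
  ∃ u v, m = u ++ a ++ v ∧ u.length = p

theorem Holds.left {m : List Bool} {p : ℕ} {a b : List Bool} (h : Holds m p (a ++ b)) :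
    Holds m p a := by
  obtain ⟨u, v, rfl, rfl⟩ := h
  exact ⟨u, b ++ v, by simp, rfl⟩

theorem Holds.right {m : List Bool} {p : ℕ} {a b : List Bool} (h : Holds m p (a ++ b)) :
    Holds m (p + a.length) b := by
  obtain ⟨u, v, rfl, rfl⟩ := h
  exact ⟨u ++ a, v, by simp, by simp⟩

theorem Holds.rd {m : List Bool} {p : ℕ} {a : List Bool} (h : Holds m p a) {i l : ℕ}
    (hi : i + l ≤ a.length) : rd m (p + i) l = WordRAM.rd a i l := by
  obtain ⟨u, v, rfl, rfl⟩ := h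
  rw [List.append_assoc, rd_append_right, rd_append_left _ _ hi]

theorem Holds.arr {m : List Bool} {p w c : ℕ} {f : ℕ → ℕ} (h : Holds m p (arr w c f)) {i : ℕ}
    (hi : i < c) (hf : f i < 2 ^ w) : WordRAM.rd m (p + i * w) w = f i := by
  rw [h.rd, rd_arr hi hf]
  rw [length_arr]
  nlinarith

/-- A part of the bits of a field. -/
theorem rd_div_mod (m : List Bool) {p l i j : ℕ} (h : i + j ≤ l) :
    rd m p l / 2 ^ i % 2 ^ j = rd m (p + i) j := by
  apply Nat.eq_of_testBit_eq
  intro x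
  rw [Nat.testBit_mod_two_pow, Nat.testBit_div_two_pow, testBit_rd, testBit_rd]
  by_cases hx : x < j
  · have : x + i < l := by omega
    simp only [hx, this, decide_true, Bool.true_and]
    congr 1
    omega
  · simp [hx]

/-! ### The header of the memory and the main loop

The registers `1, …, 19` hold the fields of the header during the whole run: the field width `L`,
the letter width `l` and the gap `b` between samples in `1`, `2` and `3`, the addresses of a
dictionary in `5, …, 8`, the address of the acceptance bits in `9`, and in the other ones the
parameters of the tables that belong to one of the two encodings. Register `20` holds the state,
`21` the letter, and `22` tells whether there was a letter left. The registers `23, …, 37` are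
scratch registers, and the registers from `40` on serve for the evaluation of expressions. -/

/-- The start of the memory: `L` in unary, and then the numbers `H 1, …, H h` in fields of `L`
bits. -/
def header (L h : ℕ) (H : ℕ → ℕ) : List Bool :=
  bits (L + 1) (2 ^ L) ++ arr L h fun i => H (i + 1)

@[simp] theorem length_header (L h : ℕ) (H : ℕ → ℕ) :
    (header L h H).length = L + 1 + h * L := by
  simp [header]

/-- Loads `L` into register `1`, if it is stored in the first field of the header: the lowest bit
of the first word that is set is the bit number `L`. -/
def loadWidth : Prog (63 + 1) :=
  .seq (.load (reg 40) (reg 0)) <|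
  .seq (.const (reg 41) 1) <|
  .seq (.op .sub (reg 42) (reg 40) (reg 41)) <|
  .seq (.op .and (reg 42) (reg 42) (reg 40)) <|
  .seq (.op .sub (reg 42) (reg 40) (reg 42)) <|
  .seq (.op .div (reg 40) (reg 40) (reg 42)) <|
  .seq (.op .shr (reg 40) (reg 40) (reg 41)) <|
  .op .mod (reg 1) (reg 40) (reg 42)

/-- The lowest set bit of a number `z` is the difference of `z` and the bitwise conjunction of
`z - 1` and `z`. -/
theorem sub_and_pred (L y : ℕ) :
    2 ^ L * (2 * y + 1) - (2 ^ L * (2 * y + 1) - 1 &&& 2 ^ L * (2 * y + 1)) = 2 ^ L := by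
  have hpos : 0 < 2 ^ L := by positivity
  have e1 : 2 ^ L * (2 * y + 1) = 2 ^ (L + 1) * y + 2 ^ L := by rw [pow_succ]; ring
  have e2 : 2 ^ L * (2 * y + 1) - 1 = 2 ^ (L + 1) * y + (2 ^ L - 1) := by rw [e1]; omega
  have e3 : (2 ^ (L + 1) * y + (2 ^ L - 1)) &&& (2 ^ (L + 1) * y + 2 ^ L) = 2 ^ (L + 1) * y := by
    have l1 : 2 ^ L < 2 ^ (L + 1) := Nat.pow_lt_pow_right (by omega) (by omega)
    apply Nat.eq_of_testBit_eq
    intro i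
    rw [Nat.testBit_and, Nat.testBit_two_pow_mul_add _ (by omega), Nat.testBit_two_pow_mul_add _ l1,
      Nat.testBit_two_pow_mul, Nat.testBit_two_pow_sub_one, Nat.testBit_two_pow]
    by_cases h : i < L + 1
    · have h' : ¬ i ≥ L + 1 := by omega
      simp only [h, h', if_true, decide_false, Bool.false_and]
      by_cases h2 : i < L
      · simp [h2, h2.ne']
      · simp [h2]
    · have h' : i ≥ L + 1 := by omega
      simp [h, h']
  rw [e2, e1, e3]
  omega

/-- The first word is longer than `2 * L`, so it contains the unary part of the header and the first
field, whose value is `L`. -/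
theorem word_zero_of_header {w L h : ℕ} {H : ℕ → ℕ} {m : List Bool} (hh : 1 ≤ h) (hL : H 1 = L)
    (hw : 2 * L + 1 ≤ w) (hm : Holds m 0 (header L h H)) :
    ∃ y, (word w m 0).toNat = 2 ^ L * (2 * y + 1) ∧ y % 2 ^ L = L := by
  have h1 : rd m 0 (L + 1) = 2 ^ L := by
    have h := hm.left.rd (i := 0) (l := L + 1) (by simp)
    rw [rd_bits (Nat.pow_lt_pow_right (by omega) (by omega))] at h
    exact h
  have h2 : rd m (L + 1) L = L := by
    have h := hm.right.arr (i := 0) (by omega)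
      (by simp only [zero_add, hL]; exact Nat.lt_two_pow_self)
    simpa [hL] using h
  have e : (word w m 0).toNat = rd m 0 w := by rw [word_toNat, rd, zero_mul]
  refine ⟨rd m 0 w / 2 ^ (L + 1), ?_, ?_⟩
  · have h3 := rd_div_mod m (p := 0) (l := w) (i := 0) (j := L + 1) (by omega)
    rw [h1, pow_zero, Nat.div_one] at h3
    have h4 := Nat.div_add_mod (rd m 0 w) (2 ^ (L + 1))
    rw [e, ← h4, h3, pow_succ]
    simp only [← pow_succ]
    rw [Nat.mul_add_div (by positivity), Nat.div_eq_of_lt (Nat.pow_lt_pow_right (by omega)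
      (by omega : L < L + 1)), pow_succ]
    ring
  · have h3 := rd_div_mod m (p := 0) (l := w) (i := L + 1) (j := L) (by omega)
    rw [h3, zero_add, h2]

theorem exec_loadWidth {w S L h : ℕ} {H : ℕ → ℕ} {m : List Bool} (hB : Wide w S) (hh : 1 ≤ h)
    (hL : H 1 = L) (hLS : 2 ^ L ≤ S) (hm : Holds m 0 (header L h H)) (inp : List ℕ) :
    ∃ st : Config (63 + 1) w,
      Exec m loadWidth ⟨fun _ => 0, inp.map (BitVec.ofNat w)⟩ st 8 ∧
      Rep S st (State.set ⟨fun _ => 0, inp⟩ 1 L) := by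
  have hw : 2 * L + 1 ≤ w := by
    have h1 : (2 ^ L) ^ 64 < 2 ^ w := (Nat.pow_le_pow_left hLS 64).trans_lt hB.lt
    rw [← pow_mul] at h1
    have := (Nat.pow_lt_pow_iff_right (by omega : 1 < 2)).1 h1
    omega
  obtain ⟨y, h1, h2⟩ := word_zero_of_header hh hL hw hm
  have hw1 := hB.one_lt
  have hone : (BitVec.ofNat w 1).toNat = 1 := by
    simp [Nat.mod_eq_of_lt (Nat.one_lt_two_pow (by omega : w ≠ 0))]
  refine ⟨_, .seq (.load _ _ _) <| .seq (.const _ _ _) <| .seq (.op ..) <| .seq (.op ..) <|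
    .seq (.op ..) <| .seq (.op ..) <| .seq (.op ..) (.op ..), ?_, ?_⟩
  · intro x hx
    have n0 : reg x ≠ reg 40 := reg_ne (by omega) (by omega) (by omega)
    have n1 : reg x ≠ reg 41 := reg_ne (by omega) (by omega) (by omega)
    have n2 : reg x ≠ reg 42 := reg_ne (by omega) (by omega) (by omega)
    by_cases hx1 : x = 1
    · subst hx1
      have a1 : reg 40 ≠ reg 41 := by decide
      have a2 : reg 40 ≠ reg 42 := by decide
      have a3 : reg 41 ≠ reg 42 := by decide
      simp only [Config.set, Function.update_self, Function.update_of_ne, ne_eq, a1, a2, a3,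
        a1.symm, a2.symm, not_false_eq_true, State.set_v, if_true]
      have hx0 : (word w m (BitVec.toNat (0 : BitVec w))).toNat = 2 ^ L * (2 * y + 1) := by
        simpa using h1
      generalize word w m (BitVec.toNat (0 : BitVec w)) = z at hx0
      have hpos : 0 < 2 ^ L := by positivity
      have hz1 : 1 ≤ z.toNat := by rw [hx0]; exact Nat.mul_pos hpos (by omega)
      have hz2 : (z - BitVec.ofNat w 1).toNat = z.toNat - 1 := by
        rw [BitVec.toNat_sub_of_le (by rw [BitVec.le_def, hone]; exact hz1), hone]
      have hz3 : (z - ((z - BitVec.ofNat w 1) &&& z)).toNat = 2 ^ L := by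
        rw [BitVec.toNat_sub_of_le, BitVec.toNat_and, hz2, hx0]
        · exact sub_and_pred L y
        · rw [BitVec.le_def, BitVec.toNat_and]
          exact Nat.and_le_right
      simp only [Op.eval, BitVec.ushiftRight_eq', BitVec.toNat_umod, BitVec.toNat_ushiftRight,
        BitVec.toNat_udiv, hz3, hone, hx0, Nat.mul_div_cancel_left _ hpos]
      have e : (2 * y + 1) >>> 1 = y := by rw [Nat.shiftRight_eq_div_pow]; omega
      rw [e, h2]
      exact ⟨rfl, (Nat.lt_two_pow_self).le.trans hLS⟩
    · have n3 : reg x ≠ reg 1 := reg_ne (by omega) (by omega) hx1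
      simp [Config.set, n0, n1, n2, n3, hx1]
  · simp [Config.set]

/-- The field of the header that belongs to register `i`. -/
def fieldExpr (i : ℕ) : Expr := .read (.bin .add (.bin .mul (.lit i) (.var 1)) (.lit 1)) (.var 1)

/-- Loads the header fields number `2, …, h + 1` into the registers of the same number. -/
def loadFields : ℕ → Prog (63 + 1)
  | 0 => asg 1 (.var 1)
  | h + 1 => .seq (loadFields h) (asg (h + 2) (fieldExpr (h + 2)))

/-- The registers `1, …, h` contain the header. -/
def Loaded (h : ℕ) (H : ℕ → ℕ) (s : State) : Prop := ∀ i, 1 ≤ i → i ≤ h → s.v i = H i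

/-- The fields are loaded one after the other, by straight-line code. -/
theorem wp_loadFields {w S L h k : ℕ} {H : ℕ → ℕ} {m : List Bool} (hB : Wide w S) (hh : k + 1 ≤ h)
    (hk : k + 1 < 40) (hS : 40 ≤ S)
    (hL : H 1 = L) (hLS : 2 ^ L ≤ S) (hH : ∀ i, H i < 2 ^ L) (hm : Holds m 0 (header L h H))
    (s : State) (hs : s.v 1 = L) :
    WP w S m (loadFields k) 0 (fun s' => Loaded (k + 1) H s' ∧
      (∀ i, i = 0 ∨ k + 1 < i → s'.v i = s.v i) ∧ s'.inp = s.inp) s := by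
  induction k with
  | zero =>
    refine WP.asg hB L (by omega) rfl trivial hs ((Nat.lt_two_pow_self).le.trans hLS)
      ⟨fun i h1 h2 => ?_, fun i hi => ?_, rfl⟩
    · obtain rfl : i = 1 := by omega
      simp [hL]
    · have : i ≠ 1 := by omega
      simp [this]
  | succ k ih =>
    refine WP.seq (i := 0) (j := 0) ((ih (by omega) (by omega)).mono le_rfl ?_)
    rintro s1 ⟨h1, h2, h3⟩
    have hL1 : s1.v 1 = L := (h1 1 le_rfl (by omega)).trans hL
    have hval : rd m ((k + 2) * L + 1) L = H (k + 2) := by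
      have h := hm.right.arr (i := k + 1) (by omega) (hH _)
      rw [← h, length_bits]
      congr 1
      ring
    refine WP.asg hB (H (k + 2)) (by omega) ?_ ?_ ?_ ((hH _).le.trans hLS)
      ⟨fun i h4 h5 => ?_, fun i hi => ?_, h3⟩
    · simp [Expr.Ok, fieldExpr, Expr.height, Expr.Closed, Expr.deg]
    · simp only [fieldExpr, Expr.Safe, Op.Safe, Expr.eval, hL1, hLS, and_true]
      omega
    · simp only [fieldExpr, Expr.eval, Op.nat, hL1]
      exact hval
    · simp only [State.set_v]
      split_ifs with h
      · rw [h]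
      · exact h1 i h4 (by omega)
    · have : i ≠ k + 2 := by omega
      simp only [State.set_v, this, if_false]
      exact h2 i (by omega)

/-- The loop over the input: the state of the automaton is in register `20`, the letter in register
`21`. -/
def mainLoop (step : Prog (63 + 1)) : Prog (63 + 1) :=
  .seq (.next (reg 21) (reg 22)) (whl (.var 22) (.seq step (.next (reg 21) (reg 22))))

theorem wp_mainLoop {w S b n σ : ℕ} {H : ℕ → ℕ} {m : List Bool} (hB : Wide w S)
    (step : Prog (63 + 1)) (d : ℕ → ℕ) (hσ : σ ≤ S) (hd : ∀ t, d t < n)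
    (hstep : ∀ s, Loaded 19 H s → s.v 20 < n → s.v 21 < σ → WP w S m step b
      (fun s' => Loaded 19 H s' ∧ s'.v 20 = d (σ * s.v 20 + s.v 21) ∧ s'.inp = s.inp) s)
    (s : State) (hs : Loaded 19 H s) (hq : s.v 20 < n) (hx : ∀ a ∈ s.inp, a < σ) :
    WP w S m (mainLoop step) (s.inp.length * (b + 1))
      (fun s' => Loaded 19 H s' ∧ s'.v 20 = s.inp.foldl (fun q a => d (σ * q + a)) (s.v 20)) s := by
  set Q : ℕ → State → Prop := fun r s' => Loaded 19 H s' ∧ s'.v 20 = r with hQ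
  -- The effect of fetching a letter, from which the loop proceeds.
  have key : ∀ (l : List ℕ) (s : State), s.inp = l → Loaded 19 H s → s.v 20 < n →
      (∀ a ∈ l, a < σ) → WP w S m (.next (reg 21) (reg 22)) 0
        (fun s' => WP w S m (whl (.var 22) (.seq step (.next (reg 21) (reg 22))))
          (l.length * (b + 1)) (Q (l.foldl (fun q a => d (σ * q + a)) (s.v 20))) s') s := by
    intro l
    induction l with
    | nil =>
      intro s hi hs hq _
      refine WP.next_nil (by omega) hi ?_
      refine (WP.whl_false hB rfl (by trivial) (by simp [Expr.eval]) ?_).mono (by omega) fun _ => id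
      refine ⟨fun i h1 h2 => ?_, by simp⟩
      have : i ≠ 22 := by omega
      simp only [State.set_v, this, if_false]
      exact hs i h1 h2
    | cons a l ih =>
      intro s hi hs hq hx
      have ha := hx a (by simp)
      refine WP.next_cons hB (by omega) (by omega) hi (by omega) ?_
      set s1 := (State.set ⟨s.v, l⟩ 21 a).set 22 1 with hs1
      have q1 : s1.v 20 = s.v 20 := by simp [hs1]
      have a1 : s1.v 21 = a := by simp [hs1]
      have L1 : Loaded 19 H s1 := by
        intro i h1 h2
        have n1 : i ≠ 22 := by omega
        have n2 : i ≠ 21 := by omega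
        simp only [hs1, State.set_v, n1, n2, if_false]
        exact hs i h1 h2
      refine (WP.whl_true (i := b) (j := l.length * (b + 1)) hB rfl (by trivial)
        (by simp [Expr.eval, hs1]) ?_).mono (by simp; nlinarith) fun _ => id
      refine WP.seq (i := b) (j := 0) ((hstep s1 L1 (by rw [q1]; exact hq)
        (by rw [a1]; exact ha)).mono le_rfl ?_)
      rintro s2 ⟨L2, q2, i2⟩
      have := ih s2 (by rw [i2]; rfl) L2 (by rw [q2]; exact hd _)
        (fun c hc => hx c (by simp [hc]))
      rw [q2, q1, a1] at this
      exact this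
  exact (WP.seq (i := 0) (key s.inp s rfl hs hq hx)).mono (by omega) fun _ => id

/-- Loading the header and running through the input. -/
def runProg (step : Prog (63 + 1)) : Prog (63 + 1) :=
  .seq loadWidth (.seq (loadFields 18) (mainLoop step))

/-- The acceptance bits of the states are stored from the address in register `9` on. -/
def answer : Prog (63 + 1) := asg 0 (.read (.bin .add (.var 9) (.var 20)) (.lit 1))

/-- The program that simulates the automaton, given the code `step` for the transition function. -/
def fullProg (step : Prog (63 + 1)) : Prog (63 + 1) := .seq (runProg step) answer

/-- If `step` computes the transition function `d` within `b` loop iterations, then the program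
follows the run of the automaton, and its answer is the acceptance bit of the last state. -/
theorem run_fullProg {w S L b n σ : ℕ} {H : ℕ → ℕ} {m : List Bool} (hB : Wide w S) (hS : 40 ≤ S)
    (step : Prog (63 + 1)) (d : ℕ → ℕ) (acc : ℕ → ℕ) (hσ : σ ≤ S) (hd : ∀ t, d t < n)
    (hstep : ∀ s, Loaded 19 H s → s.v 20 < n → s.v 21 < σ → WP w S m step b
      (fun s' => Loaded 19 H s' ∧ s'.v 20 = d (σ * s.v 20 + s.v 21) ∧ s'.inp = s.inp) s)
    (hL : H 1 = L) (hLS : 2 ^ L ≤ S) (hH : ∀ i, H i < 2 ^ L) (hm : Holds m 0 (header L 19 H))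
    (hacc : Holds m (H 9) (arr 1 n acc)) (hacc2 : ∀ i, acc i < 2)
    (x : List (Fin σ)) :
    ∃ st T, Exec m (runProg step) (initial (63 + 1) w x) st T ∧
      (st.regs (reg 20)).toNat = (x.map Fin.val).foldl (fun q a => d (σ * q + a)) 0 ∧
      ∃ st' T', Exec m answer st st' T' ∧
        T + T' ≤ (fullProg step).size * (x.length * (b + 1) + 1) ∧
        (st'.regs 0 ≠ 0 ↔ acc ((x.map Fin.val).foldl (fun q a => d (σ * q + a)) 0) ≠ 0) := by
  have hn : 0 < n := (Nat.zero_le _).trans_lt (hd 0)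
  set xs : List ℕ := x.map Fin.val with hxs
  have hlen : xs.length = x.length := by simp [hxs]
  have hinit : initial (63 + 1) w x = ⟨fun _ => 0, xs.map (BitVec.ofNat w)⟩ := by
    rw [hxs, initial]
    congr 1
    clear_value xs
    clear hxs hlen
    induction x with
    | nil => rfl
    | cons a x ih => exact congrArg (List.cons (BitVec.ofNat w a)) ih
  obtain ⟨st1, e1, r1⟩ := exec_loadWidth hB (by omega) hL hLS hm xs
  set s1 := State.set ⟨fun _ => 0, xs⟩ 1 L with hs1
  have hlt : xs.foldl (fun q a => d (σ * q + a)) 0 < n := by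
    clear_value xs
    induction xs using List.reverseRecOn with
    | nil => exact hn
    | append_singleton l a _ =>
      simp only [List.foldl_append, List.foldl_cons, List.foldl_nil]
      exact hd _
  have hrun : WP w S m (.seq (loadFields 18) (mainLoop step)) (xs.length * (b + 1))
      (fun s' => Loaded 19 H s' ∧ s'.v 20 = xs.foldl (fun q a => d (σ * q + a)) 0) s1 := by
    refine (WP.seq (i := 0) (j := xs.length * (b + 1)) ((wp_loadFields hB (by omega) (by omega) hS
      hL hLS hH hm s1 (by simp [hs1])).mono le_rfl ?_)).mono (by omega) fun _ => id
    rintro s2 ⟨L2, f2, i2⟩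
    have q2 : s2.v 20 = 0 := by rw [f2 20 (by omega)]; simp [hs1]
    have := wp_mainLoop hB step d hσ hd hstep s2 L2 (by omega)
      (by rw [i2, hs1]; simp [hxs])
    rw [i2, q2] at this
    exact this
  obtain ⟨st2, t2, s2, e2, b2, r2, L2, q2⟩ := hrun st1 r1
  have hans : WP w S m answer 0 (fun s' => s'.v 0 = acc (s2.v 20)) s2 := by
    have h9 : s2.v 9 = H 9 := L2 9 (by omega) (by omega)
    refine WP.asg hB (acc (s2.v 20)) (by omega) rfl ?_ ?_ ?_ (by simp)
    · simp only [Expr.Safe, Op.Safe, Expr.eval, and_true, true_and]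
      omega
    · simp only [Expr.eval, Op.nat, h9]
      have := hacc.arr (i := s2.v 20) (by rw [q2]; exact hlt) (hacc2 _)
      rw [mul_one] at this
      exact this
    · have := hacc2 (s2.v 20); omega
  obtain ⟨st3, t3, s3, e3, b3, r3, v3⟩ := hans st2 r2
  rw [hinit]
  refine ⟨st2, 8 + t2, .seq e1 e2, ?_, st3, t3, e3, ?_, ?_⟩
  · rw [(r2.1 20 (by omega)).1, q2]
  · have hlw : loadWidth.size = 8 := rfl
    simp only [fullProg, runProg, Prog.size, hlw] at b2 b3 ⊢
    rw [hlen] at b2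
    nlinarith [Nat.zero_le (answer.size * (x.length * (b + 1)))]
  · have h0 := (r3.1 0 (by omega)).1
    rw [v3, q2] at h0
    rw [← h0]
    have : reg 0 = 0 := rfl
    rw [this, not_iff_not, ← BitVec.toNat_inj]
    simp

/-! ### Notation for expressions -/

namespace Expr

instance : Add Expr := ⟨.bin .add⟩
instance : Sub Expr := ⟨.bin .sub⟩
instance : Mul Expr := ⟨.bin .mul⟩
instance : Div Expr := ⟨.bin .div⟩
instance : Mod Expr := ⟨.bin .mod⟩

/-- The expression with value `1` if `a < b` and `0` otherwise. -/
def less (a b : Expr) : Expr := .bin .lt a b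

/-- The expression with value `1` if `a = b` and `0` otherwise. -/
def same (a b : Expr) : Expr := .bin .eq a b

/-- The expression for a power of two. -/
def pow2 (a : Expr) : Expr := .bin .shl (.lit 1) a

variable {S : ℕ} {m : List Bool} {v : ℕ → ℕ} {a b : Expr}

@[simp] theorem eval_lit (c : ℕ) : (lit c).eval m v = c := rfl
@[simp] theorem eval_var (x : ℕ) : (var x).eval m v = v x := rfl
@[simp] theorem eval_add : (a + b).eval m v = a.eval m v + b.eval m v := rfl
@[simp] theorem eval_sub : (a - b).eval m v = a.eval m v - b.eval m v := rfl
@[simp] theorem eval_mul : (a * b).eval m v = a.eval m v * b.eval m v := rfl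
@[simp] theorem eval_div : (a / b).eval m v = a.eval m v / b.eval m v := rfl
@[simp] theorem eval_mod : (a % b).eval m v = a.eval m v % b.eval m v := rfl
@[simp] theorem eval_less :
    (less a b).eval m v = if a.eval m v < b.eval m v then 1 else 0 := rfl
@[simp] theorem eval_same :
    (same a b).eval m v = if a.eval m v = b.eval m v then 1 else 0 := rfl
@[simp] theorem eval_pow2 : (pow2 a).eval m v = 2 ^ a.eval m v := one_mul _
@[simp] theorem eval_read : (read a b).eval m v = rd m (a.eval m v) (b.eval m v) := rfl

@[simp] theorem safe_lit (c : ℕ) : (lit c).Safe S m v ↔ c ≤ S := Iff.rfl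
@[simp] theorem safe_var (x : ℕ) : (var x).Safe S m v := trivial
@[simp] theorem safe_add : (a + b).Safe S m v ↔ a.Safe S m v ∧ b.Safe S m v := by
  change _ ∧ _ ∧ True ↔ _; simp
@[simp] theorem safe_sub :
    (a - b).Safe S m v ↔ a.Safe S m v ∧ b.Safe S m v ∧ b.eval m v ≤ a.eval m v := Iff.rfl
@[simp] theorem safe_mul : (a * b).Safe S m v ↔ a.Safe S m v ∧ b.Safe S m v := by
  change _ ∧ _ ∧ True ↔ _; simp
@[simp] theorem safe_div : (a / b).Safe S m v ↔ a.Safe S m v ∧ b.Safe S m v := by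
  change _ ∧ _ ∧ True ↔ _; simp
@[simp] theorem safe_mod : (a % b).Safe S m v ↔ a.Safe S m v ∧ b.Safe S m v := by
  change _ ∧ _ ∧ True ↔ _; simp
@[simp] theorem safe_less : (less a b).Safe S m v ↔ a.Safe S m v ∧ b.Safe S m v := by
  change _ ∧ _ ∧ True ↔ _; simp
@[simp] theorem safe_same : (same a b).Safe S m v ↔ a.Safe S m v ∧ b.Safe S m v := by
  change _ ∧ _ ∧ True ↔ _; simp
@[simp] theorem safe_pow2 :
    (pow2 a).Safe S m v ↔ 1 ≤ S ∧ a.Safe S m v ∧ 2 ^ a.eval m v ≤ S := by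
  change _ ∧ _ ∧ 1 * _ ≤ S ↔ _; rw [one_mul]; rfl
@[simp] theorem safe_read :
    (read a b).Safe S m v ↔ a.Safe S m v ∧ b.Safe S m v ∧ 2 ^ b.eval m v ≤ S := Iff.rfl

end Expr

/-- The states `s` and `s'` agree on the first `k` variables and on the input. -/
def Agree (k : ℕ) (s s' : State) : Prop := (∀ i < k, s'.v i = s.v i) ∧ s'.inp = s.inp

theorem Agree.refl {k : ℕ} (s : State) : Agree k s s := ⟨fun _ _ => rfl, rfl⟩

theorem Agree.set {k : ℕ} {s s' : State} (h : Agree k s s') {x : ℕ} (hx : k ≤ x) (a : ℕ) :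
    Agree k s (s'.set x a) := by
  refine ⟨fun i hi => ?_, h.2⟩
  have : i ≠ x := by omega
  simp only [State.set_v, this, if_false]
  exact h.1 i hi

theorem Agree.trans {k : ℕ} {s s' s'' : State} (h : Agree k s s') (h' : Agree k s' s'') :
    Agree k s s'' :=
  ⟨fun i hi => (h'.1 i hi).trans (h.1 i hi), h'.2.trans h.2⟩

theorem Agree.mono {k l : ℕ} {s s' : State} (h : Agree k s s') (hl : l ≤ k) : Agree l s s' :=
  ⟨fun i hi => h.1 i (by omega), h.2⟩

/-! ### Ranks in a strictly increasing sequence -/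

/-- The number of terms below `x` among the first `T` terms of a sequence. -/
def rank (T : ℕ) (τ : ℕ → ℕ) (x : ℕ) : ℕ := ((Finset.range T).filter fun j => τ j < x).card

/-- The first `T` terms of the sequence are strictly increasing. -/
def Increasing (T : ℕ) (τ : ℕ → ℕ) : Prop := ∀ i j, i < j → j < T → τ i < τ j

theorem rank_le (T : ℕ) (τ : ℕ → ℕ) (x : ℕ) : rank T τ x ≤ T :=
  (Finset.card_filter_le _ _).trans (by simp)

theorem rank_mono (T : ℕ) (τ : ℕ → ℕ) {x y : ℕ} (h : x ≤ y) : rank T τ x ≤ rank T τ y := by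
  refine Finset.card_le_card fun j hj => ?_
  simp only [Finset.mem_filter] at hj ⊢
  exact ⟨hj.1, by omega⟩

theorem rank_zero (T : ℕ) (τ : ℕ → ℕ) : rank T τ 0 = 0 := by simp [rank]

theorem lt_rank_iff {T : ℕ} {τ : ℕ → ℕ} (h : Increasing T τ) {j x : ℕ} (hj : j < T) :
    j < rank T τ x ↔ τ j < x := by
  constructor
  · intro hr
    by_contra hx
    have : rank T τ x ≤ (Finset.range j).card := by
      refine Finset.card_le_card fun i hi => ?_
      simp only [Finset.mem_filter, Finset.mem_range] at hi ⊢
      by_contra hij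
      rcases Nat.lt_or_ge j i with h' | h'
      · have := h j i h' hi.1
        omega
      · obtain rfl : i = j := by omega
        omega
    simp at this
    omega
  · intro hx
    have : (Finset.range (j + 1)).card ≤ rank T τ x := by
      refine Finset.card_le_card fun i hi => ?_
      simp only [Finset.mem_filter, Finset.mem_range] at hi ⊢
      refine ⟨by omega, ?_⟩
      rcases Nat.lt_or_ge i j with h' | h'
      · exact (h i j h' hj).trans hx
      · obtain rfl : i = j := by omega
        exact hx
    simpa using this

theorem Increasing.add_le {T : ℕ} {τ : ℕ → ℕ} (h : Increasing T τ) {i k : ℕ} (hk : i + k < T) :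
    τ i + k ≤ τ (i + k) := by
  induction k with
  | zero => simp
  | succ k ih =>
    have := ih (by omega)
    have := h (i + k) (i + (k + 1)) (by omega) hk
    omega

/-- There are at most `k` terms in an interval of length `k`; in particular, an out-degree is at
most `σ` and fits into a field of `l` bits. -/
theorem rank_add_le {T : ℕ} {τ : ℕ → ℕ} (h : Increasing T τ) (x k : ℕ) :
    rank T τ (x + k) ≤ rank T τ x + k := by
  by_contra hlt
  push Not at hlt
  have hT := rank_le T τ (x + k)
  have h1 := (lt_rank_iff h (j := rank T τ x + k) (x := x + k) (by omega)).1 hlt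
  have h2 := h.add_le (i := rank T τ x) (k := k) (by omega)
  have h3 : ¬ τ (rank T τ x) < x := fun h' =>
    lt_irrefl _ ((lt_rank_iff h (j := rank T τ x) (by omega)).2 h')
  omega

/-! ### A dictionary for sparse sets of pairs of a state and a letter -/

/-- The number of terms of the sequence that belong to states before `q`, where the pair of `q` and
`a` has the number `σ * q + a`. -/
def pre (σ T : ℕ) (τ : ℕ → ℕ) (q : ℕ) : ℕ := rank T τ (σ * q)

/-- The sum of the first `k` digits of `v` in base `2 ^ l`. -/
def digitSum (l k v : ℕ) : ℕ := ∑ i ∈ Finset.range k, v / 2 ^ (i * l) % 2 ^ l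

/-- The prefix sums `pre q` for every `b`-th state `q`. -/
def samples (n σ L b T : ℕ) (τ : ℕ → ℕ) : List Bool := arr L (n / b + 1) fun j => pre σ T τ (j * b)

/-- The increments of the prefix sums. -/
def increments (n σ l T : ℕ) (τ : ℕ → ℕ) : List Bool :=
  arr l n fun q => pre σ T τ (q + 1) - pre σ T τ q

/-- The table of the sums of fewer than `b` fields of `l` bits. -/
def sumTable (L l b : ℕ) : List Bool := arr L (2 ^ ((b - 1) * l)) (digitSum l (b - 1))

/-- The letters of the pairs. -/
def letters (σ l T : ℕ) (τ : ℕ → ℕ) : List Bool := arr l T fun j => τ j % σ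

/-- The four parts of the dictionary for the first `T` terms of the sequence `τ` of numbers below
`σ * n` are stored at the addresses `B 0`, `B 1`, `B 2` and `B 3`. -/
structure DictAt (m : List Bool) (n σ L l b T : ℕ) (τ : ℕ → ℕ) (B : ℕ → ℕ) : Prop where
  samples : Holds m (B 0) (samples n σ L b T τ)
  increments : Holds m (B 1) (increments n σ l T τ)
  sumTable : Holds m (B 2) (sumTable L l b)
  letters : Holds m (B 3) (letters σ l T τ)

theorem sum_increments {σ T : ℕ} {τ : ℕ → ℕ} (q r : ℕ) :
    ∑ i ∈ Finset.range r, (pre σ T τ (q + i + 1) - pre σ T τ (q + i)) =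
      pre σ T τ (q + r) - pre σ T τ q := by
  have hmono : ∀ a b, a ≤ b → pre σ T τ a ≤ pre σ T τ b := fun a b h =>
    rank_mono _ _ (Nat.mul_le_mul_left _ h)
  induction r with
  | zero => simp
  | succ r ih =>
    rw [Finset.sum_range_succ, ih]
    have := hmono q (q + r) (by omega)
    have := hmono (q + r) (q + r + 1) (by omega)
    rw [← add_assoc]
    omega

/-- A string of fewer than `b` fields, read as one number, is an index into the table of digit sums.
-/
theorem digitSum_rd {m : List Bool} {l k r p : ℕ} (hr : r ≤ k) :
    digitSum l k (rd m p (r * l)) = ∑ i ∈ Finset.range r, rd m (p + i * l) l := by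
  rw [digitSum, ← Finset.sum_subset (Finset.range_mono hr)]
  · refine Finset.sum_congr rfl fun i hi => rd_div_mod m ?_
    have : (i + 1) * l ≤ r * l := Nat.mul_le_mul_right _ (Finset.mem_range.1 hi)
    linarith
  · intro i _ hi
    have h1 : r * l ≤ i * l := Nat.mul_le_mul_right _ (by simpa using hi)
    rw [Nat.div_eq_of_lt ((rd_lt _ _ _).trans_le (Nat.pow_le_pow_right (by omega) h1)),
      Nat.zero_mod]

section dict

variable {m : List Bool} {n σ L l b T : ℕ} {τ : ℕ → ℕ} {B : ℕ → ℕ}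

/-- A prefix sum is the last sample before it plus the sum of the increments since then, which is an
entry of the table. -/
theorem DictAt.rd_pre (hD : DictAt m n σ L l b T τ B) (hτ : Increasing T τ) (hb : 0 < b)
    (hσ : σ < 2 ^ l) (hT : T < 2 ^ L) {q : ℕ} (hq : q ≤ n) :
    rd m (B 0 + q / b * L) L +
      rd m (B 2 + rd m (B 1 + q / b * b * l) (q % b * l) * L) L = pre σ T τ q := by
  have hpT : ∀ q, pre σ T τ q < 2 ^ L := fun q => (rank_le _ _ _).trans_lt hT
  have hmod : q % b < b := Nat.mod_lt _ hb
  have hdm : q / b * b + q % b = q := Nat.div_add_mod' q b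
  rw [hD.samples.arr (Nat.lt_succ_of_le (Nat.div_le_div_right hq)) (hpT _)]
  have hs : digitSum l (b - 1) (rd m (B 1 + q / b * b * l) (q % b * l)) =
      pre σ T τ q - pre σ T τ (q / b * b) := by
    rw [digitSum_rd (by omega), ← congrArg (pre σ T τ) hdm, ← sum_increments]
    refine Finset.sum_congr rfl fun i hi => ?_
    have hi' := Finset.mem_range.1 hi
    have := hD.increments.arr (i := q / b * b + i) (by omega) (by
      refine lt_of_le_of_lt ?_ hσ
      have := rank_add_le hτ (σ * (q / b * b + i)) σ
      simp only [pre]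
      rw [mul_add σ _ 1, mul_one]
      omega)
    rw [← this]
    congr 1
    ring
  have hlt : rd m (B 1 + q / b * b * l) (q % b * l) < 2 ^ ((b - 1) * l) :=
    (rd_lt _ _ _).trans_le
      (Nat.pow_le_pow_right (by omega) (Nat.mul_le_mul_right _ (by omega)))
  rw [hD.sumTable.arr hlt (by rw [hs]; exact (Nat.sub_le _ _).trans_lt (hpT _)), hs]
  have : pre σ T τ (q / b * b) ≤ pre σ T τ q :=
    rank_mono _ _ (Nat.mul_le_mul_left _ (Nat.div_mul_le_self q b))
  omega

/-- The expression for the number of terms before the state `q`; the addresses of the dictionary are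
in the registers from `β` on. -/
def preExpr (β : ℕ) (q : Expr) : Expr :=
  .read (.var β + q / .var 3 * .var 1) (.var 1) +
    .read (.var (β + 2) +
      .read (.var (β + 1) + q / .var 3 * .var 3 * .var 2) (q % .var 3 * .var 2) * .var 1) (.var 1)

/-- The expression for the letter number `j` of the dictionary. -/
def letterExpr (β : ℕ) (j : Expr) : Expr := .read (.var (β + 3) + j * .var 2) (.var 2)

/-- Binary search for the pair of the state in register `20` and the letter in register `21` in the
dictionary: its rank goes into register `23`, and register `27` says whether it was found. -/
def search (β : ℕ) : Prog (63 + 1) :=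
  .seq (asg 23 (preExpr β (.var 20))) <|
  .seq (asg 24 (preExpr β (.var 20 + .lit 1))) <|
  .seq (asg 25 (.var 24)) <|
  .seq (whl (.less (.var 23) (.var 24)) <|
    .seq (asg 26 ((.var 23 + .var 24) / .lit 2)) <|
    ite (.less (letterExpr β (.var 26)) (.var 21))
      (asg 23 (.var 26 + .lit 1)) (asg 24 (.var 26))) <|
  asg 27 (.less (.var 23) (.var 25) * .same (letterExpr β (.var 23)) (.var 21))

/-- Among the terms that belong to the state `q`, the letter determines the term. -/
theorem DictAt.letter (hD : DictAt m n σ L l b T τ B) (hτ : Increasing T τ) (hσ : σ < 2 ^ l)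
    {q j : ℕ} (h0 : 0 < σ) (h1 : pre σ T τ q ≤ j) (h2 : j < pre σ T τ (q + 1)) :
    τ j = σ * q + rd m (B 3 + j * l) l := by
  have hj : j < T := h2.trans_le (rank_le _ _ _)
  have h3 : τ j < σ * (q + 1) := (lt_rank_iff hτ hj).1 h2
  have h4 : ¬ τ j < σ * q := fun h => absurd ((lt_rank_iff hτ hj).2 h) (by simpa [pre] using h1)
  rw [mul_add, mul_one] at h3
  rw [hD.letters.arr hj ((Nat.mod_lt _ h0).trans hσ)]
  obtain ⟨c, hc⟩ := Nat.exists_eq_add_of_le (not_lt.1 h4)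
  rw [hc, Nat.mul_add_mod, Nat.mod_eq_of_lt (by omega)]

/-- The terms that belong to one state form an interval of length at most `σ < 2 ^ l`, so that `l`
iterations are enough. -/
theorem wp_search {w S β : ℕ} (hB : Wide w S) (hβ : β + 3 < 20)
    (hβ' : β = 5 ∨ β = 12) (s : State)
    (hD : DictAt m n σ L l b T τ fun i => s.v (β + i)) (hτ : Increasing T τ) (hb : 0 < b)
    (h0 : 0 < σ) (hσ : σ < 2 ^ l) (hT : T < 2 ^ L) (hLS : 2 ^ L ≤ S) (hlS : 2 ^ l ≤ S)
    (hbS : 2 ^ ((b - 1) * l) ≤ S) (h1 : s.v 1 = L) (h2 : s.v 2 = l) (h3 : s.v 3 = b)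
    (hq : s.v 20 < n) (ha : s.v 21 < σ) :
    WP w S m (search β) l (fun s' => Agree 23 s s' ∧
      s'.v 23 = rank T τ (σ * s.v 20 + s.v 21) ∧
      (s'.v 27 ≠ 0 ↔ s'.v 23 < T ∧ τ (s'.v 23) = σ * s.v 20 + s.v 21)) s := by
  set q := s.v 20 with hqd
  set a := s.v 21 with had
  set r := rank T τ (σ * q + a) with hr
  have hS2 := hB.two_le
  have hpre : ∀ q ≤ n, pre σ T τ q ≤ S := fun q _ => (rank_le _ _ _).trans (hT.le.trans hLS)
  have hmodS : ∀ q, 2 ^ (q % b * l) ≤ S := fun q => le_trans (Nat.pow_le_pow_right (by omega)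
    (Nat.mul_le_mul_right _ (by have := Nat.mod_lt q hb; omega))) hbS
  have hok1 : (preExpr β (.var 20)).Ok = true := by rcases hβ' with rfl | rfl <;> rfl
  have hok2 : (preExpr β (.var 20 + .lit 1)).Ok = true := by rcases hβ' with rfl | rfl <;> rfl
  have hok3 : (Expr.less (letterExpr β (.var 26)) (.var 21)).Ok = true := by
    rcases hβ' with rfl | rfl <;> rfl
  have hok4 : (Expr.less (.var 23) (.var 25) *
      .same (letterExpr β (.var 23)) (.var 21)).Ok = true := by
    rcases hβ' with rfl | rfl <;> rfl
  have hpr1 : pre σ T τ q ≤ r := rank_mono _ _ (by omega)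
  have hpr2 : r ≤ pre σ T τ (q + 1) := rank_mono _ _ (by rw [mul_add]; omega)
  have hp := fun q (hq : q ≤ n) => hD.rd_pre hτ hb hσ hT hq
  simp only [add_zero] at hp
  refine (WP.seq (i := 0) (j := l) (WP.asg hB (pre σ T τ q) (by omega) hok1 ?_ ?_
    (hpre q hq.le) ?_)).mono (by omega) fun _ => id
  · simp [preExpr, h1, h2, h3, hLS, hmodS]
  · rw [← hp q hq.le]
    simp [preExpr, h1, h2, h3, hqd]
  refine (WP.seq (i := 0) (j := l) (WP.asg hB (pre σ T τ (q + 1)) (by omega) hok2 ?_ ?_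
    (hpre _ (by omega)) ?_)).mono (by omega) fun _ => id
  · simp [preExpr, h1, h2, h3, hLS, hmodS, show 1 ≤ S by omega]
  · rw [← hp (q + 1) (by omega)]
    simp [preExpr, h1, h2, h3, hqd, show β ≠ 23 by omega,
      show β + 1 ≠ 23 by omega, show β + 2 ≠ 23 by omega]
  refine (WP.seq (i := 0) (j := l) (WP.asg hB (pre σ T τ (q + 1)) (by omega) rfl (by simp)
    (by simp) (hpre _ (by omega)) ?_)).mono (by omega) fun _ => id
  refine WP.seq (i := l) (j := 0) ?_
  set I : ℕ → State → Prop := fun N s' => Agree 23 s s' ∧ s'.v 25 = pre σ T τ (q + 1) ∧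
    pre σ T τ q ≤ s'.v 23 ∧ s'.v 23 ≤ r ∧ r ≤ s'.v 24 ∧ s'.v 24 ≤ pre σ T τ (q + 1) ∧
    s'.v 24 - s'.v 23 < 2 ^ N with hI
  have hletter : ∀ s', Agree 23 s s' → ∀ e : Expr, (letterExpr β e).eval m s'.v =
      rd m (s.v (β + 3) + e.eval m s'.v * l) l := by
    intro s' hA e
    simp [letterExpr, hA.1 (β + 3) (by omega), hA.1 2 (by omega), h2]
  refine (WP.whl hB (b := 0) (n := l) I rfl (by simp) ?_ ?_ ?_).mono (by omega) fun _ => id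
  · -- One iteration halves the interval, which contains the rank all the time.
    rintro N s' ⟨hA, h25, c1, c2, c3, c4, c5⟩ hc
    have hlt : s'.v 23 < s'.v 24 := by
      by_contra h
      simp [h] at hc
    obtain ⟨N, rfl⟩ : ∃ N', N = N' + 1 := by
      cases N with
      | zero => simp at c5; omega
      | succ N => exact ⟨N, rfl⟩
    refine ⟨N, rfl, ?_⟩
    set mid := (s'.v 23 + s'.v 24) / 2 with hmid
    have hm1 : s'.v 23 ≤ mid := by omega
    have hm2 : mid < s'.v 24 := by omega
    have hmT : mid < T := (hm2.trans_le c4).trans_le (rank_le _ _ _)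
    have hmS : mid + 1 ≤ S := hmT.trans_le (hT.le.trans hLS)
    rw [pow_succ] at c5
    refine WP.seq (i := 0) (j := 0) (WP.asg hB mid (by omega) rfl (by simpa using hS2)
      (by simp [hmid]) (by omega) ?_)
    have hA' : Agree 23 s (s'.set 26 mid) := hA.set (by omega) _
    have hlet := hD.letter hτ hσ h0 (c1.trans hm1) (hm2.trans_le c4)
    have hcmp := lt_rank_iff hτ (x := σ * q + a) hmT
    have hval := hletter _ hA' (.var 26)
    simp only [Expr.eval_var, State.set_v, if_true] at hval
    refine WP.ite hB hok3 ?_ ?_ ?_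
    · simp [letterExpr, hA.1 2 (by omega), h2, hlS]
    · intro h
      have hlt : rd m (s.v (β + 3) + mid * l) l < a := by
        by_contra h'
        apply h
        rw [Expr.eval_less, hval, if_neg]
        simpa [hA.1 21 (by omega), had] using h'
      refine WP.asg hB (mid + 1) (by omega) rfl (by simp; omega) (by simp) hmS ?_
      refine ⟨hA'.set (by omega) _, by simpa using h25, ?_⟩
      simp only [State.set_v]
      norm_num
      have : mid < r := hcmp.2 (by rw [hlet]; omega)
      omega
    · intro h
      have hge : ¬ rd m (s.v (β + 3) + mid * l) l < a := by
        intro h'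
        rw [Expr.eval_less, hval, if_pos] at h
        · exact one_ne_zero h
        · simpa [hA.1 21 (by omega), had] using h'
      refine WP.asg hB mid (by omega) rfl (by simp) (by simp) (by omega) ?_
      refine ⟨hA'.set (by omega) _, by simpa using h25, ?_⟩
      simp only [State.set_v]
      norm_num
      have : ¬ mid < r := fun h' => by have := hcmp.1 h'; omega
      omega
  · rintro N s' ⟨hA, h25, c1, c2, c3, c4, c5⟩ hc
    have hge : s'.v 24 ≤ s'.v 23 := by
      by_contra h
      simp at h
      simp [h] at hc
    have hv : s'.v 23 = r := by omega
    have hval := hletter _ hA (.var 23)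
    simp only [Expr.eval_var, hv] at hval
    refine WP.asg hB (if r < pre σ T τ (q + 1) ∧ rd m (s.v (β + 3) + r * l) l = a then 1 else 0)
      (by omega) hok4 ?_ ?_ (by split_ifs <;> omega) ⟨hA.set (by omega) _, by simp [hv], ?_⟩
    · simp [letterExpr, hA.1 2 (by omega), h2, hlS]
    · rw [Expr.eval_mul, Expr.eval_same, hval]
      simp only [Expr.eval_less, Expr.eval_var, hv, h25, hA.1 21 (by omega), ← had]
      split_ifs <;> first | rfl | omega
    · simp only [State.set_v]
      norm_num
      rw [hv]
      constructor
      · rintro ⟨h4, h5⟩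
        refine ⟨h4.trans_le (rank_le _ _ _), ?_⟩
        rw [hD.letter hτ hσ h0 hpr1 h4]
        simp only [h5]
      · rintro ⟨h4, h5⟩
        have h6 : r < pre σ T τ (q + 1) := (lt_rank_iff hτ h4).2 (by rw [h5, mul_add]; omega)
        refine ⟨h6, ?_⟩
        have := hD.letter hτ hσ h0 hpr1 h6
        omega
  · refine ⟨(((Agree.refl s).set (by omega) _).set (by omega) _).set (by omega) _, ?_⟩
    simp only [State.set_v]
    norm_num
    refine ⟨hpr1, hpr2, ?_⟩
    have := rank_add_le hτ (σ * q) σ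
    simp only [pre]
    rw [mul_add, mul_one]
    omega

end dict

/-! ### Storing an array of blocks almost without loss -/

/-- The least possible number of values of a spill, except for the trivial ones. -/
def zmin (X l : ℕ) : ℕ := (X + 2 * 2 ^ l - 1) / (2 * 2 ^ l)

/-- An approximation from below of the number of bits for two spills. -/
def mu (X l : ℕ) : ℕ := Nat.clog 2 (zmin X l * zmin X l)

/-- The number of bits for a spill that is stored separately. -/
def zeta (X l : ℕ) : ℕ := Nat.clog 2 (2 * zmin X l)

/-- The number of bits of a field that contains two spills with `Z` values each and at least `l`
bits of a block. -/
def nodeWidth (X l Z : ℕ) : ℕ :=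
  l + (mu X l + (if 2 ^ mu X l < Z * Z then 1 else 0) + (if 2 * 2 ^ mu X l < Z * Z then 1 else 0))

/-- The width of the fields at level `h`, if the incoming spills have `Z` values. -/
def widthOf (X l h Z : ℕ) : ℕ := if h = 0 then l else nodeWidth X l Z

/-- The number of values of the spills that come into level `h`. -/
def spillCard (X l : ℕ) : ℕ → ℕ
  | 0 => 1
  | h + 1 =>
    (X + 2 ^ widthOf X l h (spillCard X l h) / (spillCard X l h * spillCard X l h) - 1) /
      (2 ^ widthOf X l h (spillCard X l h) / (spillCard X l h * spillCard X l h))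

/-- The width of the fields at level `h`. -/
def width (X l h : ℕ) : ℕ := widthOf X l h (spillCard X l h)

/-- The number of values of the part of a block that is stored in its own field at level `h`. -/
def keep (X l h : ℕ) : ℕ := 2 ^ width X l h / (spillCard X l h * spillCard X l h)

theorem spillCard_succ (X l h : ℕ) :
    spillCard X l (h + 1) = (X + keep X l h - 1) / keep X l h := rfl

section bounds

variable {X l : ℕ}

theorem zmin_pos (hX : 0 < X) : 0 < zmin X l :=
  Nat.div_pos (by have : 0 < 2 ^ l := by positivity
                  omega) (by positivity)

theorem two_pow_mu (hX : 0 < X) :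
    zmin X l * zmin X l ≤ 2 ^ mu X l ∧ 2 ^ mu X l < 2 * (zmin X l * zmin X l) := by
  refine ⟨Nat.le_pow_clog (by omega) _, ?_⟩
  have h0 := zmin_pos (l := l) hX
  rcases Nat.lt_or_ge 1 (zmin X l * zmin X l) with h | h
  · have h1 := Nat.pow_pred_clog_lt_self (b := 2) (by omega) h
    have h2 : 0 < mu X l := Nat.clog_pos (by omega) h
    have h3 : 2 ^ mu X l = 2 * 2 ^ (mu X l).pred := by
      rw [← pow_succ', ← Nat.succ_eq_add_one, Nat.succ_pred_eq_of_pos h2]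
    rw [h3]
    have h4 : 2 ^ (mu X l).pred < zmin X l * zmin X l := h1
    omega
  · have h1 : zmin X l * zmin X l = 1 := by
      have := Nat.mul_pos h0 h0
      omega
    have : mu X l = 0 := by rw [mu, h1]; simp
    rw [this, h1]
    norm_num

/-- As `Z * Z` and `2 ^ mu X l` differ by a factor of at most `4`, two comparisons find the width
that leaves between `l` and `l + 1` bits for the block. So the width needs no computation of a
logarithm. -/
theorem two_pow_nodeWidth (hX : 0 < X) {Z : ℕ} (h1 : zmin X l ≤ Z) (h2 : Z ≤ 2 * zmin X l) :
    2 ^ l * (Z * Z) ≤ 2 ^ nodeWidth X l Z ∧ 2 ^ nodeWidth X l Z < 2 * 2 ^ l * (Z * Z) := by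
  obtain ⟨h3, h4⟩ := two_pow_mu (l := l) hX
  have h5 : zmin X l * zmin X l ≤ Z * Z := Nat.mul_le_mul h1 h1
  have h6 : Z * Z ≤ 4 * (zmin X l * zmin X l) := by nlinarith
  have hl : 0 < 2 ^ l := by positivity
  rw [nodeWidth, pow_add]
  suffices h : Z * Z ≤ 2 ^ (mu X l + (if 2 ^ mu X l < Z * Z then 1 else 0) +
      (if 2 * 2 ^ mu X l < Z * Z then 1 else 0)) ∧
      2 ^ (mu X l + (if 2 ^ mu X l < Z * Z then 1 else 0) +
      (if 2 * 2 ^ mu X l < Z * Z then 1 else 0)) < 2 * (Z * Z) by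
    refine ⟨Nat.mul_le_mul_left _ h.1, ?_⟩
    calc _ < 2 ^ l * (2 * (Z * Z)) := Nat.mul_lt_mul_of_pos_left h.2 hl
      _ = _ := by ring
  rw [pow_add, pow_add]
  split_ifs with c1 c2 c2 <;> simp only [pow_one, pow_zero] <;> omega

/-- The constants of a level, in terms of the number of values of the incoming spills. -/
theorem level_step (hX : 0 < X) {h : ℕ}
    (hw : 2 ^ l * (spillCard X l h * spillCard X l h) ≤ 2 ^ width X l h ∧
      2 ^ width X l h < 2 * 2 ^ l * (spillCard X l h * spillCard X l h))
    (hZ : 0 < spillCard X l h) :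
    2 ^ l ≤ keep X l h ∧ keep X l h < 2 * 2 ^ l ∧
      zmin X l ≤ spillCard X l (h + 1) ∧ spillCard X l (h + 1) ≤ 2 * zmin X l := by
  have hl : 0 < 2 ^ l := by positivity
  have hZZ : 0 < spillCard X l h * spillCard X l h := Nat.mul_pos hZ hZ
  have h1 : 2 ^ l ≤ keep X l h := (Nat.le_div_iff_mul_le hZZ).2 hw.1
  have h2 : keep X l h < 2 * 2 ^ l := (Nat.div_lt_iff_lt_mul hZZ).2 hw.2
  have hk : 0 < keep X l h := by omega
  have e : ∀ c, 0 < c → (X + c - 1) / c = (X - 1) / c + 1 := fun c hc => by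
    rw [← Nat.add_div_right _ hc]; congr 1; omega
  refine ⟨h1, h2, ?_, ?_⟩
  · rw [spillCard_succ, zmin, e _ hk, e _ (by positivity)]
    exact Nat.succ_le_succ (Nat.div_le_div_left h2.le hk)
  · rw [spillCard_succ, zmin, e _ hk, e _ (by positivity)]
    have h3 : (X - 1) / keep X l h ≤ (X - 1) / 2 ^ l := Nat.div_le_div_left h1 hl
    have h4 : (X - 1) / 2 ^ l / 2 = (X - 1) / (2 * 2 ^ l) := by
      rw [Nat.div_div_eq_div_mul, mul_comm]
    omega

/-- From level `1` on, the numbers of values of the spills differ by a factor of at most `2`.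
-/
theorem spillCard_bounds (hX : 0 < X) (h : ℕ) :
    zmin X l ≤ spillCard X l (h + 1) ∧ spillCard X l (h + 1) ≤ 2 * zmin X l := by
  induction h with
  | zero =>
    refine (level_step hX ?_ (by simp [spillCard])).2.2
    have hl : 0 < 2 ^ l := by positivity
    simp only [width, widthOf, spillCard, if_true]
    omega
  | succ h ih =>
    refine (level_step hX ?_ ((zmin_pos hX).trans_le ih.1)).2.2
    exact two_pow_nodeWidth hX ih.1 ih.2

theorem spillCard_pos (hX : 0 < X) (h : ℕ) : 0 < spillCard X l h := by
  cases h with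
  | zero => simp [spillCard]
  | succ h => exact (zmin_pos hX).trans_le (spillCard_bounds hX h).1

theorem two_pow_width (hX : 0 < X) (h : ℕ) :
    2 ^ l * (spillCard X l h * spillCard X l h) ≤ 2 ^ width X l h ∧
      2 ^ width X l h < 2 * 2 ^ l * (spillCard X l h * spillCard X l h) := by
  cases h with
  | zero =>
    have hl : 0 < 2 ^ l := by positivity
    simp only [width, widthOf, spillCard, if_true]
    omega
  | succ h => exact two_pow_nodeWidth hX (spillCard_bounds hX h).1 (spillCard_bounds hX h).2

theorem keep_bounds (hX : 0 < X) (h : ℕ) : 2 ^ l ≤ keep X l h ∧ keep X l h < 2 * 2 ^ l :=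
  let H := level_step hX (two_pow_width hX h) (spillCard_pos hX h)
  ⟨H.1, H.2.1⟩

theorem keep_pos (hX : 0 < X) (h : ℕ) : 0 < keep X l h :=
  lt_of_lt_of_le (by positivity) (keep_bounds hX h).1

theorem spill_lt (hX : 0 < X) (h : ℕ) {x : ℕ} (hx : x < X) :
    x / keep X l h < spillCard X l (h + 1) := by
  have hk := keep_pos (l := l) hX h
  rw [spillCard_succ, show X + keep X l h - 1 = (X - 1) + keep X l h by omega,
    Nat.add_div_right _ hk]
  exact Nat.lt_succ_of_le (Nat.div_le_div_right (by omega))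

theorem le_two_pow_zeta : 2 * zmin X l ≤ 2 ^ zeta X l := Nat.le_pow_clog (by omega) _

theorem two_pow_width_le (hX : 0 < X) (h : ℕ) :
    2 ^ width X l h ≤ 8 * 2 ^ l * (zmin X l * zmin X l) := by
  have h1 := (two_pow_width (l := l) hX h).2
  have h2 : spillCard X l h ≤ 2 * zmin X l := by
    cases h with
    | zero => have := zmin_pos (l := l) hX; simp only [spillCard]; omega
    | succ h => exact (spillCard_bounds hX h).2
  have h3 : spillCard X l h * spillCard X l h ≤ 4 * (zmin X l * zmin X l) := by nlinarith
  have h4 := Nat.mul_le_mul_left (2 * 2 ^ l) h3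
  refine h1.le.trans (h4.trans (le_of_eq ?_))
  ring

end bounds

/-- The number of nodes of the next level, if `c` is the number of nodes of the present one, and
`d` levels are left, including the present one. -/
def nextCount (d c : ℕ) : ℕ := if 1 < d then c / 2 else 0

theorem two_mul_nextCount_le (d c : ℕ) : 2 * nextCount d c ≤ c := by
  rw [nextCount]; split_ifs <;> omega

/-- Storage of `r` blocks `x 0, …, x (r - 1)`, which are numbers below `X`, by means of `d` levels
of nodes, of which the first one has the number `h` and consists of `c` nodes.
A node contains one block and the spills `y` of two nodes of the level before. It stores the spills
and the residue of the block modulo `keep X l h`. The quotient is the spill of the node. It is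
stored in a node of the next level or, if there is no such node, separately. -/
def levelBits (X l : ℕ) : (d h c r : ℕ) → (y x : ℕ → ℕ) → List Bool
  | 0, _, _, r, _, x => arr (Nat.clog 2 X) r x
  | d + 1, h, c, r, y, x =>
    arr (width X l h) c (fun i =>
        x i % keep X l h + keep X l h * (y (2 * i) + spillCard X l h * y (2 * i + 1))) ++
      (arr (zeta X l) (c - 2 * nextCount (d + 1) c)
          (fun i => x (2 * nextCount (d + 1) c + i) / keep X l h) ++
        levelBits X l d (h + 1) (nextCount (d + 1) c) (r - c) (fun i => x i / keep X l h)
          fun i => x (c + i))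

/-- Without nodes, all blocks are stored in fields of their own. -/
theorem levelBits_zero (X l d h r : ℕ) (y x : ℕ → ℕ) :
    levelBits X l d h 0 r y x = arr (Nat.clog 2 X) r x := by
  induction d generalizing h y with
  | zero => rfl
  | succ d ih =>
    have : nextCount (d + 1) 0 = 0 := by simp [nextCount]
    simp only [levelBits, this]
    simp only [Nat.zero_add, Nat.sub_zero, arr, List.nil_append, mul_zero, Nat.sub_self]
    exact ih _ _

/-- The contents of a node fit into its field. -/
theorem node_lt {X l h x y₁ y₂ : ℕ} (hX : 0 < X) (h1 : y₁ < spillCard X l h)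
    (h2 : y₂ < spillCard X l h) :
    x % keep X l h + keep X l h * (y₁ + spillCard X l h * y₂) < 2 ^ width X l h := by
  have hk := keep_pos (l := l) hX h
  have h3 : x % keep X l h < keep X l h := Nat.mod_lt _ hk
  have h4 : y₁ + spillCard X l h * y₂ + 1 ≤ spillCard X l h * spillCard X l h := by
    have : spillCard X l h * (y₂ + 1) ≤ spillCard X l h * spillCard X l h :=
      Nat.mul_le_mul_left _ h2
    rw [mul_add, mul_one] at this
    omega
  have h5 : keep X l h * (spillCard X l h * spillCard X l h) ≤ 2 ^ width X l h :=
    Nat.div_mul_le_self _ _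
  have h6 := Nat.mul_le_mul_left (keep X l h) h4
  rw [mul_add, mul_one] at h6
  omega

/-! ### Access to the blocks -/

/-- The expression for the width of the next level. -/
def widthExpr : Expr :=
  .var 2 + (.var 14 + .less (.pow2 (.var 14)) (.var 33 * .var 33) +
    .less (.lit 2 * .pow2 (.var 14)) (.var 33 * .var 33))

/-- The expression for the address of the next level. -/
def nextBase : Expr :=
  .var 34 + .var 28 * .var 30 + (.var 28 - .lit 2 * .var 35) * .var 15

/-- The expression for the number of values of the outgoing spills. -/
def spillExpr : Expr := (.var 12 + .var 31 - .lit 1) / .var 31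

/-- The expression for the number of nodes of the next level. -/
def countExpr : Expr := .var 28 / .lit 2 * .less (.lit 1) (.var 29)

/-- Sets the variables for the first level. -/
def levelInit : Prog (63 + 1) :=
  .seq (asg 28 (.var 13)) <|
  .seq (asg 29 (.var 18)) <|
  .seq (asg 30 (.var 2)) <|
  .seq (asg 31 (.pow2 (.var 2))) <|
  .seq (asg 33 spillExpr) <|
  .seq (asg 34 (.var 17)) <|
  asg 35 countExpr

/-- Proceeds to the next level. -/
def levelNext : Prog (63 + 1) :=
  .seq (asg 24 (.var 24 - .var 28)) <|
  .seq (asg 34 nextBase) <|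
  .seq (asg 28 (.var 35)) <|
  .seq (asg 29 (.var 29 - .lit 1)) <|
  .seq (asg 30 widthExpr) <|
  .seq (asg 31 (.pow2 (.var 30) / (.var 33 * .var 33))) <|
  .seq (asg 33 spillExpr) <|
  asg 35 countExpr

/-- Reads the block of the node with the number in register `24` of the present level. -/
def readNode : Prog (63 + 1) :=
  .seq (asg 37 (.read (.var 34 + .var 24 * .var 30) (.var 30))) <|
  .seq (ite (.less (.var 24 / .lit 2) (.var 35))
    (.seq (asg 34 nextBase) <|
     .seq (asg 36 widthExpr) <|
     .seq (asg 35 (.read (.var 34 + .var 24 / .lit 2 * .var 36) (.var 36) /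
       (.pow2 (.var 36) / (.var 33 * .var 33)))) <|
     ite (.var 24 % .lit 2) (asg 32 (.var 35 / .var 33)) (asg 32 (.var 35 % .var 33)))
    (asg 32 (.read (.var 34 + .var 28 * .var 30 + (.var 24 - .lit 2 * .var 35) * .var 15)
      (.var 15)))) <|
  asg 26 (.var 37 % .var 31 + .var 31 * .var 32)

/-- Reads the block with the number in register `24` into register `26`. -/
def readBlock : Prog (63 + 1) :=
  .seq levelInit <|
  .seq (whl (.less (.lit 0) (.var 28) * .less (.var 28) (.var 24 + .lit 1)) levelNext) <|
  ite (.var 28) readNode (asg 26 (.read (.var 34 + .var 24 * .var 16) (.var 16)))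

/-- The constants of the array are in the registers. -/
structure ArrayRegs (X l : ℕ) (s : State) : Prop where
  l_eq : s.v 2 = l
  X_eq : s.v 12 = X
  mu_eq : s.v 14 = mu X l
  zeta_eq : s.v 15 = zeta X l
  clog_eq : s.v 16 = Nat.clog 2 X

theorem ArrayRegs.of_agree {X l k : ℕ} {s s' : State} (h : ArrayRegs X l s) (ha : Agree k s s')
    (hk : 17 ≤ k) : ArrayRegs X l s' :=
  ⟨by rw [ha.1 _ (by omega), h.l_eq], by rw [ha.1 _ (by omega), h.X_eq],
    by rw [ha.1 _ (by omega), h.mu_eq], by rw [ha.1 _ (by omega), h.zeta_eq],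
    by rw [ha.1 _ (by omega), h.clog_eq]⟩

/-- The bound `S` is large enough for the computations with the levels. -/
structure ArrayBound (m : List Bool) (X l S : ℕ) : Prop where
  X_pos : 0 < X
  X_le : X ≤ S
  pow_le : 8 * 2 ^ l * (zmin X l * zmin X l) ≤ S
  clog_le : 2 ^ Nat.clog 2 X ≤ S
  length_le : m.length ≤ S

/-- The variables of the program describe a level, whose data and those of the following levels are
in the memory. -/
structure LevelInv (m : List Bool) (X l S : ℕ) (s : State) (d h c r : ℕ) (y x : ℕ → ℕ) : Prop where
  count : s.v 28 = c
  depth : s.v 29 = d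
  width : s.v 30 = width X l h
  keep : s.v 31 = keep X l h
  spill : s.v 33 = spillCard X l (h + 1)
  next : s.v 35 = nextCount d c
  holds : Holds m (s.v 34) (levelBits X l d h c r y x)
  two_mul_le : 2 * c ≤ r
  count_eq : d = 0 → c = 0
  lt_y : ∀ i, y i < spillCard X l h
  lt_x : ∀ i, x i < X
  lt_r : s.v 24 < r
  count_le : c ≤ S
  index_le : s.v 24 ≤ S
  depth_le : d ≤ S

theorem Holds.le_length {m : List Bool} {p : ℕ} {a : List Bool} (h : Holds m p a) :
    p ≤ m.length := by
  obtain ⟨u, v, rfl, rfl⟩ := h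
  simp only [List.length_append]
  omega

section access

variable {m : List Bool} {X l w S : ℕ}

theorem eval_widthExpr {s : State} (hR : ArrayRegs X l s) {h : ℕ}
    (h33 : s.v 33 = spillCard X l (h + 1)) :
    widthExpr.eval m s.v = width X l (h + 1) := by
  simp [widthExpr, hR.l_eq, hR.mu_eq, h33, width, widthOf, nodeWidth]

theorem eval_spillExpr {s : State} (hR : ArrayRegs X l s) {h : ℕ} (h31 : s.v 31 = keep X l h) :
    spillExpr.eval m s.v = spillCard X l (h + 1) := by
  simp [spillExpr, hR.X_eq, h31, spillCard_succ]

theorem ArrayBound.mu_le (hA : ArrayBound m X l S) : 2 ^ mu X l ≤ S := by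
  have h1 := (two_pow_mu (l := l) hA.X_pos).2
  have h2 : 1 ≤ 2 ^ l := Nat.one_le_two_pow
  have h3 := hA.pow_le
  nlinarith [Nat.zero_le (zmin X l * zmin X l)]

theorem ArrayBound.width_le (hA : ArrayBound m X l S) (h : ℕ) : 2 ^ width X l h ≤ S :=
  (two_pow_width_le hA.X_pos h).trans hA.pow_le

theorem ArrayBound.l_le (hA : ArrayBound m X l S) : 2 ^ l ≤ S := by
  simpa [width, widthOf] using hA.width_le 0

theorem ArrayBound.spill_le (hA : ArrayBound m X l S) (h : ℕ) : spillCard X l h ≤ S := by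
  have h1 := (two_pow_width (l := l) hA.X_pos h).1
  have h2 := hA.width_le h
  have h3 : 1 ≤ 2 ^ l := Nat.one_le_two_pow
  nlinarith [spillCard_pos (l := l) hA.X_pos h]

theorem ArrayBound.keep_le (hA : ArrayBound m X l S) (h : ℕ) : keep X l h ≤ S :=
  (Nat.div_le_self _ _).trans (hA.width_le h)

theorem ArrayBound.zeta_le (hA : ArrayBound m X l S) : 2 ^ zeta X l ≤ S := by
  have hz := zmin_pos (l := l) hA.X_pos
  have h1 := Nat.pow_pred_clog_lt_self (b := 2) (x := 2 * zmin X l) (by omega) (by omega)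
  have h2 : 0 < Nat.clog 2 (2 * zmin X l) := Nat.clog_pos (by omega) (by omega)
  have h3 : 2 ^ zeta X l = 2 * 2 ^ (Nat.clog 2 (2 * zmin X l)).pred := by
    rw [zeta, ← pow_succ', ← Nat.succ_eq_add_one, Nat.succ_pred_eq_of_pos h2]
  have h4 := hA.pow_le
  have h5 : 1 ≤ 2 ^ l := Nat.one_le_two_pow
  rw [h3]
  nlinarith

theorem ArrayBound.pos (hA : ArrayBound m X l S) : 1 ≤ S := hA.X_pos.trans_le hA.X_le

theorem levelBits_step {d h c r p : ℕ} {y x : ℕ → ℕ}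
    (hm : Holds m p (levelBits X l (d + 1) h c r y x)) :
    Holds m (p + c * width X l h + (c - 2 * nextCount (d + 1) c) * zeta X l)
      (levelBits X l d (h + 1) (nextCount (d + 1) c) (r - c) (fun i => x i / keep X l h)
        fun i => x (c + i)) := by
  have := hm.right.right
  simpa using this

theorem safe_widthExpr (hA : ArrayBound m X l S) (hB : Wide w S) {s : State}
    (hR : ArrayRegs X l s) : widthExpr.Safe S m s.v := by
  simp [widthExpr, hR.mu_eq, hA.mu_le, hA.pos, hB.two_le]

theorem wp_levelInit (hA : ArrayBound m X l S) (hB : Wide w S) {s : State} (hR : ArrayRegs X l s)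
    {d c r : ℕ} {x : ℕ → ℕ} (h13 : s.v 13 = c) (h18 : s.v 18 = d) (hc : 2 * c ≤ r) (hcS : c ≤ S)
    (hdS : d ≤ S) (hd : d = 0 → c = 0)
    (hm : Holds m (s.v 17) (levelBits X l d 0 c r (fun _ => 0) x))
    (hx : ∀ i, x i < X) (hi : s.v 24 < r) (hiS : s.v 24 ≤ S) :
    WP w S m levelInit 0 (fun s' => Agree 23 s s' ∧ s'.v 25 = s.v 25 ∧
      LevelInv m X l S s' d 0 c r (fun _ => 0) x ∧ s'.v 24 = s.v 24) s := by
  have hl : l ≤ S := (Nat.lt_two_pow_self).le.trans hA.l_le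
  have hnc := two_mul_nextCount_le d c
  refine WP.seq (i := 0) (j := 0) (WP.asg hB c (by omega) rfl (by simp) (by simp [h13]) hcS ?_)
  refine WP.seq (i := 0) (j := 0) (WP.asg hB d (by omega) rfl (by simp) (by simp [h18]) hdS ?_)
  refine WP.seq (i := 0) (j := 0) (WP.asg hB l (by omega) rfl (by simp) (by simp [hR.l_eq]) hl ?_)
  refine WP.seq (i := 0) (j := 0) (WP.asg hB (2 ^ l) (by omega) rfl
    (by simp [hA.pos, hR.l_eq, hA.l_le]) (by simp [hR.l_eq]) hA.l_le ?_)
  have hk : keep X l 0 = 2 ^ l := by simp [keep, width, widthOf, spillCard]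
  refine WP.seq (i := 0) (j := 0) (WP.asg hB (spillCard X l 1) (by omega) rfl ?_ ?_
    (hA.spill_le 1) ?_)
  · have : 1 ≤ 2 ^ l := Nat.one_le_two_pow
    simp [spillExpr, hA.pos]
    omega
  · rw [← hk]
    exact eval_spillExpr (hR.of_agree (((((Agree.refl s).set (by omega) _).set (by omega) _).set
      (by omega) _).set (by omega) _) le_rfl) (by simp)
  refine WP.seq (i := 0) (j := 0) (WP.asg hB (s.v 17) (by omega) rfl (by simp) (by simp)
    (hm.le_length.trans hA.length_le) ?_)
  refine WP.asg hB (nextCount d c) (by omega) rfl (by simp [countExpr, hA.pos, hB.two_le])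
    ?_ (by omega) ⟨?_, by simp, ⟨by simp, by simp, ?_, ?_, by simp, by simp, by simpa using hm, hc,
      hd, fun _ => by simp [spillCard], hx, by simpa using hi, hcS, by simpa using hiS, hdS⟩,
      by simp⟩
  · simp only [countExpr, nextCount]
    simp
  · exact (((((((Agree.refl s).set (by omega) _).set (by omega) _).set (by omega) _).set
      (by omega) _).set (by omega) _).set (by omega) _).set (by omega) _
  · simp [width, widthOf]
  · simp [hk]

/-- The parameters of a level follow from the number of values of the spills that come into it. -/
theorem wp_levelNext (hA : ArrayBound m X l S) (hB : Wide w S) {s : State} (hR : ArrayRegs X l s)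
    {d h c r : ℕ} {y x : ℕ → ℕ} (hI : LevelInv m X l S s (d + 1) h c r y x) (hc : c ≤ s.v 24) :
    WP w S m levelNext 0 (fun s' => Agree 23 s s' ∧ s'.v 25 = s.v 25 ∧
      LevelInv m X l S s' d (h + 1) (nextCount (d + 1) c) (r - c) (fun i => x i / keep X l h)
        (fun i => x (c + i)) ∧ s'.v 24 = s.v 24 - c) s := by
  have hnc := two_mul_nextCount_le (d + 1) c
  have hstep := levelBits_step hI.holds
  have hi := hI.index_le
  have hcS := hI.count_le
  have hdS := hI.depth_le
  refine WP.seq (i := 0) (j := 0) (WP.asg hB (s.v 24 - c) (by omega) rfl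
    (by simpa [hI.count] using hc) (by simp [hI.count]) (by omega) ?_)
  refine WP.seq (i := 0) (j := 0) (WP.asg hB (s.v 34 + c * width X l h +
    (c - 2 * nextCount (d + 1) c) * zeta X l) (by omega) rfl ?_ ?_
    (hstep.le_length.trans hA.length_le) ?_)
  · simpa [nextBase, hI.count, hI.next, hB.two_le] using hnc
  · simp [nextBase, hI.count, hI.next, hI.width, hR.zeta_eq]
  refine WP.seq (i := 0) (j := 0) (WP.asg hB (nextCount (d + 1) c) (by omega) rfl (by simp)
    (by simp [hI.next]) (by omega) ?_)
  refine WP.seq (i := 0) (j := 0) (WP.asg hB d (by omega) rfl (by simp [hI.depth, hA.pos])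
    (by simp [hI.depth]) (by omega) ?_)
  have hag : Agree 23 s ((((s.set 24 (s.v 24 - c)).set 34 (s.v 34 + c * width X l h +
      (c - 2 * nextCount (d + 1) c) * zeta X l)).set 28 (nextCount (d + 1) c)).set 29 d) :=
    ((((Agree.refl s).set (by omega) _).set (by omega) _).set (by omega) _).set (by omega) _
  refine WP.seq (i := 0) (j := 0) (WP.asg hB (width X l (h + 1)) (by omega) rfl
    (safe_widthExpr hA hB (hR.of_agree hag (by omega)))
    (eval_widthExpr (hR.of_agree hag (by omega)) (by simp [hI.spill]))
    ((Nat.lt_two_pow_self).le.trans (hA.width_le _)) ?_)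
  have hag := hag.set (x := 30) (by omega) (width X l (h + 1))
  refine WP.seq (i := 0) (j := 0) (WP.asg hB (keep X l (h + 1)) (by omega) rfl
    (by simp [hA.pos, hA.width_le]) (by simp [hI.spill, keep]) (hA.keep_le _) ?_)
  have hag := hag.set (x := 31) (by omega) (keep X l (h + 1))
  have hkp := keep_pos (l := l) hA.X_pos (h + 1)
  refine WP.seq (i := 0) (j := 0) (WP.asg hB (spillCard X l (h + 1 + 1)) (by omega) rfl
    (by simp [spillExpr, hA.pos]; omega)
    (eval_spillExpr (hR.of_agree hag (by omega)) (by simp)) (hA.spill_le _) ?_)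
  have hag := hag.set (x := 33) (by omega) (spillCard X l (h + 1 + 1))
  have hnc2 := two_mul_nextCount_le d (nextCount (d + 1) c)
  refine WP.asg hB (nextCount d (nextCount (d + 1) c)) (by omega) rfl
    (by simp [countExpr, hA.pos, hB.two_le]) ?_ (by omega)
    ⟨hag.set (by omega) _, by simp, ⟨by simp, by simp, by simp, by simp, by simp, by simp,
      by simpa using hstep, ?_, ?_, fun i => spill_lt hA.X_pos h (hI.lt_x i),
      fun i => hI.lt_x _, ?_, by omega, ?_, by omega⟩, by simp⟩
  · simp only [countExpr]
    simp only [Expr.eval_mul, Expr.eval_div, Expr.eval_less, Expr.eval_var, Expr.eval_lit,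
      State.set_v]
    norm_num [nextCount]
  · have := hI.two_mul_le; omega
  · intro hd
    simp [nextCount, hd]
  · have := hI.lt_r
    simp
    omega
  · simp
    omega

/-- The residue of the block is in the node itself, and its quotient, the spill, is half of the
spills of a node of the next level, or in a field of its own. -/
theorem wp_readNode (hA : ArrayBound m X l S) (hB : Wide w S) {s : State} (hR : ArrayRegs X l s)
    {d h c r : ℕ} {y x : ℕ → ℕ} (hI : LevelInv m X l S s d h c r y x) (hc : s.v 24 < c) :
    WP w S m readNode 0 (fun s' => Agree 23 s s' ∧ s'.v 25 = s.v 25 ∧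
      s'.v 26 = x (s.v 24)) s := by
  obtain ⟨d, rfl⟩ : ∃ d', d = d' + 1 := by
    cases d with
    | zero => have := hI.count_eq rfl; omega
    | succ d => exact ⟨d, rfl⟩
  have hX := hA.X_pos
  set i := s.v 24 with hi
  set F := x i % keep X l h + keep X l h * (y (2 * i) + spillCard X l h * y (2 * i + 1)) with hF
  have hFlt : F < 2 ^ width X l h := node_lt hX (hI.lt_y _) (hI.lt_y _)
  have hnc := two_mul_nextCount_le (d + 1) c
  have hcS := hI.count_le
  have hstep := levelBits_step hI.holds
  have hkp := keep_pos (l := l) hX h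
  have hspl := spill_lt (l := l) hX h (hI.lt_x i)
  have hspS : x i / keep X l h ≤ S := hspl.le.trans (hA.spill_le _)
  refine WP.seq (i := 0) (j := 0) (WP.asg hB F (by omega) rfl (by simp [hI.width, hA.width_le]) ?_
    (hFlt.le.trans (hA.width_le h)) ?_)
  · have := hI.holds.left.arr (i := i) hc hFlt
    simpa [hI.width, ← hi] using this
  refine WP.seq (i := 0) (j := 0) ((?_ : WP w S m _ 0 (fun s' => Agree 23 s s' ∧
    s'.v 25 = s.v 25 ∧ s'.v 31 = s.v 31 ∧ s'.v 37 = F ∧ s'.v 32 = x i / keep X l h) _).mono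
    le_rfl ?_)
  · have hag0 : Agree 23 s (s.set 37 F) := (Agree.refl s).set (by omega) _
    refine WP.ite hB rfl (by simp [hB.two_le]) ?_ ?_
    · intro hcond
      have hlt : i / 2 < nextCount (d + 1) c := by
        by_contra h'
        simp [hI.next, ← hi, h'] at hcond
      obtain ⟨d, rfl⟩ : ∃ d', d = d' + 1 := by
        cases d with
        | zero => simp [nextCount] at hlt
        | succ d => exact ⟨d, rfl⟩
      refine WP.seq (i := 0) (j := 0) (WP.asg hB (s.v 34 + c * width X l h +
        (c - 2 * nextCount (d + 1 + 1) c) * zeta X l) (by omega) rfl ?_ ?_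
        (hstep.le_length.trans hA.length_le) ?_)
      · simpa [nextBase, hI.count, hI.next, hB.two_le] using hnc
      · simp [nextBase, hI.count, hI.next, hI.width, hR.zeta_eq]
      have hag := hag0.set (x := 34) (by omega) (s.v 34 + c * width X l h +
        (c - 2 * nextCount (d + 1 + 1) c) * zeta X l)
      refine WP.seq (i := 0) (j := 0) (WP.asg hB (width X l (h + 1)) (by omega) rfl
        (safe_widthExpr hA hB (hR.of_agree hag (by omega)))
        (eval_widthExpr (hR.of_agree hag (by omega)) (by simp [hI.spill]))
        ((Nat.lt_two_pow_self).le.trans (hA.width_le _)) ?_)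
      have hag := hag.set (x := 36) (by omega) (width X l (h + 1))
      -- the two spills that the node of the next level contains
      set y' : ℕ → ℕ := fun i => x i / keep X l h with hy'
      have hy'lt : ∀ i, y' i < spillCard X l (h + 1) := fun i => spill_lt hX h (hI.lt_x i)
      set g := y' (2 * (i / 2)) + spillCard X l (h + 1) * y' (2 * (i / 2) + 1) with hg
      have hkp' := keep_pos (l := l) hX (h + 1)
      have hZp := spillCard_pos (l := l) hX (h + 1)
      have hnode : x (c + i / 2) % keep X l (h + 1) + keep X l (h + 1) * g <
          2 ^ width X l (h + 1) :=
        node_lt hX (hy'lt (2 * (i / 2))) (hy'lt (2 * (i / 2) + 1))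
      have hrd := hstep.left.arr (i := i / 2) hlt hnode
      have hdiv : (x (c + i / 2) % keep X l (h + 1) + keep X l (h + 1) * g) / keep X l (h + 1) =
          g := by
        rw [Nat.add_mul_div_left _ _ hkp', Nat.div_eq_of_lt (Nat.mod_lt _ hkp'), zero_add]
      have hgS : g ≤ S := by
        have h1 := hA.width_le (h + 1)
        have h2 : g ≤ keep X l (h + 1) * g := Nat.le_mul_of_pos_left _ hkp'
        omega
      refine WP.seq (i := 0) (j := 0) (WP.asg hB g (by omega) rfl
        (by simp [hA.width_le, hA.pos, hB.two_le]) ?_ hgS ?_)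
      · simp only [Expr.eval_div, Expr.eval_read, Expr.eval_add, Expr.eval_mul, Expr.eval_var,
          Expr.eval_lit, Expr.eval_pow2, State.set_v]
        norm_num
        rw [hI.spill, ← hi, hrd, ← keep, hdiv]
      have hag := hag.set (x := 35) (by omega) g
      refine WP.ite hB rfl (by simp [hB.two_le]) ?_ ?_
      · intro hodd
        have hodd : 2 * (i / 2) + 1 = i := by
          simp [← hi] at hodd
          omega
        refine WP.asg hB (x i / keep X l h) (by omega) rfl (by simp) ?_ hspS
          ⟨hag.set (by omega) _, by simp, by simp, by simp, by simp⟩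
        simp only [Expr.eval_div, Expr.eval_var, State.set_v]
        norm_num
        rw [hI.spill, hg, hodd, Nat.add_mul_div_left _ _ hZp, Nat.div_eq_of_lt (hy'lt _), zero_add]
      · intro heven
        have heven : 2 * (i / 2) = i := by
          simp [← hi] at heven
          omega
        refine WP.asg hB (x i / keep X l h) (by omega) rfl (by simp) ?_ hspS
          ⟨hag.set (by omega) _, by simp, by simp, by simp, by simp⟩
        simp only [Expr.eval_mod, Expr.eval_var, State.set_v]
        norm_num
        rw [hI.spill, hg, heven, Nat.add_mul_mod_self_left, Nat.mod_eq_of_lt (hy'lt _)]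
    · intro hcond
      have hge : nextCount (d + 1) c ≤ i / 2 := by
        by_contra h'
        simp only [Expr.eval_less, Expr.eval_div, Expr.eval_var, Expr.eval_lit,
          State.set_v] at hcond
        norm_num at hcond
        rw [hI.next, ← hi] at hcond
        omega
      have hz : x i / keep X l h < 2 ^ zeta X l :=
        hspl.trans_le ((spillCard_bounds hX h).2.trans le_two_pow_zeta)
      have hrd := hI.holds.right.left.arr (i := i - 2 * nextCount (d + 1) c) (by omega)
        (by
          rw [show 2 * nextCount (d + 1) c + (i - 2 * nextCount (d + 1) c) = i by omega]
          exact hz)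
      rw [length_arr, show 2 * nextCount (d + 1) c + (i - 2 * nextCount (d + 1) c) = i by omega]
        at hrd
      refine WP.asg hB (x i / keep X l h) (by omega) rfl ?_ ?_ hspS
        ⟨hag0.set (by omega) _, by simp, by simp, by simp, by simp⟩
      · simp [hB.two_le, hR.zeta_eq, hA.zeta_le, hI.next, ← hi]
        omega
      · simp only [Expr.eval_read, Expr.eval_add, Expr.eval_mul, Expr.eval_sub, Expr.eval_var,
          Expr.eval_lit, State.set_v]
        norm_num
        rw [hI.count, hI.width, hI.next, hR.zeta_eq, ← hi]
        exact hrd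
  · rintro s' ⟨hag, h25, h31, h37, h32⟩
    refine WP.asg hB (x i) (by omega) rfl (by simp) ?_ ((hI.lt_x i).le.trans hA.X_le)
      ⟨hag.set (by omega) _, by simpa using h25, by simp⟩
    simp only [Expr.eval_add, Expr.eval_mod, Expr.eval_mul, Expr.eval_var]
    rw [h31, h37, h32, hI.keep, hF, Nat.add_mul_mod_self_left, Nat.mod_mod]
    exact Nat.mod_add_div _ _

/-- The loop runs through the levels until it reaches the one with the node of the block, or the
blocks without a node. -/
theorem wp_readBlock (hA : ArrayBound m X l S) (hB : Wide w S) {s : State} (hR : ArrayRegs X l s)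
    {d c r : ℕ} {x : ℕ → ℕ} (h13 : s.v 13 = c) (h18 : s.v 18 = d) (hc : 2 * c ≤ r) (hcS : c ≤ S)
    (hdS : d ≤ S) (hd : d = 0 → c = 0)
    (hm : Holds m (s.v 17) (levelBits X l d 0 c r (fun _ => 0) x))
    (hx : ∀ i, x i < X) (hi : s.v 24 < r) (hiS : s.v 24 ≤ S) :
    WP w S m readBlock d (fun s' => Agree 23 s s' ∧ s'.v 25 = s.v 25 ∧
      s'.v 26 = x (s.v 24)) s := by
  refine (WP.seq (i := 0) (j := d) ((wp_levelInit hA hB hR h13 h18 hc hcS hdS hd hm hx hi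
    hiS).mono le_rfl ?_)).mono (by omega) fun _ => id
  rintro s1 ⟨hag1, h25, hI1, h24⟩
  refine (WP.seq (i := d * (0 + 1)) (j := 0) ?_).mono (by omega) fun _ => id
  set I : ℕ → State → Prop := fun N s' => Agree 23 s s' ∧ s'.v 25 = s.v 25 ∧
    ∃ h c r y x', LevelInv m X l S s' N h c r y x' ∧ x' (s'.v 24) = x (s.v 24) with hIdef
  refine WP.whl hB I rfl ?_ ?_ ?_ ⟨hag1, h25, 0, c, r, _, x, hI1, by rw [h24]⟩
  · intro N s2 _
    simp [hA.pos]
  · rintro N s2 ⟨hag, h25, h, c, r, y, x', hI, hx'⟩ hcond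
    have hc0 : 0 < c ∧ c ≤ s2.v 24 := by
      simp only [Expr.eval_mul, Expr.eval_less, Expr.eval_lit, Expr.eval_var, Expr.eval_add,
        hI.count] at hcond
      split_ifs at hcond <;> omega
    obtain ⟨N, rfl⟩ : ∃ N', N = N' + 1 := by
      cases N with
      | zero => have := hI.count_eq rfl; omega
      | succ N => exact ⟨N, rfl⟩
    refine ⟨N, rfl, (wp_levelNext hA hB (hR.of_agree hag (by omega)) hI hc0.2).mono le_rfl ?_⟩
    rintro s3 ⟨hag3, h25', hI3, h24'⟩
    refine ⟨hag.trans hag3, h25'.trans h25, _, _, _, _, _, hI3, ?_⟩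
    rw [h24', ← hx']
    congr 1
    omega
  · rintro N s2 ⟨hag, h25, h, c, r, y, x', hI, hx'⟩ hcond
    have hR2 := hR.of_agree hag (by omega)
    refine WP.ite hB rfl (by simp) ?_ ?_
    · intro h28
      simp only [Expr.eval_var, hI.count] at h28
      have hlt : s2.v 24 < c := by
        by_contra h'
        simp only [Expr.eval_mul, Expr.eval_less, Expr.eval_lit, Expr.eval_var, Expr.eval_add,
          hI.count] at hcond
        split_ifs at hcond <;> omega
      refine (wp_readNode hA hB hR2 hI hlt).mono le_rfl ?_
      rintro s3 ⟨hag3, h25', h26⟩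
      exact ⟨hag.trans hag3, h25'.trans h25, h26.trans hx'⟩
    · intro h28
      simp only [Expr.eval_var, hI.count] at h28
      subst h28
      have hm' := hI.holds
      rw [levelBits_zero] at hm'
      have hlt := hI.lt_x (s2.v 24)
      have hrd := hm'.arr hI.lt_r (hlt.trans_le (Nat.le_pow_clog (by omega) X))
      refine WP.asg hB (x' (s2.v 24)) (by omega) rfl (by simp [hR2.clog_eq, hA.clog_le]) ?_
        (hlt.le.trans hA.X_le) ⟨hag.set (by omega) _, by simpa using h25, by simpa using hx'⟩
      simpa [hR2.clog_eq] using hrd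

end access

/-! ### A canonical numbering of the states -/

section numbering

variable {n σ : ℕ}

/-- The state that is reached by the `c`-th word in the order by length, and among words of the same
length in the lexicographic order: the word number `σ * c + a + 1` is the word number `c`,
followed by the letter `a`. -/
def visit (A : DFA (Fin σ) (Fin n)) (hσ : 0 < σ) : ℕ → Fin n
  | 0 => A.start
  | c + 1 => A.step (visit A hσ (c / σ)) ⟨c % σ, Nat.mod_lt _ hσ⟩
termination_by c => c
decreasing_by exact Nat.lt_succ_of_le (Nat.div_le_self _ _)

/-- Every word has a number. -/
theorem visit_surjective (A : DFA (Fin σ) (Fin n)) (hσ : 0 < σ) (hA : A.InitiallyConnected)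
    (q : Fin n) : ∃ c, visit A hσ c = q := by
  obtain ⟨x, rfl⟩ := hA q
  induction x using List.reverseRecOn with
  | nil => exact ⟨0, by rw [visit]; rfl⟩
  | append_singleton x a ih =>
    obtain ⟨c, hc⟩ := ih
    refine ⟨σ * c + a + 1, ?_⟩
    rw [visit, DFA.eval_append_singleton, ← hc]
    congr 2
    · rw [Nat.mul_add_div hσ, Nat.div_eq_of_lt a.2, add_zero]
    · rw [Nat.mul_add_mod, Nat.mod_eq_of_lt a.2]

/-- Every function with distinct natural numbers as values on a finite type can be turned into a
numbering that preserves the order. -/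
theorem exists_ranking (f : Fin n → ℕ) (hf : Function.Injective f) :
    ∃ e : Fin n ≃ Fin n, ∀ p q, e p < e q ↔ f p < f q := by
  classical
  let g : Fin n → ℕ := fun q => (Finset.univ.filter fun p => f p < f q).card
  have hmono : ∀ p q, f p < f q → g p < g q := by
    intro p q h
    refine Finset.card_lt_card ⟨fun r hr => ?_, fun hsub => ?_⟩
    · simp only [Finset.mem_filter, Finset.mem_univ, true_and] at hr ⊢
      omega
    · have := hsub (show p ∈ _ by simpa using h)
      simp at this
  have hiff : ∀ p q, g p < g q ↔ f p < f q := by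
    intro p q
    refine ⟨fun h => ?_, hmono p q⟩
    by_contra h'
    rcases (not_lt.1 h').lt_or_eq with h2 | h2
    · have := hmono q p h2; omega
    · rw [hf h2] at h; omega
  have hlt : ∀ q, g q < n := by
    intro q
    have : g q < (Finset.univ : Finset (Fin n)).card := by
      refine Finset.card_lt_card ⟨fun r _ => Finset.mem_univ r, fun hsub => ?_⟩
      have := hsub (Finset.mem_univ q)
      simp at this
    simpa using this
  have hinj : Function.Injective fun q => (⟨g q, hlt q⟩ : Fin n) := by
    intro p q h
    have h : g p = g q := congrArg Fin.val h
    by_contra hne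
    rcases lt_or_gt_of_ne (fun h' => hne (hf h')) with h' | h'
    · have := hmono _ _ h'; omega
    · have := hmono _ _ h'; omega
  exact ⟨Equiv.ofBijective _ (Finite.injective_iff_bijective.1 hinj), hiff⟩

/-- The states can be numbered in such a way that `0` is the initial state and that for `j > 0`,
there is a transition to the state `j`, and the numbers of these transitions increase with `j`. -/
theorem exists_numbering (hσ : 0 < σ) (A : DFA (Fin σ) (Fin n)) (hA : A.InitiallyConnected) :
    ∃ (e : Fin n ≃ Fin n) (τ : ℕ → ℕ), (e A.start : ℕ) = 0 ∧ Increasing (n - 1) τ ∧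
      ∀ j < n - 1, ∃ (p : Fin n) (a : Fin σ),
        τ j = σ * (e p : ℕ) + a ∧ (e (A.step p a) : ℕ) = j + 1 := by
  classical
  -- the number of the first word that leads to a state
  let f : Fin n → ℕ := fun q => Nat.find (visit_surjective A hσ hA q)
  have hfv : ∀ q, visit A hσ (f q) = q := fun q => Nat.find_spec (visit_surjective A hσ hA q)
  have hfmin : ∀ c, f (visit A hσ c) ≤ c := fun c => Nat.find_min' _ rfl
  have hinj : Function.Injective f := fun p q h => by rw [← hfv p, h, hfv]
  obtain ⟨e, he⟩ := exists_ranking f hinj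
  have hfstart : f A.start = 0 := by
    have := hfmin 0
    rw [visit] at this
    omega
  have hstart : (e A.start : ℕ) = 0 := by
    by_contra h0
    have hlt : (⟨0, by have := A.start.2; omega⟩ : Fin n) < e A.start := by
      rw [Fin.lt_def]; simp only; omega
    rw [← e.apply_symm_apply ⟨0, _⟩, he, hfstart] at hlt
    omega
  -- the first word is the extension of the first word for another state
  have hpar : ∀ q c, f q = c + 1 → f (visit A hσ (c / σ)) = c / σ := by
    intro q c hc
    refine le_antisymm (hfmin _) ?_
    by_contra hlt
    push Not at hlt
    set c' := f (visit A hσ (c / σ)) with hc'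
    have h1 : visit A hσ (σ * c' + c % σ + 1) = q := by
      rw [visit, Nat.mul_add_div hσ, Nat.div_eq_of_lt (Nat.mod_lt _ hσ), add_zero, hc', hfv,
        ← hfv q, hc, visit]
      congr 2
      rw [Nat.mul_add_mod, Nat.mod_mod]
    have h2 := hfmin (σ * c' + c % σ + 1)
    rw [h1, hc] at h2
    have h3 := Nat.div_add_mod c σ
    have h4 : σ * c' < σ * (c / σ) := Nat.mul_lt_mul_of_pos_left hlt hσ
    omega
  let st : ℕ → Fin n := fun j => if h : j + 1 < n then e.symm ⟨j + 1, h⟩ else A.start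
  let par : ℕ → ℕ := fun j => f (st j) - 1
  have hst : ∀ j < n - 1, (e (st j) : ℕ) = j + 1 := by
    intro j hj
    have : j + 1 < n := by omega
    simp [st, this]
  have hpos : ∀ j < n - 1, f (st j) = par j + 1 := by
    intro j hj
    have h1 : f (st j) ≠ 0 := by
      intro h
      have : st j = A.start := hinj (h.trans hfstart.symm)
      have h2 := hst j hj
      rw [this, hstart] at h2
      omega
    simp only [par]
    omega
  refine ⟨e, fun j => σ * (e (visit A hσ (par j / σ)) : ℕ) + par j % σ, hstart, ?_, ?_⟩
  · intro i j hij hj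
    have h1 : f (st i) < f (st j) := by
      rw [← he, Fin.lt_def, hst i (by omega), hst j hj]
      omega
    rw [hpos i (by omega), hpos j hj] at h1
    have hmi := Nat.mod_lt (par i) hσ
    rcases (Nat.div_le_div_right (c := σ) (show par i ≤ par j by omega)).lt_or_eq with h2 | h2
    · have h3 : e (visit A hσ (par i / σ)) < e (visit A hσ (par j / σ)) := by
        rw [he, hpar _ _ (hpos i (by omega)), hpar _ _ (hpos j hj)]
        exact h2
      have h4 : σ * ((e (visit A hσ (par i / σ)) : ℕ) + 1) ≤
          σ * (e (visit A hσ (par j / σ)) : ℕ) := Nat.mul_le_mul_left _ h3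
      simp only
      rw [mul_add] at h4
      omega
    · have h3 := Nat.div_add_mod (par i) σ
      have h4 := Nat.div_add_mod (par j) σ
      simp only
      rw [h2] at h3 ⊢
      omega
  · intro j hj
    refine ⟨visit A hσ (par j / σ), ⟨par j % σ, Nat.mod_lt _ hσ⟩, rfl, ?_⟩
    have h1 : A.step (visit A hσ (par j / σ)) ⟨par j % σ, Nat.mod_lt _ hσ⟩ = st j := by
      rw [← hfv (st j), hpos j hj, visit]
    rw [h1, hst j hj]

/-- The transition function for the numbering `e`, as a function of the number of the pair of a
state and a letter. -/
def trans (A : DFA (Fin σ) (Fin n)) (e : Fin n ≃ Fin n) (t : ℕ) : ℕ :=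
  if h : t < σ * n then
    e (A.step (e.symm ⟨t / σ, Nat.div_lt_of_lt_mul h⟩)
      ⟨t % σ, Nat.mod_lt _ (Nat.pos_of_ne_zero fun h0 => by simp [h0] at h)⟩)
  else 0

theorem pair_lt (q : Fin n) (a : Fin σ) : σ * (q : ℕ) + a < σ * n := by
  have h1 : σ * ((q : ℕ) + 1) ≤ σ * n := Nat.mul_le_mul_left _ q.2
  have := a.2
  rw [mul_add] at h1
  omega

theorem trans_pair (A : DFA (Fin σ) (Fin n)) (e : Fin n ≃ Fin n) (q : Fin n) (a : Fin σ) :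
    trans A e (σ * (e q : ℕ) + a) = e (A.step q a) := by
  have hσ : 0 < σ := (Nat.zero_le _).trans_lt a.2
  have h1 : (σ * (e q : ℕ) + a) / σ = e q := by
    rw [Nat.mul_add_div hσ, Nat.div_eq_of_lt a.2, add_zero]
  have h2 : (σ * (e q : ℕ) + a) % σ = a := by
    rw [Nat.mul_add_mod, Nat.mod_eq_of_lt a.2]
  rw [trans, dif_pos (pair_lt _ _)]
  simp only [h1, h2, Fin.eta, Equiv.symm_apply_apply]

theorem trans_lt (A : DFA (Fin σ) (Fin n)) (e : Fin n ≃ Fin n) (t : ℕ) : trans A e t < n := by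
  rw [trans]
  split_ifs
  · exact Fin.is_lt _
  · exact (Nat.zero_le _).trans_lt A.start.2

theorem foldl_trans (A : DFA (Fin σ) (Fin n)) (e : Fin n ≃ Fin n) (h0 : (e A.start : ℕ) = 0)
    (x : List (Fin σ)) :
    (x.map Fin.val).foldl (fun q a => trans A e (σ * q + a)) 0 = e (A.eval x) := by
  induction x using List.reverseRecOn with
  | nil => exact h0.symm
  | append_singleton x a ih =>
    rw [List.map_append, List.foldl_append, ih, DFA.eval_append_singleton]
    exact trans_pair A e _ a

/-- Two automata are isomorphic if the same words lead to corresponding states. -/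
theorem isomorphic_of_eval (A B : DFA (Fin σ) (Fin n)) (hA : A.InitiallyConnected)
    (e e' : Fin n ≃ Fin n) (h : ∀ x, e (A.eval x) = e' (B.eval x))
    (hacc : ∀ x, x ∈ A.accepts ↔ x ∈ B.accepts) : A.Isomorphic B := by
  have h' : ∀ x, (e.trans e'.symm) (A.eval x) = B.eval x := fun x => by simp [h x]
  have hsymm : ∀ x, (e.trans e'.symm).symm (B.eval x) = A.eval x := fun x => by
    rw [← h' x, Equiv.symm_apply_apply]
  have hB : ∀ q, ∃ x, B.eval x = q := fun q => by
    obtain ⟨x, hx⟩ := hA ((e.trans e'.symm).symm q)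
    exact ⟨x, by rw [← h' x, hx, Equiv.apply_symm_apply]⟩
  refine ⟨e.trans e'.symm, ?_⟩
  obtain ⟨stepB, startB, accB⟩ := B
  simp only [DFA.reindex, Equiv.coe_fn_mk]
  congr 1
  · funext q a
    obtain ⟨x, rfl⟩ := hB q
    rw [hsymm x]
    have := h' (x ++ [a])
    rwa [DFA.eval_append_singleton, DFA.eval_append_singleton] at this
  · exact h' []
  · ext q
    obtain ⟨x, rfl⟩ := hB q
    rw [Set.mem_preimage, hsymm x]
    exact hacc x

end numbering

/-! ### Numbering the terms that are missing in a sequence -/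

/-- The number `t` is not among the first `T` terms of the sequence. -/
def Missing (T : ℕ) (τ : ℕ → ℕ) (t : ℕ) : Prop := ∀ j < T, τ j ≠ t

instance (T : ℕ) (τ : ℕ → ℕ) : DecidablePred (Missing T τ) := fun t =>
  inferInstanceAs (Decidable (∀ j < T, τ j ≠ t))

/-- The number of missing terms below `x`: this turns the rank in the dictionary into an index for
the array. -/
theorem count_missing {T : ℕ} {τ : ℕ → ℕ} (h : Increasing T τ) (x : ℕ) :
    Nat.count (Missing T τ) x = x - rank T τ x := by
  have hinj : Set.InjOn τ ((Finset.range T).filter fun j => τ j < x : Finset ℕ) := by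
    intro i hi j hj hij
    simp only [Finset.coe_filter, Finset.mem_range, Set.mem_ofPred_eq] at hi hj
    rcases lt_trichotomy i j with h' | h' | h'
    · have := h i j h' hj.1; omega
    · exact h'
    · have := h j i h' hi.1; omega
  have h1 : ((Finset.range x).filter fun t => ¬ Missing T τ t).card = rank T τ x := by
    rw [rank, ← Finset.card_image_of_injOn hinj]
    congr 1
    ext t
    rw [Finset.mem_filter, Finset.mem_image]
    simp only [Finset.mem_filter, Finset.mem_range]
    constructor
    · rintro ⟨h2, h3⟩
      rw [Missing] at h3
      push Not at h3
      obtain ⟨j, hj, rfl⟩ := h3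
      exact ⟨j, ⟨hj, h2⟩, rfl⟩
    · rintro ⟨j, ⟨hj, h2⟩, rfl⟩
      exact ⟨h2, fun h3 => h3 j hj rfl⟩
  have h2 := Finset.card_filter_add_card_filter_not (s := Finset.range x) (Missing T τ)
  rw [Finset.card_range] at h2
  have h3 : ((Finset.range x).filter (Missing T τ)).card + rank T τ x = x := by
    rw [← h1]
    convert h2
  rw [Nat.count_eq_card_filter_range]
  exact Nat.eq_sub_of_add_eq h3

/-! ### Blocks of digits -/

/-- The number with the `k` digits `g 0, …, g (k - 1)` in base `n`. -/
def block (n : ℕ) : ℕ → (ℕ → ℕ) → ℕ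
  | 0, _ => 0
  | k + 1, g => g 0 + n * block n k fun i => g (i + 1)

theorem block_lt {n : ℕ} (k : ℕ) {g : ℕ → ℕ} (hg : ∀ i, g i < n) : block n k g < n ^ k := by
  induction k generalizing g with
  | zero => simp [block]
  | succ k ih =>
    have h1 := ih fun i => hg (i + 1)
    have h2 := hg 0
    rw [block, pow_succ']
    have h3 : n * (block n k (fun i => g (i + 1)) + 1) ≤ n * n ^ k := Nat.mul_le_mul_left _ h1
    rw [mul_add] at h3
    omega

theorem block_digit {n k : ℕ} {g : ℕ → ℕ} (hg : ∀ i, g i < n) {j : ℕ} (hj : j < k) :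
    block n k g / n ^ j % n = g j := by
  have hn : 0 < n := (Nat.zero_le _).trans_lt (hg 0)
  induction k generalizing g j with
  | zero => omega
  | succ k ih =>
    cases j with
    | zero =>
      rw [block, pow_zero, Nat.div_one, Nat.add_mul_mod_self_left, Nat.mod_eq_of_lt (hg 0)]
    | succ j =>
      rw [block, pow_succ', ← Nat.div_div_eq_div_mul, Nat.add_mul_div_left _ _ hn,
        Nat.div_eq_of_lt (hg 0), zero_add]
      exact ih (fun i => hg (i + 1)) (by omega)

/-! ### The code for the transition functions -/

/-- The expression for the number of the present transition among those that are not in the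
dictionary. -/
def entryExpr : Expr := .var 4 * .var 20 + .var 21 - .var 23

/-- Extracts the digit with the number in register `25` from the block in register `26`. -/
def readDigit : Prog (63 + 1) :=
  .seq (whl (.var 25) (.seq (asg 26 (.var 26 / .var 10)) (asg 25 (.var 25 - .lit 1))))
    (asg 20 (.var 26 % .var 10))

/-- One step of the automaton: a transition in the dictionary leads to the state whose number is
one more than its rank, and the other transitions are stored in an array. -/
def denseStep : Prog (63 + 1) :=
  .seq (search 5) <|
  ite (.var 27) (asg 20 (.var 23 + .lit 1)) <|
  .seq (asg 24 (entryExpr / .var 11)) <|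
  .seq (asg 25 (entryExpr % .var 11)) <|
  .seq readBlock readDigit

/-- One step of the automaton: a transition in the first dictionary leads to the state whose number
is one more than its rank, for a transition in the second dictionary the target is stored
explicitly, and all other transitions lead to the failure state. -/
def sparseStep : Prog (63 + 1) :=
  .seq (search 5) <|
  ite (.var 27) (asg 20 (.var 23 + .lit 1)) <|
  .seq (search 12) <|
  ite (.var 27) (asg 20 (.read (.var 10 + .var 23 * .var 11) (.var 11))) (asg 20 (.var 4))

theorem Loaded.of_agree {H : ℕ → ℕ} {s s' : State} (h : Loaded 19 H s) (ha : Agree 20 s s') :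
    Loaded 19 H s' := fun i h1 h2 => by rw [ha.1 i (by omega), h i h1 h2]

theorem wp_readDigit {w S : ℕ} {m : List Bool} (hB : Wide w S) {s : State} {n : ℕ}
    (h10 : s.v 10 = n) (h26 : s.v 26 ≤ S) (h25 : s.v 25 ≤ S) :
    WP w S m readDigit (s.v 25) (fun s' => Agree 20 s s' ∧
      s'.v 20 = s.v 26 / n ^ s.v 25 % n) s := by
  have h1 := hB.two_le
  refine WP.seq (i := s.v 25) (j := 0) ?_
  set I : ℕ → State → Prop := fun N s' => Agree 20 s s' ∧ s'.v 25 = N ∧ s'.v 26 ≤ S ∧ N ≤ S ∧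
    s'.v 26 / n ^ N = s.v 26 / n ^ s.v 25 with hI
  refine (WP.whl hB (b := 0) I rfl (by simp) ?_ ?_ (n := s.v 25)
    ⟨Agree.refl s, rfl, h26, h25, rfl⟩).mono (by omega) fun _ => id
  · rintro N s1 ⟨hag, c25, c26, cN, cd⟩ hcond
    simp only [Expr.eval_var, c25] at hcond
    obtain ⟨N, rfl⟩ := Nat.exists_eq_succ_of_ne_zero hcond
    have hle : s1.v 26 / n ≤ S := (Nat.div_le_self _ _).trans c26
    refine ⟨N, rfl, WP.seq (i := 0) (j := 0) (WP.asg hB (s1.v 26 / n) (by omega) rfl (by simp)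
      (by simp [hag.1 10 (by omega), h10]) hle
      (WP.asg hB N (by omega) rfl (by simp [c25]; omega) (by simp [c25]) (by omega)
      ⟨(hag.set (by omega) _).set (by omega) _, by simp, by simpa using hle, by omega, ?_⟩))⟩
    rw [← cd, pow_succ', ← Nat.div_div_eq_div_mul]
    simp
  · rintro N s1 ⟨hag, c25, c26, cN, cd⟩ hcond
    simp only [Expr.eval_var, c25] at hcond
    subst hcond
    rw [pow_zero, Nat.div_one] at cd
    refine WP.asg hB (s.v 26 / n ^ s.v 25 % n) (by omega) rfl (by simp)
      (by simp [hag.1 10 (by omega), h10, cd]) ?_ ⟨hag.set (by omega) _, by simp⟩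
    exact (Nat.mod_le _ _).trans ((Nat.div_le_self _ _).trans h26)

/-- The tree transitions, which are in the dictionary: the transition number `τ j` leads to the
state `j + 1`. -/
structure TreeData (n σ : ℕ) (d τ : ℕ → ℕ) : Prop where
  increasing : Increasing (n - 1) τ
  target : ∀ j < n - 1, d (τ j) = j + 1
  lt : ∀ j < n - 1, τ j < σ * n
  d_lt : ∀ t, d t < n

/-- The bounds for the sizes of the parts of a dictionary. -/
structure DictBound (n σ L l b T S : ℕ) : Prop where
  b_pos : 0 < b
  σ_pos : 0 < σ
  σ_lt : σ < 2 ^ l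
  T_lt : T < 2 ^ L
  L_le : 2 ^ L ≤ S
  l_le : 2 ^ l ≤ S
  sum_le : 2 ^ ((b - 1) * l) ≤ S

theorem wp_search_loaded {m : List Bool} {n σ L l b T : ℕ} {τ : ℕ → ℕ} {w S β : ℕ} (hB : Wide w S)
    (hβ : β = 5 ∨ β = 12) {H : ℕ → ℕ} {s : State} (hs : Loaded 19 H s)
    (hD : DictAt m n σ L l b T τ fun i => H (β + i)) (hτ : Increasing T τ)
    (hb : DictBound n σ L l b T S) (h1 : H 1 = L) (h2 : H 2 = l) (h3 : H 3 = b)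
    (hq : s.v 20 < n) (ha : s.v 21 < σ) :
    WP w S m (search β) l (fun s' => Agree 23 s s' ∧
      s'.v 23 = rank T τ (σ * s.v 20 + s.v 21) ∧
      (s'.v 27 ≠ 0 ↔ s'.v 23 < T ∧ τ (s'.v 23) = σ * s.v 20 + s.v 21)) s := by
  refine wp_search hB (by omega) hβ s ?_ hτ hb.b_pos hb.σ_pos hb.σ_lt hb.T_lt hb.L_le hb.l_le
    hb.sum_le (by rw [hs 1 (by omega) (by omega), h1]) (by rw [hs 2 (by omega) (by omega), h2])
    (by rw [hs 3 (by omega) (by omega), h3]) hq ha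
  have e : ∀ i < 4, s.v (β + i) = H (β + i) := fun i hi => hs _ (by omega) (by omega)
  exact ⟨by rw [e 0 (by omega)]; exact hD.samples, by rw [e 1 (by omega)]; exact hD.increments,
    by rw [e 2 (by omega)]; exact hD.sumTable, by rw [e 3 (by omega)]; exact hD.letters⟩

/-- A number that the search does not find is missing in the sequence. -/
theorem missing_of_rank {T : ℕ} {τ : ℕ → ℕ} (h : Increasing T τ) {t : ℕ}
    (hn : ¬ (rank T τ t < T ∧ τ (rank T τ t) = t)) : Missing T τ t := by
  intro j hj hjt
  apply hn
  have h1 : ¬ j < rank T τ t := fun h' => by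
    have := (lt_rank_iff h hj).1 h'
    omega
  rcases (not_lt.1 h1).lt_or_eq with h2 | h2
  · have h3 : τ (rank T τ t) < t := (h _ _ h2 hj).trans_eq hjt
    have := (lt_rank_iff h (h2.trans hj)).2 h3
    omega
  · rw [h2]; exact ⟨hj, hjt⟩

/-- The targets of the transitions that are not in the dictionary. -/
noncomputable def entry (n : ℕ) (d τ : ℕ → ℕ) (i : ℕ) : ℕ := d (Nat.nth (Missing (n - 1) τ) i)

/-- The targets of the transitions that are not in the dictionary, in blocks of length `k`. -/
noncomputable def entryBlock (n k : ℕ) (d τ : ℕ → ℕ) (i : ℕ) : ℕ :=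
  block n k fun j => entry n d τ (i * k + j)

/-- One step takes `l` iterations for the search, `d0` for the levels of the array, and `k` for the
position in the block. -/
theorem wp_denseStep {w S n σ L l b k X c d0 r : ℕ} {m : List Bool} (hB : Wide w S)
    (d τ H : ℕ → ℕ) (hT : TreeData n σ d τ) (hDB : DictBound n σ L l b (n - 1) S)
    (hA : ArrayBound m X l S) (hD : DictAt m n σ L l b (n - 1) τ fun i => H (5 + i))
    (hk : 0 < k) (hX : X = n ^ k) (h1 : H 1 = L) (h2 : H 2 = l) (h3 : H 3 = b) (h4 : H 4 = σ)
    (h10 : H 10 = n) (h11 : H 11 = k) (h12 : H 12 = X) (h13 : H 13 = c) (h14 : H 14 = mu X l)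
    (h15 : H 15 = zeta X l) (h16 : H 16 = Nat.clog 2 X) (h18 : H 18 = d0)
    (hm : Holds m (H 17) (levelBits X l d0 0 c r (fun _ => 0) (entryBlock n k d τ)))
    (hc : 2 * c ≤ r) (hcS : c ≤ S) (hdS : d0 ≤ S) (hd0 : d0 = 0 → c = 0) (hσn : σ * n ≤ S)
    (hr : σ * n - (n - 1) ≤ r * k) (s : State) (hs : Loaded 19 H s)
    (hq : s.v 20 < n) (ha : s.v 21 < σ) :
    WP w S m denseStep (l + (d0 + k)) (fun s' => Loaded 19 H s' ∧
      s'.v 20 = d (σ * s.v 20 + s.v 21) ∧ s'.inp = s.inp) s := by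
  set t := σ * s.v 20 + s.v 21 with ht
  have htlt : t < σ * n := pair_lt ⟨s.v 20, hq⟩ ⟨s.v 21, ha⟩
  have hnS : n ≤ S := (Nat.le_mul_of_pos_left n hDB.σ_pos).trans hσn
  have hτ := hT.increasing
  refine WP.seq (i := l) (j := d0 + k) ((wp_search_loaded hB (Or.inl rfl) hs hD hτ hDB h1 h2 h3 hq
    ha).mono le_rfl ?_)
  rintro s1 ⟨hag, h23, h27⟩
  rw [← ht] at h23 h27
  have hs1 := hs.of_agree (hag.mono (by omega))
  refine WP.ite hB rfl (by simp) ?_ ?_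
  · intro hf
    simp only [Expr.eval_var] at hf
    obtain ⟨hlt, heq⟩ := h27.1 hf
    refine (WP.asg hB (s1.v 23 + 1) (by omega) rfl (by simp [hA.pos]) (by simp) (by omega)
      ⟨hs1.of_agree ((Agree.refl s1).set (by omega) _), ?_, hag.2⟩).mono (by omega) fun _ => id
    rw [← heq, hT.target _ hlt]
    simp
  · intro hf
    simp only [Expr.eval_var] at hf
    have hmiss : Missing (n - 1) τ t := missing_of_rank hτ (by
      rw [← h23]
      exact fun h' => absurd hf (h27.2 h'))
    set i := t - rank (n - 1) τ t with hi
    have hcount := count_missing hτ t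
    have hentry : entry n d τ i = d t := by rw [entry, hi, ← hcount, Nat.nth_count hmiss]
    have hrank : rank (n - 1) τ t ≤ t := by
      have h5 := rank_add_le hτ 0 t
      rw [rank_zero, zero_add] at h5
      omega
    have hilt : i < σ * n - (n - 1) := by
      have h5 := Nat.count_strict_mono hmiss htlt
      have h6 : rank (n - 1) τ (σ * n) = n - 1 := by
        rw [rank, Finset.filter_true_of_mem, Finset.card_range]
        exact fun j hj => hT.lt j (Finset.mem_range.1 hj)
      rw [hcount, count_missing hτ, h6] at h5
      exact h5
    have hiS : i ≤ S := by omega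
    have hmod := Nat.mod_lt i hk
    have hval : ∀ s' : State, Agree 23 s1 s' → s'.v 23 = s1.v 23 →
        entryExpr.eval m s'.v = i ∧ entryExpr.Safe S m s'.v := by
      intro s' h' h23'
      have e4 : s'.v 4 = σ := by rw [h'.1 4 (by omega), hs1 4 (by omega) (by omega), h4]
      have e20 : s'.v 20 = s.v 20 := by rw [h'.1 20 (by omega), hag.1 20 (by omega)]
      have e21 : s'.v 21 = s.v 21 := by rw [h'.1 21 (by omega), hag.1 21 (by omega)]
      simp [entryExpr, e4, e20, e21, h23', h23, ← ht, ← hi, hrank]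
    refine (WP.seq (i := 0) (j := d0 + k) ?_).mono (by omega) fun _ => id
    refine WP.asg hB (i / k) (by omega) rfl ?_ ?_ ((Nat.div_le_self _ _).trans hiS) ?_
    · simpa using (hval s1 (Agree.refl _) rfl).2
    · rw [Expr.eval_div, (hval s1 (Agree.refl _) rfl).1, Expr.eval_var,
        hs1 11 (by omega) (by omega), h11]
    set s2 := s1.set 24 (i / k) with hs2
    have hag2 : Agree 23 s1 s2 := (Agree.refl s1).set (by omega) _
    refine (WP.seq (i := 0) (j := d0 + k) ?_).mono (by omega) fun _ => id
    refine WP.asg hB (i % k) (by omega) rfl ?_ ?_ ((Nat.mod_le _ _).trans hiS) ?_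
    · simpa using (hval s2 hag2 (by simp [hs2])).2
    · rw [Expr.eval_mod, (hval s2 hag2 (by simp [hs2])).1, Expr.eval_var, hag2.1 11 (by omega),
        hs1 11 (by omega) (by omega), h11]
    set s3 := s2.set 25 (i % k) with hs3
    have hag3 : Agree 23 s1 s3 := hag2.set (by omega) _
    have hL3 := hs1.of_agree (hag3.mono (by omega))
    have h24 : s3.v 24 = i / k := by simp [hs3, hs2]
    have h25 : s3.v 25 = i % k := by simp [hs3]
    have hdlt : ∀ j, entry n d τ j < n := fun j => hT.d_lt _
    have hblt : ∀ j, entryBlock n k d τ j < X := fun j => by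
      rw [hX]; exact block_lt k fun _ => hdlt _
    have g : ∀ j, 1 ≤ j → j ≤ 19 → s3.v j = H j := hL3
    refine WP.seq (i := d0) (j := k) ((wp_readBlock hA hB
      ⟨by rw [g 2 (by omega) (by omega), h2], by rw [g 12 (by omega) (by omega), h12],
        by rw [g 14 (by omega) (by omega), h14], by rw [g 15 (by omega) (by omega), h15],
        by rw [g 16 (by omega) (by omega), h16]⟩ (by rw [g 13 (by omega) (by omega), h13])
      (by rw [g 18 (by omega) (by omega), h18]) hc hcS hdS hd0
      (by rw [g 17 (by omega) (by omega)]; exact hm) hblt ?_ ?_).mono le_rfl ?_)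
    · rw [h24]
      exact (Nat.div_lt_iff_lt_mul hk).2 (by omega)
    · rw [h24]
      exact (Nat.div_le_self _ _).trans hiS
    rintro s4 ⟨hag4, h25', h26⟩
    have hL4 := hL3.of_agree (hag4.mono (by omega))
    refine (wp_readDigit hB (by rw [hL4 10 (by omega) (by omega), h10])
      (by rw [h26]; exact (hblt _).le.trans hA.X_le)
      (by rw [h25', h25]; exact (Nat.mod_le _ _).trans hiS)).mono (by rw [h25', h25]; omega) ?_
    rintro s5 ⟨hag5, h20⟩
    refine ⟨hL4.of_agree hag5, ?_, hag5.2.trans (hag4.2.trans (hag3.2.trans hag.2))⟩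
    rw [h20, h26, h25', h24, h25, entryBlock, block_digit (fun j => hdlt _) hmod,
      Nat.div_add_mod', hentry]

/-- One step takes `l` iterations for each of the two searches. -/
theorem wp_sparseStep {w S n σ L l b T f nb : ℕ} {m : List Bool} (hB : Wide w S)
    (d τ η H : ℕ → ℕ) (hT : TreeData n σ d τ) (hDB : DictBound n σ L l b (n - 1) S)
    (hD : DictAt m n σ L l b (n - 1) τ fun i => H (5 + i))
    (hη : Increasing T η) (hDB' : DictBound n σ L l b T S)
    (hD' : DictAt m n σ L l b T η fun i => H (12 + i))
    (h1 : H 1 = L) (h2 : H 2 = l) (h3 : H 3 = b) (h4 : H 4 = f) (h11 : H 11 = nb)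
    (hm : Holds m (H 10) (arr nb T fun j => d (η j))) (hnb : n ≤ 2 ^ nb) (hnbS : 2 ^ nb ≤ S)
    (hf : f < n) (hfail : ∀ t < σ * n, Missing (n - 1) τ t → Missing T η t → d t = f)
    (s : State) (hs : Loaded 19 H s) (hq : s.v 20 < n) (ha : s.v 21 < σ) :
    WP w S m sparseStep (l + l) (fun s' => Loaded 19 H s' ∧
      s'.v 20 = d (σ * s.v 20 + s.v 21) ∧ s'.inp = s.inp) s := by
  set t := σ * s.v 20 + s.v 21 with ht
  have htlt : t < σ * n := pair_lt ⟨s.v 20, hq⟩ ⟨s.v 21, ha⟩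
  have hS2 := hB.two_le
  have hnS : n ≤ S := hnb.trans hnbS
  refine WP.seq (i := l) (j := l) ((wp_search_loaded hB (Or.inl rfl) hs hD hT.increasing hDB h1 h2
    h3 hq ha).mono le_rfl ?_)
  rintro s1 ⟨hag, h23, h27⟩
  rw [← ht] at h23 h27
  have hs1 := hs.of_agree (hag.mono (by omega))
  refine WP.ite hB rfl (by simp) ?_ ?_
  · intro hf
    simp only [Expr.eval_var] at hf
    obtain ⟨hlt, heq⟩ := h27.1 hf
    refine (WP.asg hB (s1.v 23 + 1) (by omega) rfl (by simp; omega) (by simp) (by omega)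
      ⟨hs1.of_agree ((Agree.refl s1).set (by omega) _), ?_, hag.2⟩).mono (by omega) fun _ => id
    rw [← heq, hT.target _ hlt]
    simp
  · intro hz
    simp only [Expr.eval_var] at hz
    have hmiss : Missing (n - 1) τ t := missing_of_rank hT.increasing (by
      rw [← h23]
      exact fun h' => absurd hz (h27.2 h'))
    have e20 : s1.v 20 = s.v 20 := hag.1 20 (by omega)
    have e21 : s1.v 21 = s.v 21 := hag.1 21 (by omega)
    refine WP.seq (i := l) (j := 0) ((wp_search_loaded hB (Or.inr rfl) hs1 hD' hη hDB' h1 h2 h3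
      (by rw [e20]; exact hq) (by rw [e21]; exact ha)).mono le_rfl ?_)
    rintro s2 ⟨hag2, k23, k27⟩
    rw [e20, e21, ← ht] at k23 k27
    have hs2 := hs1.of_agree (hag2.mono (by omega))
    have hinp : s2.inp = s.inp := hag2.2.trans hag.2
    refine WP.ite hB rfl (by simp) ?_ ?_
    · intro hf
      simp only [Expr.eval_var] at hf
      obtain ⟨hlt, heq⟩ := k27.1 hf
      refine WP.asg hB (d t) (by omega) rfl ?_ ?_ ((hT.d_lt t).le.trans hnS)
        ⟨hs2.of_agree ((Agree.refl s2).set (by omega) _), by simp, hinp⟩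
      · simpa [hs2 11 (by omega) (by omega), h11] using hnbS
      · have := hm.arr (i := s2.v 23) hlt ((hT.d_lt _).trans_le hnb)
        rw [heq] at this
        simpa [hs2 11 (by omega) (by omega), h11, hs2 10 (by omega) (by omega)] using this
    · intro hz
      simp only [Expr.eval_var] at hz
      have hmiss' : Missing T η t := missing_of_rank hη (by
        rw [← k23]
        exact fun h' => absurd hz (k27.2 h'))
      refine WP.asg hB f (by omega) rfl (by simp) (by simp [hs2 4 (by omega) (by omega), h4])
        (hf.le.trans hnS) ⟨hs2.of_agree ((Agree.refl s2).set (by omega) _), ?_, hinp⟩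
      rw [hfail t htlt hmiss hmiss']
      simp

/-! ### The space for the array -/

/-- Rounding up to a power of two costs less than a factor of two. -/
theorem two_pow_clog_lt {x : ℕ} (hx : 1 ≤ x) : 2 ^ Nat.clog 2 x < 2 * x := by
  rcases hx.lt_or_eq with h | h
  · have h1 := Nat.pow_pred_clog_lt_self (b := 2) (by omega) h
    have h2 : 0 < Nat.clog 2 x := Nat.clog_pos (by omega) h
    have h3 : 2 ^ Nat.clog 2 x = 2 * 2 ^ (Nat.clog 2 x).pred := by
      rw [← pow_succ', ← Nat.succ_eq_add_one, Nat.succ_pred_eq_of_pos h2]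
    omega
  · simp [← h]

theorem clog_le_logb {x : ℕ} (hx : 1 ≤ x) : (Nat.clog 2 x : ℝ) ≤ Real.logb 2 x + 1 := by
  have hx' : (0 : ℝ) < x := by exact_mod_cast hx
  have h : ((2 : ℝ) ^ Nat.clog 2 x) ≤ 2 * x := by exact_mod_cast (two_pow_clog_lt hx).le
  have h1 := Real.logb_le_logb_of_le (b := 2) (by norm_num) (by positivity) h
  rw [Real.logb_mul (by norm_num) hx'.ne', Real.logb_pow, Real.logb_self_eq_one (by norm_num)] at h1
  linarith

section space

variable {X l σ : ℕ}

/-- The loss of space at a node is at most `8 / σ` bits: the node stores a block and two spills in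
a field of the memory and one spill. -/
theorem width_add_logb_le (hσ : 2 ≤ σ) (hX : σ ^ 2 ≤ X) (h1 : σ < 2 ^ l) (h2 : 2 ^ l ≤ 2 * σ)
    (h : ℕ) :
    (width X l h : ℝ) + Real.logb 2 (spillCard X l (h + 1)) ≤
      Real.logb 2 X + 2 * Real.logb 2 (spillCard X l h) + 8 / σ := by
  have hXpos : 0 < X := lt_of_lt_of_le (by positivity) hX
  have hZ := spillCard_pos (l := l) hXpos h
  have hZ' := spillCard_pos (l := l) hXpos (h + 1)
  have hk := keep_bounds (l := l) hXpos h
  have hkpos := keep_pos (l := l) hXpos h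
  set A := keep X l h with hA
  set Z := spillCard X l h with hZdef
  set Z' := spillCard X l (h + 1) with hZ'def
  have e1 : 2 ^ width X l h ≤ Z * Z * (A + 1) :=
    (Nat.lt_mul_div_succ _ (Nat.mul_pos hZ hZ)).le
  have e2 : Z' * A ≤ X + A :=
    (Nat.div_mul_le_self (X + A - 1) A).trans (Nat.sub_le _ _)
  have hσ0 : (0 : ℝ) < σ := by positivity
  have hXr : (σ : ℝ) ^ 2 ≤ X := by exact_mod_cast hX
  have hX0 : (0 : ℝ) < X := by exact_mod_cast hXpos
  have hZr : (0 : ℝ) < Z := by exact_mod_cast hZ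
  have hZr' : (0 : ℝ) < Z' := by exact_mod_cast hZ'
  have hAr : (0 : ℝ) < A := by exact_mod_cast hkpos
  have e1r : (2 : ℝ) ^ width X l h ≤ Z * Z * (A + 1) := by exact_mod_cast e1
  have e2r : (Z' : ℝ) * A ≤ X + A := by exact_mod_cast e2
  have hAσ : (σ : ℝ) ≤ A := by exact_mod_cast h1.le.trans hk.1
  have hA4 : (A : ℝ) ≤ 4 * σ := by
    have : A ≤ 4 * σ := by omega
    exact_mod_cast this
  have f1 : (A : ℝ) + 1 ≤ A * (1 + 1 / σ) := by
    have : 1 ≤ (A : ℝ) / σ := (one_le_div hσ0).2 hAσ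
    calc (A : ℝ) + 1 ≤ A + A / σ := by linarith
      _ = _ := by ring
  have f2 : (X : ℝ) + A ≤ X * (1 + 4 / σ) := by
    have : (A : ℝ) ≤ 4 * X / σ := by
      rw [le_div_iff₀ hσ0]
      nlinarith
    calc (X : ℝ) + A ≤ X + 4 * X / σ := by linarith
      _ = _ := by ring
  have hmain : (2 : ℝ) ^ width X l h * Z' ≤ X * (Z * Z) * ((1 + 1 / σ) * (1 + 4 / σ)) := by
    calc (2 : ℝ) ^ width X l h * Z' ≤ Z * Z * (A * (1 + 1 / σ)) * Z' := by
          gcongr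
          exact e1r.trans (by gcongr)
      _ = Z * Z * (1 + 1 / σ) * (Z' * A) := by ring
      _ ≤ Z * Z * (1 + 1 / σ) * (X * (1 + 4 / σ)) := by
          exact mul_le_mul_of_nonneg_left (e2r.trans f2) (by positivity)
      _ = _ := by ring
  have hlog := Real.logb_le_logb_of_le (b := 2) (by norm_num) (by positivity) hmain
  have g1 : (1 + 1 / (σ : ℝ)) ≠ 0 := by positivity
  have g2 : (1 + 4 / (σ : ℝ)) ≠ 0 := by positivity
  rw [Real.logb_mul (by positivity) hZr'.ne', Real.logb_pow, Real.logb_self_eq_one (by norm_num),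
    Real.logb_mul (by positivity) (by positivity), Real.logb_mul hX0.ne' (by positivity),
    Real.logb_mul hZr.ne' hZr.ne', Real.logb_mul g1 g2] at hlog
  have g3 : Real.log (1 + 1 / (σ : ℝ)) ≤ 1 / σ := by
    have := Real.log_le_sub_one_of_pos (show (0 : ℝ) < 1 + 1 / σ by positivity)
    linarith
  have g4 : Real.log (1 + 4 / (σ : ℝ)) ≤ 4 / σ := by
    have := Real.log_le_sub_one_of_pos (show (0 : ℝ) < 1 + 4 / σ by positivity)
    linarith
  have hl2 := Real.log_two_gt_d9
  have g5 : Real.logb 2 (1 + 1 / (σ : ℝ)) + Real.logb 2 (1 + 4 / (σ : ℝ)) ≤ 8 / σ := by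
    rw [Real.logb, Real.logb, ← add_div, div_le_iff₀ (by linarith)]
    have : 8 / (σ : ℝ) * Real.log 2 ≥ 8 / σ * (5 / 8) := by
      gcongr
      linarith
    calc _ ≤ 1 / (σ : ℝ) + 4 / σ := add_le_add g3 g4
      _ = 8 / σ * (5 / 8) := by ring
      _ ≤ _ := this
  linarith

/-- A spill in a field of its own loses at most two bits. -/
theorem zeta_le (hX : 0 < X) (h : ℕ) :
    (zeta X l : ℝ) ≤ Real.logb 2 (spillCard X l (h + 1)) + 2 := by
  have hz := zmin_pos (l := l) hX
  have h1 := (spillCard_bounds (l := l) hX h).1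
  have h2 := clog_le_logb (x := 2 * zmin X l) (by omega)
  have hz' : (0 : ℝ) < zmin X l := by exact_mod_cast hz
  have h3 : Real.logb 2 (zmin X l) ≤ Real.logb 2 (spillCard X l (h + 1)) :=
    Real.logb_le_logb_of_le (by norm_num) hz' (by exact_mod_cast h1)
  rw [Nat.cast_mul, Nat.cast_two, Real.logb_mul (by norm_num) hz'.ne',
    Real.logb_self_eq_one (by norm_num)] at h2
  rw [zeta]
  linarith

/-- The number of bits that are lost because spills and blocks that are not contained in a node are
stored in fields of their own. -/
def slack : (d c r : ℕ) → ℕ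
  | 0, _, r => r
  | d + 1, c, r => 2 * (c - 2 * nextCount (d + 1) c) + slack d (nextCount (d + 1) c) (r - c)

/-- The number of nodes is halved from level to level, and at most one spill at each level, except
for the last one, has no node. -/
theorem slack_le {d c r : ℕ} (h : 2 * c ≤ r) :
    slack (d + 1) c r ≤ (r - 2 * c) + 3 * d + 3 * (c / 2 ^ d) := by
  induction d generalizing c r with
  | zero => simp [slack, nextCount]; omega
  | succ d ih =>
    have e : nextCount (d + 1 + 1) c = c / 2 := by simp [nextCount]
    have h2 := ih (c := c / 2) (r := r - c) (by omega)
    rw [Nat.div_div_eq_div_mul, ← pow_succ'] at h2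
    rw [slack, e]
    omega

/-- The loss of a node is counted for its block. The spills that come into the first level are
counted twice for each of its nodes, because a node contains two of them. -/
theorem length_levelBits_le (hσ : 2 ≤ σ) (hX : σ ^ 2 ≤ X) (h1 : σ < 2 ^ l) (h2 : 2 ^ l ≤ 2 * σ)
    {d h c r : ℕ} {y x : ℕ → ℕ} (hc : 2 * c ≤ r) (hd : d = 0 → c = 0) :
    ((levelBits X l d h c r y x).length : ℝ) ≤
      r * (Real.logb 2 X + 8 / σ) + 2 * c * Real.logb 2 (spillCard X l h) + slack d c r := by
  have hXpos : 0 < X := lt_of_lt_of_le (by positivity) hX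
  have hσ0 : (0 : ℝ) < σ := by positivity
  induction d generalizing h c r y x with
  | zero =>
    have h3 := clog_le_logb hXpos
    rw [hd rfl]
    simp only [levelBits, length_arr, slack, Nat.cast_mul]
    have h4 : (0 : ℝ) ≤ 8 / σ := by positivity
    have h5 : (r : ℝ) * Nat.clog 2 X ≤ r * (Real.logb 2 X + 8 / σ + 1) := by
      gcongr; linarith
    push_cast
    linarith
  | succ d ih =>
    have hn := two_mul_nextCount_le (d + 1) c
    have h3 := width_add_logb_le hσ hX h1 h2 h
    have h4 := zeta_le (l := l) hXpos h
    have h5 := ih (h := h + 1) (c := nextCount (d + 1) c) (r := r - c)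
      (y := fun i => x i / keep X l h) (x := fun i => x (c + i)) (by omega)
      (by intro hd; simp [nextCount, hd])
    simp only [levelBits, List.length_append, length_arr, slack]
    rw [Nat.cast_sub (show c ≤ r by omega)] at h5
    push_cast [Nat.cast_sub hn]
    have hc0 : (0 : ℝ) ≤ c := Nat.cast_nonneg c
    have hp0 : (0 : ℝ) ≤ (c : ℝ) - 2 * nextCount (d + 1) c := by
      have : ((2 * nextCount (d + 1) c : ℕ) : ℝ) ≤ c := by exact_mod_cast hn
      push_cast at this
      linarith
    have h6 := mul_le_mul_of_nonneg_left h3 hc0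
    have h7 := mul_le_mul_of_nonneg_left h4 hp0
    linarith

/-- The array of the transitions that are not in the dictionary takes little space. The blocks have
`k` entries, so that their number of values is large compared with `σ`; for `n = 1`, no bits are
needed. -/
theorem exists_array {n : ℕ} (hn : 1 ≤ n) (hσ : 2 ≤ σ) (h1 : σ < 2 ^ l) (h2 : 2 ^ l ≤ 2 * σ) :
    ∃ k c d r : ℕ, 0 < k ∧ k ≤ 2 * l ∧ n ^ k ≤ σ ^ 2 * n ∧ 2 * c ≤ r ∧ r ≤ σ * n ∧ d ≤ l ∧
      (d = 0 → c = 0) ∧ σ * n - (n - 1) ≤ r * k ∧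
      ∀ x, ((levelBits (n ^ k) l d 0 c r (fun _ => 0) x).length : ℝ) ≤
        ((σ : ℝ) - 1) * n * Real.logb 2 n + 18 * (n * l) := by
  have hl : 1 ≤ l := by
    by_contra h
    have : l = 0 := by omega
    subst this
    omega
  rcases hn.lt_or_eq with hn2 | hn1
  · have hs2 : 1 < σ ^ 2 := by nlinarith
    set k := Nat.clog n (σ ^ 2) with hk
    have hk0 : 0 < k := Nat.clog_pos hn2 hs2
    have hpk : σ ^ 2 ≤ n ^ k := Nat.le_pow_clog hn2 _
    have hpk' : n ^ (k - 1) < σ ^ 2 := Nat.pow_pred_clog_lt_self hn2 hs2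
    set M := σ * n - (n - 1) with hM
    have hMle : M ≤ σ * n := Nat.sub_le _ _
    have hσn : n ≤ σ * n := Nat.le_mul_of_pos_left n (by omega)
    set r := (M + k - 1) / k with hr
    have hrk : r * k ≤ M + k - 1 := Nat.div_mul_le_self _ _
    have hMr : M ≤ r * k := by
      have h3 : M + k - 1 < k * (r + 1) := Nat.lt_mul_div_succ (M + k - 1) hk0
      have h4 : k * (r + 1) = r * k + k := by ring
      omega
    have hrM : r ≤ M := by
      have h3 : r * k ≤ M * k := by
        have : M - 1 + k ≤ M * k := by
          obtain ⟨a, ha⟩ : ∃ a, M = a + 1 := ⟨M - 1, by omega⟩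
          rw [ha, add_mul, one_mul, Nat.add_sub_cancel]
          nlinarith
        omega
      exact Nat.le_of_mul_le_mul_right h3 hk0
    clear_value r
    have hk2 : k ≤ 2 * l := by
      have h3 : 2 ^ (k - 1) ≤ n ^ (k - 1) := Nat.pow_le_pow_left hn2 _
      have h4 : σ ^ 2 < 2 ^ (2 * l) := by
        rw [mul_comm, pow_mul]
        exact Nat.pow_lt_pow_left h1 (by omega)
      have := (Nat.pow_lt_pow_iff_right (by omega : 1 < 2)).1 (h3.trans_lt (hpk'.trans h4))
      omega
    refine ⟨k, r / 2, l, r, hk0, hk2, ?_, by omega, hrM.trans hMle, le_rfl, by omega, hMr,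
      fun x => ?_⟩
    · obtain ⟨j, hj⟩ : ∃ j, k = j + 1 := ⟨k - 1, by omega⟩
      rw [hj, Nat.add_sub_cancel] at hpk'
      rw [hj, pow_succ]
      exact Nat.mul_le_mul_right _ hpk'.le
    · have hlen := length_levelBits_le (y := fun _ => 0) (x := x) (h := 0) (d := l) (c := r / 2)
        (r := r) hσ hpk h1 h2 (by omega) (by omega)
      have hsl : slack l (r / 2) r ≤ 1 + 3 * l + 3 * n := by
        obtain ⟨j, rfl⟩ : ∃ j, l = j + 1 := ⟨l - 1, by omega⟩
        have h3 := slack_le (d := j) (c := r / 2) (r := r) (by omega)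
        rw [Nat.div_div_eq_div_mul, ← pow_succ'] at h3
        have h4 : r / 2 ^ (j + 1) ≤ n := by
          refine (Nat.div_le_div_right (hrM.trans hMle)).trans ?_
          refine Nat.div_le_of_le_mul ?_
          exact Nat.mul_le_mul_right _ h1.le
        omega
      have hσ0 : (0 : ℝ) < σ := by positivity
      have hn0 : (0 : ℝ) < n := by exact_mod_cast hn
      have hlogn : 0 ≤ Real.logb 2 n := Real.logb_nonneg (by norm_num) (by exact_mod_cast hn)
      -- the blocks that are not full
      have hpad : ((k : ℝ) - 1) * Real.logb 2 n ≤ 2 * l := by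
        have h3 : ((n : ℝ) ^ (k - 1)) ≤ 2 ^ (2 * l) := by
          have : n ^ (k - 1) ≤ 2 ^ (2 * l) := by
            rw [mul_comm, pow_mul]
            exact hpk'.le.trans (Nat.pow_le_pow_left h1.le 2)
          exact_mod_cast this
        have h4 := Real.logb_le_logb_of_le (b := 2) (by norm_num) (by positivity) h3
        rw [Real.logb_pow, Real.logb_pow, Real.logb_self_eq_one (by norm_num),
          Nat.cast_sub hk0] at h4
        push_cast at h4
        linarith
      have hself : Real.logb 2 n ≤ n := by
        have h3 : (n : ℝ) ≤ 2 ^ n := by exact_mod_cast (Nat.lt_two_pow_self).le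
        have h4 := Real.logb_le_logb_of_le (b := 2) (by norm_num) hn0 h3
        rw [Real.logb_pow, Real.logb_self_eq_one (by norm_num)] at h4
        linarith
      have hMr' : (M : ℝ) = (σ - 1) * n + 1 := by
        rw [hM, Nat.cast_sub (by omega), Nat.cast_sub hn]
        push_cast
        ring
      have hrk' : (r : ℝ) * k ≤ M + (k - 1) := by
        have : r * k + 1 ≤ M + k := by omega
        have : ((r * k + 1 : ℕ) : ℝ) ≤ ((M + k : ℕ) : ℝ) := by exact_mod_cast this
        push_cast at this
        linarith
      have hr8 : (r : ℝ) * (8 / σ) ≤ 8 * n := by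
        have h3 : (r : ℝ) ≤ σ * n := by exact_mod_cast hrM.trans hMle
        rw [mul_div_assoc', div_le_iff₀ hσ0]
        nlinarith
      have h5 : (r : ℝ) * Real.logb 2 ((n ^ k : ℕ) : ℝ) ≤
          (σ - 1) * n * Real.logb 2 n + n + 2 * l := by
        push_cast
        rw [Real.logb_pow, ← mul_assoc]
        calc _ ≤ ((M : ℝ) + (k - 1)) * Real.logb 2 n := by gcongr
          _ = (σ - 1) * n * Real.logb 2 n + Real.logb 2 n + (k - 1) * Real.logb 2 n := by
            rw [hMr']; ring
          _ ≤ _ := by linarith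
      have hsl' : (slack l (r / 2) r : ℝ) ≤ 1 + 3 * l + 3 * n := by exact_mod_cast hsl
      have hsp : Real.logb 2 (spillCard (n ^ k) l 0) = 0 := by simp [spillCard]
      rw [hsp] at hlen
      have hl1 : (1 : ℝ) ≤ l := by exact_mod_cast hl
      have hn1 : (1 : ℝ) ≤ n := by exact_mod_cast hn
      have e1 : (n : ℝ) ≤ n * l := by nlinarith
      have e2 : (l : ℝ) ≤ n * l := by nlinarith
      linarith
  · refine ⟨1, 0, 0, σ, by omega, by omega, ?_, by omega, ?_, by omega, by simp, ?_, fun x => ?_⟩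
    · rw [← hn1]; nlinarith
    · rw [← hn1]; omega
    · rw [← hn1]; omega
    · simp only [levelBits, length_arr, ← hn1]
      simp

end space

/-! ### The space for the dictionary -/

/-- The four parts of the dictionary. -/
def dictBits (n σ L l b T : ℕ) (τ : ℕ → ℕ) : List Bool :=
  samples n σ L b T τ ++ (increments n σ l T τ ++ (sumTable L l b ++ letters σ l T τ))

theorem dictAt_of_holds {m : List Bool} {n σ L l b T p : ℕ} {τ B : ℕ → ℕ}
    (h : Holds m p (dictBits n σ L l b T τ)) (h0 : B 0 = p) (h1 : B 1 = p + (n / b + 1) * L)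
    (h2 : B 2 = p + (n / b + 1) * L + n * l)
    (h3 : B 3 = p + (n / b + 1) * L + n * l + 2 ^ ((b - 1) * l) * L) :
    DictAt m n σ L l b T τ B := by
  have e1 := h.right
  have e2 := e1.right
  have e3 := e2.right
  simp only [samples, increments, sumTable, length_arr] at e1 e2 e3
  exact ⟨by rw [h0]; exact h.left, by rw [h1]; exact e1.left, by rw [h2]; exact e2.left,
    by rw [h3]; exact e3⟩

theorem length_dictBits (n σ L l b T : ℕ) (τ : ℕ → ℕ) : (dictBits n σ L l b T τ).length =
    (n / b + 1) * L + n * l + 2 ^ ((b - 1) * l) * L + T * l := by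
  simp only [dictBits, samples, increments, sumTable, letters, List.length_append, length_arr]
  ring

/-- The number of bits of the fields of the header. The factor `20` is generous: all addresses and
parameters turn out to be at most the power of `2 ^ (l + (log n + 1))` with exponent `6`. -/
def fieldWidth (n l : ℕ) : ℕ := 20 * (l + (Nat.log 2 n + 1))

/-- The distance between the samples of the prefix sums. -/
def gap (n l : ℕ) : ℕ := Nat.log 2 n / 2 / l + 1

theorem gap_pow_le {n : ℕ} (hn : 1 ≤ n) (l : ℕ) :
    2 ^ ((gap n l - 1) * l) ≤ 2 ^ (Nat.log 2 n / 2) ∧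
      2 ^ (Nat.log 2 n / 2) * 2 ^ (Nat.log 2 n / 2) ≤ n := by
  constructor
  · exact Nat.pow_le_pow_right (by omega) (by simpa [gap] using Nat.div_mul_le_self _ _)
  · rw [← pow_add]
    exact (Nat.pow_le_pow_right (by omega) (by omega)).trans (Nat.pow_log_le_self 2 (by omega))

theorem fieldWidth_le {n l : ℕ} (hn : 1 ≤ n) (hl : 1 ≤ l) : fieldWidth n l ≤ 40 * (n * l) := by
  have h1 : Nat.log 2 n + 1 ≤ n := Nat.log_lt_self 2 (by omega)
  have h2 : n ≤ n * l := Nat.le_mul_of_pos_right n hl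
  have h3 : l ≤ n * l := Nat.le_mul_of_pos_left l hn
  simp only [fieldWidth]
  omega

/-- There is one sample of `L = O(l + log n)` bits for `b` states, where `b * l` exceeds
`⌊log n / 2⌋`. The table has at most `√n` entries. -/
theorem length_dictBits_le {n l : ℕ} (hn : 1 ≤ n) (hl : 1 ≤ l) (σ T : ℕ) (τ : ℕ → ℕ) :
    (dictBits n σ (fieldWidth n l) l (gap n l) T τ).length ≤ 201 * (n * l) + T * l := by
  rw [length_dictBits]
  set t := Nat.log 2 n / 2 with ht
  set b := gap n l with hb
  have hb1 : 1 ≤ b := by simp [hb, gap]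
  have hlogn : Nat.log 2 n + 1 ≤ n := Nat.log_lt_self 2 (by omega)
  have hnl : n ≤ n * l := Nat.le_mul_of_pos_right n hl
  have hln : l ≤ n * l := Nat.le_mul_of_pos_left l hn
  -- the samples
  have htb : t < l * b := Nat.lt_mul_div_succ t hl
  have h1 : fieldWidth n l ≤ 100 * (b * l) := by
    have h2 : l ≤ b * l := Nat.le_mul_of_pos_left l hb1
    have h3 : l * b = b * l := mul_comm _ _
    simp only [fieldWidth]
    omega
  have h2 : n / b * fieldWidth n l ≤ 100 * (n * l) :=
    calc n / b * fieldWidth n l ≤ n / b * (100 * (b * l)) := Nat.mul_le_mul_left _ h1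
      _ = 100 * (n / b * b * l) := by ring
      _ ≤ 100 * (n * l) :=
        Nat.mul_le_mul_left _ (Nat.mul_le_mul_right _ (Nat.div_mul_le_self n b))
  have h3 := fieldWidth_le hn hl
  -- the table
  obtain ⟨h4, h5⟩ := gap_pow_le hn l
  rw [← ht] at h4 h5
  rw [← hb] at h4
  have h6 : t < 2 ^ t := Nat.lt_two_pow_self
  have h7 : 2 ^ ((b - 1) * l) * fieldWidth n l ≤ 60 * (n * l) := by
    have h8 : fieldWidth n l ≤ 20 * (l + 2 * 2 ^ t) := by
      simp only [fieldWidth]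
      omega
    have h9 : 2 ^ t ≤ n := (Nat.le_mul_of_pos_left _ (by positivity)).trans h5
    calc 2 ^ ((b - 1) * l) * fieldWidth n l ≤ 2 ^ t * (20 * (l + 2 * 2 ^ t)) :=
          Nat.mul_le_mul h4 h8
      _ = 20 * (2 ^ t * l) + 40 * (2 ^ t * 2 ^ t) := by ring
      _ ≤ 20 * (n * l) + 40 * n := by
          have := Nat.mul_le_mul_right l h9
          omega
      _ ≤ 60 * (n * l) := by omega
  rw [add_mul, one_mul]
  omega

/-! ### The bounds for the fields of the header -/

section bounds

variable {n σ : ℕ}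

/-- The number of bits of a letter. -/
def letterWidth (σ : ℕ) : ℕ := Nat.log 2 σ + 1

theorem lt_two_pow_letterWidth (σ : ℕ) : σ < 2 ^ letterWidth σ :=
  Nat.lt_pow_succ_log_self (by omega) σ

theorem two_pow_letterWidth_le (hσ : 2 ≤ σ) : 2 ^ letterWidth σ ≤ 2 * σ := by
  rw [letterWidth, pow_succ']
  exact Nat.mul_le_mul_left 2 (Nat.pow_log_le_self 2 (by omega))

theorem one_le_letterWidth (σ : ℕ) : 1 ≤ letterWidth σ := Nat.succ_pos _

theorem log_le_logb {x : ℕ} (hx : 1 ≤ x) : (Nat.log 2 x : ℝ) ≤ Real.logb 2 x := by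
  have hx' : (0 : ℝ) < x := by exact_mod_cast hx
  rw [Real.le_logb_iff_rpow_le (by norm_num) hx', Real.rpow_natCast]
  exact_mod_cast Nat.pow_log_le_self 2 (by omega)

theorem one_le_logb (hσ : 2 ≤ σ) : 1 ≤ Real.logb 2 σ := by
  rw [Real.le_logb_iff_rpow_le (by norm_num) (by positivity), Real.rpow_one]
  exact_mod_cast hσ

theorem letterWidth_le (hσ : 2 ≤ σ) : (letterWidth σ : ℝ) ≤ 2 * Real.logb 2 σ := by
  have h1 := log_le_logb (x := σ) (by omega)
  have h2 := one_le_logb hσ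
  rw [letterWidth]
  push_cast
  linarith

theorem logb_nonneg (hn : 1 ≤ n) : 0 ≤ Real.logb 2 n :=
  Real.logb_nonneg (by norm_num) (by exact_mod_cast hn)

theorem logb_le_self (hn : 1 ≤ n) : Real.logb 2 n ≤ n := by
  rw [Real.logb_le_iff_le_rpow (by norm_num) (by exact_mod_cast hn), Real.rpow_natCast]
  exact_mod_cast Nat.lt_two_pow_self.le

/-- The fields of the header are short in comparison with the words. -/
theorem wide_of_le (hσ : 2 ≤ σ) (hn : 1 ≤ n) {w : ℕ}
    (hw : 3841 * Real.logb 2 ((σ : ℝ) * n) ≤ w) :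
    Wide w (2 ^ fieldWidth n (letterWidth σ)) := by
  have h1 := log_le_logb (x := σ) (by omega)
  have h2 := log_le_logb hn
  have h3 := one_le_logb hσ
  have h4 := logb_nonneg hn
  have hn' : (n : ℝ) ≠ 0 := by positivity
  rw [Real.logb_mul (by positivity) hn'] at hw
  -- `l + (log n + 1)` is at most `3 * log (σ * n)`, and `64 * 20 * 3 = 3840`
  have h5 : ((fieldWidth n (letterWidth σ) * 64 : ℕ) : ℝ) < w := by
    simp only [fieldWidth, letterWidth]
    push_cast
    linarith
  refine ⟨?_, ?_⟩
  · calc 2 = 2 ^ 1 := rfl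
      _ ≤ _ := Nat.pow_le_pow_right (by omega) (by simp only [fieldWidth]; omega)
  · rw [← pow_mul]
    exact Nat.pow_lt_pow_right (by omega) (by exact_mod_cast h5)

theorem time_le (hσ : 2 ≤ σ) {b : ℕ} (hb : b ≤ 4 * letterWidth σ) (z k : ℕ) :
    ((z * (k * (b + 1) + 1) : ℕ) : ℝ) ≤ 10 * (z : ℝ) * (k * Real.logb 2 σ + 1) := by
  have h1 : (b : ℝ) ≤ 4 * letterWidth σ := by exact_mod_cast hb
  have h2 := letterWidth_le hσ
  have h3 := one_le_logb hσ
  have h4 : (k : ℝ) * (b + 1) ≤ k * (10 * Real.logb 2 σ) :=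
    mul_le_mul_of_nonneg_left (by linarith) (by positivity)
  push_cast
  rw [mul_comm (10 : ℝ), mul_assoc]
  exact mul_le_mul_of_nonneg_left (by linarith) (by positivity)

/-- A number such that all parameters are bounded by a small power of it. -/
def scale (n σ : ℕ) : ℕ := 2 ^ (letterWidth σ + (Nat.log 2 n + 1))

theorem two_pow_fieldWidth (n σ : ℕ) : 2 ^ fieldWidth n (letterWidth σ) = scale n σ ^ 20 := by
  rw [scale, ← pow_mul, fieldWidth, mul_comm]

theorem scale_bounds (n : ℕ) (hσ : 2 ≤ σ) : 8 ≤ scale n σ ∧ σ * n ≤ scale n σ ∧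
    n * letterWidth σ ≤ scale n σ ∧ 2 ^ letterWidth σ ≤ scale n σ := by
  have h1 := lt_two_pow_letterWidth σ
  have h2 : n < 2 ^ (Nat.log 2 n + 1) := Nat.lt_pow_succ_log_self (by omega) n
  have h3 : letterWidth σ < 2 ^ letterWidth σ := Nat.lt_two_pow_self
  rw [scale, pow_add]
  refine ⟨?_, Nat.mul_le_mul h1.le h2.le, ?_, Nat.le_mul_of_pos_right _ (by positivity)⟩
  · have h4 : 2 ^ 2 ≤ 2 ^ letterWidth σ := by
      refine Nat.pow_le_pow_right (by omega) ?_
      have : 1 ≤ Nat.log 2 σ := Nat.log_pos (by omega) hσ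
      simp only [letterWidth]
      omega
    have h5 : 2 ^ 1 ≤ 2 ^ (Nat.log 2 n + 1) := Nat.pow_le_pow_right (by omega) (by omega)
    exact Nat.mul_le_mul h4 h5
  · rw [mul_comm]
    exact Nat.mul_le_mul h3.le h2.le

theorem lt_of_le_scale_pow (hσ : 2 ≤ σ) {a : ℕ} (h : a ≤ scale n σ ^ 6) :
    a < 2 ^ fieldWidth n (letterWidth σ) := by
  have h1 := (scale_bounds n hσ).1
  rw [two_pow_fieldWidth]
  exact h.trans_lt (Nat.pow_lt_pow_right (by omega) (by omega))

theorem dictBound (hσ : 0 < σ) (hn : 1 ≤ n) {T : ℕ}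
    (hT : T < 2 ^ fieldWidth n (letterWidth σ)) :
    DictBound n σ (fieldWidth n (letterWidth σ)) (letterWidth σ) (gap n (letterWidth σ)) T
      (2 ^ fieldWidth n (letterWidth σ)) where
  b_pos := Nat.succ_pos _
  σ_pos := hσ
  σ_lt := lt_two_pow_letterWidth σ
  T_lt := hT
  L_le := le_rfl
  l_le := Nat.pow_le_pow_right (by omega) (by simp only [fieldWidth]; omega)
  sum_le := (gap_pow_le hn _).1.trans
    (Nat.pow_le_pow_right (by omega) (by simp only [fieldWidth]; omega))

theorem gap_lt (n l : ℕ) : gap n l < 2 ^ fieldWidth n l := by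
  have h1 : Nat.log 2 n / 2 / l ≤ Nat.log 2 n / 2 := Nat.div_le_self _ _
  have h2 : gap n l ≤ fieldWidth n l := by
    simp only [gap, fieldWidth]
    omega
  exact h2.trans_lt Nat.lt_two_pow_self

theorem getD_lt {xs : List ℕ} {B : ℕ} (hB : 0 < B) (h : ∀ x ∈ xs, x < B) (i : ℕ) :
    xs.getD i 0 < B := by
  by_cases hi : i < xs.length
  · rw [List.getD_eq_getElem _ _ hi]
    exact h _ (List.getElem_mem hi)
  · rw [List.getD_eq_default _ _ (by omega)]
    exact hB

end bounds

/-! ### The simulation of an automaton -/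

section simulation

variable {n σ : ℕ}

/-- The program, run on the memory `m`, simulates the automaton `A` with its states numbered in
some way: before the answer is computed, register `20` holds the number of the state. -/
def Simulates (step : Prog (63 + 1)) (K : ℝ) (A : DFA (Fin σ) (Fin n)) (m : List Bool) : Prop :=
  ∃ e : Fin n ≃ Fin n, ∀ w : ℕ, 3841 * Real.logb 2 ((σ : ℝ) * n) ≤ w → ∀ x : List (Fin σ),
    ∃ st T, Exec m (runProg step) (initial (63 + 1) w x) st T ∧
      (st.regs (reg 20)).toNat = e (A.eval x) ∧
      ∃ st' T', Exec m answer st st' T' ∧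
        ((T + T' : ℕ) : ℝ) ≤ K * (x.length * Real.logb 2 σ + 1) ∧
        (st'.regs 0 ≠ 0 ↔ x ∈ A.accepts)

theorem Simulates.decides {step : Prog (63 + 1)} {K C : ℝ} {A : DFA (Fin σ) (Fin n)}
    {m : List Bool} (h : Simulates step K A m) (hσ : 2 ≤ σ) (hC : K ≤ C) {w : ℕ}
    (hw : 3841 * Real.logb 2 ((σ : ℝ) * n) ≤ w) (x : List (Fin σ)) :
    Decides (fullProg step) w m x (C * (x.length * Real.logb 2 σ + 1)) (x ∈ A.accepts) := by
  obtain ⟨e, h⟩ := h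
  obtain ⟨st, T, h1, -, st', T', h2, h3, h4⟩ := h w hw x
  have := one_le_logb hσ
  exact ⟨st', T + T', .seq h1 h2, h3.trans (mul_le_mul_of_nonneg_right hC (by positivity)), h4⟩

/-- As the program is deterministic, the memory determines the automaton. -/
theorem Simulates.isomorphic {step : Prog (63 + 1)} {K : ℝ} {A B : DFA (Fin σ) (Fin n)}
    {m : List Bool} (hA : Simulates step K A m) (hB : Simulates step K B m)
    (hc : A.InitiallyConnected) : A.Isomorphic B := by
  obtain ⟨e, hA⟩ := hA
  obtain ⟨e', hB⟩ := hB
  obtain ⟨w, hw⟩ := exists_nat_ge (3841 * Real.logb 2 ((σ : ℝ) * n))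
  refine isomorphic_of_eval A B hc e e' (fun x => ?_) fun x => ?_
  · obtain ⟨st, T, h1, h2, -⟩ := hA w hw x
    obtain ⟨st', T', h1', h2', -⟩ := hB w hw x
    obtain rfl := h1.unique h1'
    exact Fin.ext (h2.symm.trans h2')
  · obtain ⟨st, T, h1, -, st₂, T₂, h3, -, h4⟩ := hA w hw x
    obtain ⟨st', T', h1', -, st₂', T₂', h3', -, h4'⟩ := hB w hw x
    obtain rfl := h1.unique h1'
    obtain rfl := h3.unique h3'
    exact h4.symm.trans h4'

open Classical in
/-- The acceptance bits of the states. -/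
noncomputable def acceptBit (A : DFA (Fin σ) (Fin n)) (e : Fin n ≃ Fin n) (i : ℕ) : ℕ :=
  if ∃ q ∈ A.accept, (e q : ℕ) = i then 1 else 0

theorem acceptBit_ne_zero_iff (A : DFA (Fin σ) (Fin n)) (e : Fin n ≃ Fin n) (q : Fin n) :
    acceptBit A e (e q) ≠ 0 ↔ q ∈ A.accept := by
  have h : (∃ q' ∈ A.accept, (e q' : ℕ) = e q) ↔ q ∈ A.accept := by
    simp [← Fin.ext_iff]
  rw [acceptBit]
  split_ifs with h'
  · simpa using h.1 h'
  · simpa using fun hq => h' (h.2 hq)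

/-- The encodings only have to provide the code for one step. -/
theorem simulates_of_step {step : Prog (63 + 1)} {A : DFA (Fin σ) (Fin n)} {b : ℕ} {H : ℕ → ℕ}
    {m : List Bool} (hσ : 2 ≤ σ) (e : Fin n ≃ Fin n) (h0 : (e A.start : ℕ) = 0)
    (hb : b ≤ 4 * letterWidth σ)
    (hstep : ∀ w, Wide w (2 ^ fieldWidth n (letterWidth σ)) → ∀ s, Loaded 19 H s → s.v 20 < n →
      s.v 21 < σ → WP w (2 ^ fieldWidth n (letterWidth σ)) m step b (fun s' => Loaded 19 H s' ∧
        s'.v 20 = trans A e (σ * s.v 20 + s.v 21) ∧ s'.inp = s.inp) s)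
    (hL : H 1 = fieldWidth n (letterWidth σ)) (hH : ∀ i, H i < 2 ^ fieldWidth n (letterWidth σ))
    (hm : Holds m 0 (header (fieldWidth n (letterWidth σ)) 19 H))
    (hacc : Holds m (H 9) (arr 1 n (acceptBit A e))) :
    Simulates step (10 * ((fullProg step).size : ℝ)) A m := by
  have hn : 1 ≤ n := (Nat.zero_le _).trans_lt A.start.2
  obtain ⟨h8, hσn, -, -⟩ := scale_bounds n hσ
  have hlt : ∀ {a}, a ≤ scale n σ ^ 6 → a < 2 ^ fieldWidth n (letterWidth σ) :=
    lt_of_le_scale_pow hσ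
  refine ⟨e, fun w hw x => ?_⟩
  have hB := wide_of_le hσ hn hw
  have h40 : 40 ≤ 2 ^ fieldWidth n (letterWidth σ) :=
    (hlt ((by norm_num : 40 ≤ 8 ^ 6).trans (Nat.pow_le_pow_left h8 6))).le
  have hσS : σ ≤ 2 ^ fieldWidth n (letterWidth σ) :=
    (hlt (((Nat.le_mul_of_pos_right σ hn).trans hσn).trans (Nat.le_self_pow (by omega) _))).le
  obtain ⟨st, T, r1, r2, st', T', r3, r4, r5⟩ := run_fullProg hB h40 step (trans A e)
    (acceptBit A e) hσS (trans_lt A e) (hstep w hB) hL le_rfl hH hm hacc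
    (fun i => by rw [acceptBit]; split_ifs <;> omega) x
  rw [foldl_trans A e h0 x] at r2 r5
  refine ⟨st, T, r1, r2, st', T', r3, ?_, r5.trans ?_⟩
  · exact (Nat.cast_le.2 r4).trans (time_le hσ hb _ _)
  · rw [acceptBit_ne_zero_iff, DFA.mem_accepts]

theorem treeData {A : DFA (Fin σ) (Fin n)} {e : Fin n ≃ Fin n} {τ : ℕ → ℕ}
    (hτ : Increasing (n - 1) τ) (h : ∀ j < n - 1, ∃ (p : Fin n) (a : Fin σ),
      τ j = σ * (e p : ℕ) + a ∧ (e (A.step p a) : ℕ) = j + 1) :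
    TreeData n σ (trans A e) τ where
  increasing := hτ
  target j hj := by
    obtain ⟨p, a, h1, h2⟩ := h j hj
    rw [h1, trans_pair, h2]
  lt j hj := by
    obtain ⟨p, a, h1, h2⟩ := h j hj
    rw [h1]
    exact pair_lt _ _
  d_lt := trans_lt A e

end simulation

/-! ### The encoding of all transitions -/

section encoding

variable {n σ : ℕ}

/-- The powers of two that occur in the array are small. -/
theorem arrayBound {m : List Bool} {X : ℕ} (hσ : 2 ≤ σ) (hX0 : 0 < X)
    (hX : X ≤ scale n σ ^ 2) (hm : m.length ≤ scale n σ ^ 6) :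
    ArrayBound m X (letterWidth σ) (2 ^ fieldWidth n (letterWidth σ)) ∧
      mu X (letterWidth σ) ≤ scale n σ ^ 6 ∧ zeta X (letterWidth σ) ≤ scale n σ ^ 6 ∧
      Nat.clog 2 X ≤ scale n σ ^ 6 := by
  obtain ⟨h8, -, -, hlU⟩ := scale_bounds n hσ
  set l := letterWidth σ with hl
  have hz0 := zmin_pos (l := l) hX0
  have hz : zmin X l ≤ scale n σ ^ 2 := by
    refine le_trans ?_ hX
    have h1 : 0 < 2 * 2 ^ l := by positivity
    refine Nat.le_of_lt_succ ((Nat.div_lt_iff_lt_mul h1).2 ?_)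
    have h2 : (X + 1) * (2 * 2 ^ l) = X * (2 * 2 ^ l) + 2 * 2 ^ l := by ring
    have h3 : X ≤ X * (2 * 2 ^ l) := Nat.le_mul_of_pos_right X h1
    rw [Nat.succ_eq_add_one, h2]
    omega
  have hzz := Nat.mul_le_mul hz hz
  set U := scale n σ with hU
  have e6 : ∀ a b, a ≤ U ^ 2 → b ≤ U ^ 4 → a * b ≤ U ^ 6 := fun a b ha hb =>
    (Nat.mul_le_mul ha hb).trans_eq (by ring)
  have e2 : 8 ≤ U ^ 2 := h8.trans (Nat.le_self_pow (by omega) U)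
  have e4 : U ^ 2 ≤ U ^ 4 := Nat.pow_le_pow_right (by omega) (by omega)
  have hclog : 2 ^ Nat.clog 2 X ≤ U ^ 6 := (two_pow_clog_lt hX0).le.trans
    (e6 2 X (by omega) (hX.trans e4))
  refine ⟨⟨hX0, (lt_of_le_scale_pow hσ ?_).le, (lt_of_le_scale_pow hσ ?_).le,
    (lt_of_le_scale_pow hσ hclog).le, (lt_of_le_scale_pow hσ hm).le⟩, ?_, ?_, ?_⟩
  · simpa using e6 1 X (by omega) (hX.trans e4)
  · refine e6 _ _ ?_ (hzz.trans_eq (by ring))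
    exact (Nat.mul_le_mul h8 hlU).trans_eq (by ring)
  · refine Nat.lt_two_pow_self.le.trans ((two_pow_clog_lt (Nat.mul_pos hz0 hz0)).le.trans ?_)
    exact e6 2 _ (by omega) (hzz.trans_eq (by ring))
  · refine Nat.lt_two_pow_self.le.trans
      ((two_pow_clog_lt (show 1 ≤ 2 * zmin X l by omega)).le.trans ?_)
    rw [← mul_assoc]
    exact e6 _ _ (by omega) (hz.trans e4)
  · exact Nat.lt_two_pow_self.le.trans hclog

theorem parameter_bounds (hσ : 2 ≤ σ) (hn : 1 ≤ n) :
    n ≤ scale n σ ∧ σ ≤ scale n σ ∧ letterWidth σ ≤ scale n σ :=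
  have h := scale_bounds n hσ
  ⟨(Nat.le_mul_of_pos_left n (by omega)).trans h.2.1,
    (Nat.le_mul_of_pos_right σ hn).trans h.2.1,
    (Nat.le_mul_of_pos_left _ hn).trans h.2.2.1⟩

/-- The encoding consists of the header, the dictionary of the tree transitions, the acceptance bits
and the array of the other transitions. -/
theorem exists_dense_encoding (hσ : 2 ≤ σ) (A : DFA (Fin σ) (Fin n)) (hA : A.InitiallyConnected) :
    ∃ m : List Bool, (m.length : ℝ) ≤
        ((σ : ℝ) - 1) * n * Real.logb 2 n + 2044 * (n * Real.logb 2 σ) ∧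
      Simulates denseStep (10 * ((fullProg denseStep).size : ℝ)) A m := by
  have hn : 1 ≤ n := (Nat.zero_le _).trans_lt A.start.2
  obtain ⟨e, τ, h0, hτ, htree⟩ := exists_numbering (by omega) A hA
  have hT := treeData hτ htree
  obtain ⟨h8, hσnU, hnlU, -⟩ := scale_bounds n hσ
  obtain ⟨hnU, hσU, hlU⟩ := parameter_bounds hσ hn
  have hl1 := one_le_letterWidth σ
  have hlσ := lt_two_pow_letterWidth σ
  have hll := letterWidth_le hσ
  obtain ⟨k, c, d0, r, hk, hkl, hX, hcr, hrσ, hdl, hdc, hrk, hlev⟩ :=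
    exists_array hn hσ hlσ (two_pow_letterWidth_le hσ)
  have hbound : ∀ {a : ℕ}, a ≤ scale n σ ^ 6 → a < 2 ^ fieldWidth n (letterWidth σ) :=
    lt_of_le_scale_pow hσ
  have hLlt : fieldWidth n (letterWidth σ) < 2 ^ fieldWidth n (letterWidth σ) :=
    Nat.lt_two_pow_self
  have hblt := gap_lt n (letterWidth σ)
  have hLle := fieldWidth_le hn hl1
  have hdict := length_dictBits_le hn hl1 σ (n - 1) τ
  have hDlen := length_dictBits n σ (fieldWidth n (letterWidth σ)) (letterWidth σ)
    (gap n (letterWidth σ)) (n - 1) τ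
  have hlev := hlev (entryBlock n k (trans A e) τ)
  have hDB := fun h => dictBound (σ := σ) (by omega) hn (T := n - 1) h
  have hsim := fun (H : ℕ → ℕ) (m : List Bool) => simulates_of_step (step := denseStep) (A := A)
    (H := H) (m := m) (b := letterWidth σ + (d0 + k)) hσ e h0 (by omega)
  have hX' : n ^ k ≤ scale n σ ^ 2 := hX.trans (by
    rw [pow_two, pow_two, mul_assoc]; exact Nat.mul_le_mul hσU hσnU)
  have hAB := fun m : List Bool => arrayBound (m := m) hσ (Nat.pow_pos hn) hX'
  set l := letterWidth σ
  set L := fieldWidth n l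
  set b := gap n l
  set X := n ^ k
  set U := scale n σ
  set lev := levelBits X l d0 0 c r (fun _ => 0) (entryBlock n k (trans A e) τ)
  set a0 := L + 1 + 19 * L with ha0
  set a1 := a0 + (n / b + 1) * L with ha1
  set a2 := a1 + n * l with ha2
  set a3 := a2 + 2 ^ ((b - 1) * l) * L with ha3
  set a4 := a3 + (n - 1) * l with ha4
  set a5 := a4 + n with ha5
  set H : ℕ → ℕ := fun i => [0, L, l, b, σ, a0, a1, a2, a3, a4, n, k, X, c, mu X l, zeta X l,
    Nat.clog 2 X, a5, d0, 0].getD i 0 with hH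
  set D := dictBits n σ L l b (n - 1) τ with hD
  set m := header L 19 H ++ (D ++ (arr 1 n (acceptBit A e) ++ lev)) with hm
  have hlen : m.length = a5 + lev.length := by
    rw [hm]
    simp only [List.length_append, length_header, length_arr, hDlen]
    omega
  have ha5le : a5 ≤ 1004 * (n * l) := by
    have h1 : (n - 1) * l ≤ n * l := Nat.mul_le_mul_right l (Nat.sub_le n 1)
    have h2 : n ≤ n * l := Nat.le_mul_of_pos_right n hl1
    omega
  have hreal : (m.length : ℝ) ≤ ((σ : ℝ) - 1) * n * Real.logb 2 n + 1022 * (n * l) := by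
    have h1 : (a5 : ℝ) ≤ 1004 * (n * l) := by exact_mod_cast ha5le
    rw [hlen]
    push_cast
    linarith
  have hcrude : m.length ≤ U ^ 6 := by
    have h1 : (m.length : ℝ) ≤ σ * n * n + 1022 * (n * l) := by
      refine hreal.trans ?_
      have h2 := logb_le_self hn
      have h3 : ((σ : ℝ) - 1) * n ≤ σ * n :=
        mul_le_mul_of_nonneg_right (by linarith) (by positivity)
      have h4 := mul_le_mul h3 h2 (logb_nonneg hn) (by positivity)
      linarith
    have h2 : m.length ≤ σ * n * n + 1022 * (n * l) := by exact_mod_cast h1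
    have h3 : σ * n * n ≤ U * U := Nat.mul_le_mul hσnU hnU
    have h4 : 8 ^ 4 * U ^ 2 ≤ U ^ 6 :=
      (Nat.mul_le_mul_right _ (Nat.pow_le_pow_left h8 4)).trans_eq (by ring)
    have h5 : U ≤ U ^ 2 := Nat.le_self_pow (by omega) U
    rw [← pow_two] at h3
    omega
  obtain ⟨hAm, hmu, hzeta, hclog⟩ := hAB m hcrude
  have hself : U ≤ U ^ 6 := Nat.le_self_pow (by omega) U
  have hX6 : X ≤ U ^ 6 := hX'.trans (Nat.pow_le_pow_right (by omega) (by omega))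
  have h88 : 8 * U ≤ U ^ 6 :=
    (Nat.mul_le_mul_right U h8).trans ((pow_two U).symm.le.trans
      (Nat.pow_le_pow_right (by omega) (by omega)))
  have hHlt : ∀ i, H i < 2 ^ L := by
    refine getD_lt (by positivity) ?_
    simp only [List.forall_mem_cons]
    refine ⟨by positivity, hLlt, hbound (by omega), hblt, hbound (by omega), hbound (by omega),
      hbound (by omega), hbound (by omega), hbound (by omega), hbound (by omega),
      hbound (by omega), hbound (by omega), hbound hX6, hbound (by omega), hbound hmu,
      hbound hzeta, hbound hclog, hbound (by omega), hbound (by omega), by positivity, ?_⟩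
    simp
  have hm0 : Holds m 0 m := ⟨[], [], by simp, rfl⟩
  have hm1 : Holds m a0 (D ++ (arr 1 n (acceptBit A e) ++ lev)) := by
    have := hm0.right (a := header L 19 H)
    rwa [length_header, zero_add] at this
  have hm2 : Holds m a4 (arr 1 n (acceptBit A e) ++ lev) := by
    have := hm1.right
    rw [hDlen] at this
    convert this using 1
    omega
  have hm3 : Holds m a5 lev := by
    have := hm2.right
    rwa [length_arr, mul_one] at this
  refine ⟨m, ?_, hsim H m ?_ rfl hHlt hm0.left hm2.left⟩
  · refine hreal.trans ?_
    have h1 : (n : ℝ) * l ≤ n * (2 * Real.logb 2 σ) :=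
      mul_le_mul_of_nonneg_left hll (by positivity)
    linarith
  · intro w hB s hs hq ha
    exact wp_denseStep hB (trans A e) τ H hT (hDB (hbound (by omega))) hAm
      (dictAt_of_holds hm1.left rfl rfl rfl rfl) hk rfl rfl rfl rfl rfl rfl rfl rfl rfl rfl rfl rfl
      rfl hm3 hcr (hbound (a := c) (by omega)).le (hbound (a := d0) (by omega)).le hdc
      (hbound (a := σ * n) (by omega)).le hrk s hs hq ha

end encoding

/-! ### The encoding of the transitions that do not lead to the failure state -/

section sparse

variable {n σ : ℕ}

/-- The number of transitions that do not lead to the failure state, counted by the numbers of the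
pairs. -/
theorem card_trans_ne_le (A : DFA (Fin σ) (Fin n)) (e : Fin n ≃ Fin n) (f : Fin n) :
    ((Finset.range (σ * n)).filter fun t => trans A e t ≠ e f).card ≤ A.numNonFailure f := by
  classical
  refine (Finset.card_le_card (t := (Finset.univ.filter fun p : Fin n × Fin σ =>
    A.step p.1 p.2 ≠ f).image fun p => σ * (e p.1 : ℕ) + p.2) fun t ht => ?_).trans
    Finset.card_image_le
  simp only [Finset.mem_filter, Finset.mem_range] at ht
  obtain ⟨h1, h2⟩ := ht
  have hσ : 0 < σ := Nat.pos_of_ne_zero fun h0 => by simp [h0] at h1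
  have h3 : t = σ * (e (e.symm ⟨t / σ, Nat.div_lt_of_lt_mul h1⟩) : ℕ) +
      (⟨t % σ, Nat.mod_lt _ hσ⟩ : Fin σ) := by
    simp [Nat.div_add_mod]
  rw [Finset.mem_image]
  refine ⟨(e.symm ⟨t / σ, Nat.div_lt_of_lt_mul h1⟩, ⟨t % σ, Nat.mod_lt _ hσ⟩), ?_, h3.symm⟩
  rw [h3, trans_pair] at h2
  simpa using fun h => h2 (by rw [h])

/-- The transitions, besides the tree transitions, that do not lead to the failure state. All but at
most one of the tree transitions do not lead to the failure state, either. -/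
theorem exists_explicit {d τ : ℕ → ℕ} (hT : TreeData n σ d τ) (f : ℕ) :
    ∃ (T : ℕ) (η : ℕ → ℕ), Increasing T η ∧ T ≤ σ * n ∧
      (∀ t < σ * n, Missing (n - 1) τ t → Missing T η t → d t = f) ∧
      T + n ≤ ((Finset.range (σ * n)).filter fun t => d t ≠ f).card + 2 := by
  classical
  set P : ℕ → Prop := fun t => t < σ * n ∧ Missing (n - 1) τ t ∧ d t ≠ f with hP
  have hT' : Nat.count P (σ * n) = ((Finset.range (σ * n)).filter P).card :=
    Nat.count_eq_card_filter_range _ _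
  have hfin : (Set.ofPred P).Finite := (Finset.finite_toSet (Finset.range (σ * n))).subset
    fun t ht => by simpa using ht.1
  have hcard : Nat.count P (σ * n) = hfin.toFinset.card := by
    rw [hT']
    congr 1
    ext t
    simp only [Finset.mem_filter, Finset.mem_range, Set.Finite.mem_toFinset]
    exact ⟨fun h => h.2, fun h => ⟨h.1, h⟩⟩
  refine ⟨Nat.count P (σ * n), Nat.nth P, fun i j hij hj => ?_, ?_, fun t ht h1 h2 => ?_, ?_⟩
  · exact Nat.nth_lt_nth' hij fun hf => by rw [hcard] at hj; exact hj
  · exact Nat.count_le P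
  · by_contra h3
    have hPt : P t := ⟨ht, h1, h3⟩
    exact h2 (Nat.count P t) (Nat.count_strict_mono hPt ht) (Nat.nth_count hPt)
  · -- the tree transitions that do not lead to the failure state
    set Q := (Finset.range (n - 1)).filter fun j => j + 1 ≠ f with hQ
    have hQcard : n - 1 - 1 ≤ Q.card := by
      have h1 : (Finset.range (n - 1)).erase (f - 1) ⊆ Q := fun j hj => by
        have h2 := Finset.ne_of_mem_erase hj
        exact Finset.mem_filter.2 ⟨Finset.mem_of_mem_erase hj, by omega⟩
      have h2 := Finset.pred_card_le_card_erase (s := Finset.range (n - 1)) (a := f - 1)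
      rw [Finset.card_range] at h2
      exact h2.trans (Finset.card_le_card h1)
    have hinj : Set.InjOn τ (Q : Set ℕ) := by
      intro i hi j hj hij
      rw [hQ, Finset.mem_coe, Finset.mem_filter, Finset.mem_range] at hi hj
      rcases lt_trichotomy i j with h' | h' | h'
      · have := hT.increasing i j h' hj.1; omega
      · exact h'
      · have := hT.increasing j i h' hi.1; omega
    have hdisj : Disjoint ((Finset.range (σ * n)).filter P) (Q.image τ) := by
      rw [Finset.disjoint_left]
      intro t ht ht'
      rw [Finset.mem_image] at ht'
      obtain ⟨j, hj, rfl⟩ := ht'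
      rw [hQ, Finset.mem_filter, Finset.mem_range] at hj
      rw [Finset.mem_filter] at ht
      exact ht.2.2.1 j hj.1 rfl
    have hsub : (Finset.range (σ * n)).filter P ∪ Q.image τ ⊆
        (Finset.range (σ * n)).filter fun t => d t ≠ f := by
      intro t ht
      rw [Finset.mem_union, Finset.mem_filter, Finset.mem_image] at ht
      rw [Finset.mem_filter]
      rcases ht with ht | ⟨j, hj, rfl⟩
      · exact ⟨ht.1, ht.2.2.2⟩
      · rw [hQ, Finset.mem_filter, Finset.mem_range] at hj
        exact ⟨Finset.mem_range.2 (hT.lt j hj.1), by rw [hT.target j hj.1]; exact hj.2⟩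
    have h1 := Finset.card_le_card hsub
    rw [Finset.card_union_of_disjoint hdisj, Finset.card_image_of_injOn hinj, ← hT'] at h1
    omega

/-- The targets in the second dictionary take `(N - n) log n` bits up to lower-order terms, as
there are at most `N - n + 2` of them. -/
theorem sparse_length_le {l N T a : ℕ} (hn : 1 ≤ n) (hl : 1 ≤ l) (hN : 1 ≤ N)
    (hT : T + n ≤ N + 2) (ha : a ≤ 1206 * (n * l) + T * l) :
    ((a + T * Nat.clog 2 n : ℕ) : ℝ) ≤
      ((N : ℝ) - n) * Real.logb 2 n + 3650 * (N * l) := by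
  have hlogn := logb_le_self hn
  have h1 : (a : ℝ) ≤ 1206 * (n * l) + T * l := by exact_mod_cast ha
  have h2 : (T : ℝ) + n ≤ N + 2 := by exact_mod_cast hT
  have h3 : (1 : ℝ) ≤ N := by exact_mod_cast hN
  have h4 : (1 : ℝ) ≤ n := by exact_mod_cast hn
  have h5 : (1 : ℝ) ≤ l := by exact_mod_cast hl
  have h6 : (0 : ℝ) ≤ T := Nat.cast_nonneg T
  have h7 : (n : ℝ) * l ≤ 3 * (N * l) := by
    rw [← mul_assoc]
    exact mul_le_mul_of_nonneg_right (by linarith) (by positivity)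
  have h8 : (T : ℝ) * l ≤ 2 * (N * l) := by
    rw [← mul_assoc]
    exact mul_le_mul_of_nonneg_right (by linarith) (by positivity)
  have h9 : (T : ℝ) * Nat.clog 2 n ≤ (N - n + 2) * (Real.logb 2 n + 1) :=
    mul_le_mul (by linarith) (clog_le_logb hn) (by positivity) (by linarith)
  have h10 : (N : ℝ) ≤ N * l := le_mul_of_one_le_right (by positivity) h5
  have h11 : ((N : ℝ) - n + 2) * (Real.logb 2 n + 1) =
    (N - n) * Real.logb 2 n + 2 * Real.logb 2 n + (N - n + 2) := by ring
  push_cast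
  linarith

/-- The encoding consists of the header, the dictionary of the tree transitions, the dictionary of
the other transitions that do not lead to the failure state, the acceptance bits, and the targets of
the transitions in the second dictionary. -/
theorem exists_sparse_encoding (hσ : 2 ≤ σ) (A : DFA (Fin σ) (Fin n)) (f : Fin n)
    (hA : A.InitiallyConnected) (hN : 1 ≤ A.numNonFailure f) :
    ∃ m : List Bool, (m.length : ℝ) ≤ ((A.numNonFailure f : ℝ) - n) * Real.logb 2 n +
        7300 * (A.numNonFailure f * Real.logb 2 σ) ∧
      Simulates sparseStep (10 * ((fullProg sparseStep).size : ℝ)) A m := by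
  have hn : 1 ≤ n := (Nat.zero_le _).trans_lt A.start.2
  obtain ⟨e, τ, h0, hτ, htree⟩ := exists_numbering (by omega) A hA
  have hT := treeData hτ htree
  obtain ⟨T, η, hη, hTσ, hfail, hcard⟩ := exists_explicit hT (e f)
  have hTN : T + n ≤ A.numNonFailure f + 2 :=
    hcard.trans (Nat.add_le_add_right (card_trans_ne_le A e f) 2)
  clear hcard
  generalize A.numNonFailure f = N at hN hTN ⊢
  obtain ⟨h8, hσnU, hnlU, -⟩ := scale_bounds n hσ
  obtain ⟨hnU, hσU, hlU⟩ := parameter_bounds hσ hn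
  have hl1 := one_le_letterWidth σ
  have hll := letterWidth_le hσ
  have hbound : ∀ {a : ℕ}, a ≤ scale n σ ^ 6 → a < 2 ^ fieldWidth n (letterWidth σ) :=
    lt_of_le_scale_pow hσ
  have hLlt : fieldWidth n (letterWidth σ) < 2 ^ fieldWidth n (letterWidth σ) :=
    Nat.lt_two_pow_self
  have hblt := gap_lt n (letterWidth σ)
  have hLle := fieldWidth_le hn hl1
  have hdict := fun (T : ℕ) (τ : ℕ → ℕ) => length_dictBits_le hn hl1 σ T τ
  have hDlen := fun (T : ℕ) (τ : ℕ → ℕ) => length_dictBits n σ (fieldWidth n (letterWidth σ))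
    (letterWidth σ) (gap n (letterWidth σ)) T τ
  have hDB := fun (T : ℕ) h => dictBound (σ := σ) (by omega) hn (T := T) h
  have hsim := fun (H : ℕ → ℕ) (m : List Bool) => simulates_of_step (step := sparseStep) (A := A)
    (H := H) (m := m) (b := letterWidth σ + letterWidth σ) hσ e h0 (by omega)
  have hnb2 := (two_pow_clog_lt hn).le
  have hnb3 : Nat.clog 2 n ≤ n := (Nat.clog_le_iff_le_pow (by omega)).2 Nat.lt_two_pow_self.le
  have hnb4 : n ≤ 2 ^ Nat.clog 2 n := Nat.le_pow_clog (by omega) n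
  have hfn : (e f : ℕ) < n := (e f).2
  set l := letterWidth σ
  set L := fieldWidth n l
  set b := gap n l
  set nb := Nat.clog 2 n
  set U := scale n σ
  set D := dictBits n σ L l b (n - 1) τ with hD
  set D' := dictBits n σ L l b T η with hD'
  set vals := arr nb T fun j => trans A e (η j) with hvals
  set a0 := L + 1 + 19 * L with ha0
  set a1 := a0 + (n / b + 1) * L with ha1
  set a2 := a1 + n * l with ha2
  set a3 := a2 + 2 ^ ((b - 1) * l) * L with ha3
  set a4 := a3 + (n - 1) * l with ha4
  set a5 := a4 + (n / b + 1) * L with ha5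
  set a6 := a5 + n * l with ha6
  set a7 := a6 + 2 ^ ((b - 1) * l) * L with ha7
  set a8 := a7 + T * l with ha8
  set a9 := a8 + n with ha9
  set H : ℕ → ℕ := fun i => [0, L, l, b, (e f : ℕ), a0, a1, a2, a3, a8, a9, nb, a4, a5, a6, a7].getD
    i 0 with hH
  set m := header L 19 H ++ (D ++ (D' ++ (arr 1 n (acceptBit A e) ++ vals))) with hm
  have hdict1 := hdict (n - 1) τ
  have hdict2 := hdict T η
  have hDlen1 := hDlen (n - 1) τ
  have hDlen2 := hDlen T η
  rw [← hD] at hdict1 hDlen1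
  rw [← hD'] at hdict2 hDlen2
  have hlen : m.length = a9 + T * nb := by
    rw [hm]
    simp only [List.length_append, length_header, length_arr, hvals]
    omega
  have ha9le : a9 ≤ 1206 * (n * l) + T * l := by
    have h1 : (n - 1) * l ≤ n * l := Nat.mul_le_mul_right l (Nat.sub_le n 1)
    have h2 : n ≤ n * l := Nat.le_mul_of_pos_right n hl1
    omega
  have hcrude : m.length ≤ U ^ 6 := by
    have h1 : T * l ≤ U * U := Nat.mul_le_mul (hTσ.trans hσnU) hlU
    have h2 : T * nb ≤ U * U := Nat.mul_le_mul (hTσ.trans hσnU) (hnb3.trans hnU)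
    have h4 : 8 ^ 4 * U ^ 2 ≤ U ^ 6 :=
      (Nat.mul_le_mul_right _ (Nat.pow_le_pow_left h8 4)).trans_eq (by ring)
    have h5 : U ≤ U ^ 2 := Nat.le_self_pow (by omega) U
    rw [← pow_two] at h1 h2
    omega
  have hreal : (m.length : ℝ) ≤ ((N : ℝ) - n) * Real.logb 2 n + 3650 * (N * l) := by
    rw [hlen]
    exact sparse_length_le hn hl1 hN hTN ha9le
  have hself : U ≤ U ^ 6 := Nat.le_self_pow (by omega) U
  have h88 : 8 * U ≤ U ^ 6 :=
    (Nat.mul_le_mul_right U h8).trans ((pow_two U).symm.le.trans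
      (Nat.pow_le_pow_right (by omega) (by omega)))
  have hHlt : ∀ i, H i < 2 ^ L := by
    refine getD_lt (by positivity) ?_
    simp only [List.forall_mem_cons]
    refine ⟨by positivity, hLlt, hbound (by omega), hblt, hbound (by omega), hbound (by omega),
      hbound (by omega), hbound (by omega), hbound (by omega), hbound (by omega),
      hbound (by omega), hbound (by omega), hbound (by omega), hbound (by omega), hbound (by omega),
      hbound (by omega), ?_⟩
    simp
  have hm0 : Holds m 0 m := ⟨[], [], by simp, rfl⟩
  have hm1 : Holds m a0 (D ++ (D' ++ (arr 1 n (acceptBit A e) ++ vals))) := by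
    have := hm0.right (a := header L 19 H)
    rwa [length_header, zero_add] at this
  have hm2 : Holds m a4 (D' ++ (arr 1 n (acceptBit A e) ++ vals)) := by
    have := hm1.right
    rw [hDlen1] at this
    convert this using 1
    omega
  have hm3 : Holds m a8 (arr 1 n (acceptBit A e) ++ vals) := by
    have := hm2.right
    rw [hDlen2] at this
    convert this using 1
    omega
  have hm4 : Holds m a9 vals := by
    have := hm3.right
    rwa [length_arr, mul_one] at this
  refine ⟨m, ?_, hsim H m ?_ rfl hHlt hm0.left hm3.left⟩
  · refine hreal.trans ?_
    have h1 : (N : ℝ) * l ≤ N * (2 * Real.logb 2 σ) :=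
      mul_le_mul_of_nonneg_left hll (by positivity)
    linarith
  · intro w hB s hs hq ha
    exact wp_sparseStep hB (trans A e) τ η H hT (hDB _ (hbound (by omega)))
      (dictAt_of_holds hm1.left rfl rfl rfl rfl) hη (hDB _ (hbound (a := T) (by omega)))
      (dictAt_of_holds hm2.left rfl rfl rfl rfl) rfl rfl rfl rfl rfl hm4 hnb4
      (hnb2.trans (hbound (a := 2 * n) (by omega)).le) hfn hfail s hs hq ha

end sparse

end WordRAM

theorem theorem1 :
    -- the encoding with `(σ - 1) n log n + O(n log σ)` bits
    (∃ (c C : ℝ) (k : ℕ) (p : WordRAM.Prog (k + 1))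
        (enc : (n σ : ℕ) → DFA (Fin σ) (Fin n) → List Bool),
      ∀ (n σ : ℕ), 2 ≤ σ →
        (∀ A : DFA (Fin σ) (Fin n), A.InitiallyConnected →
          ((enc n σ A).length : ℝ) ≤
              ((σ : ℝ) - 1) * n * Real.logb 2 n + C * (n * Real.logb 2 σ) ∧
            ∀ w : ℕ, c * Real.logb 2 ((σ : ℝ) * n) ≤ w → ∀ x : List (Fin σ),
              WordRAM.Decides p w (enc n σ A) x
                (C * (x.length * Real.logb 2 σ + 1)) (x ∈ A.accepts)) ∧
        (∀ A B : DFA (Fin σ) (Fin n), A.InitiallyConnected → B.InitiallyConnected →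
          enc n σ A = enc n σ B → A.Isomorphic B)) ∧
    -- the encoding with `(N - n) log n + O(N log σ)` bits, for `N` non-failure transitions
    (∃ (c C : ℝ) (k : ℕ) (p : WordRAM.Prog (k + 1))
        (enc : (n σ : ℕ) → DFA (Fin σ) (Fin n) → Fin n → List Bool),
      ∀ (n σ : ℕ), 2 ≤ σ →
        (∀ (A : DFA (Fin σ) (Fin n)) (f : Fin n) (N : ℕ), A.InitiallyConnected →
          A.numNonFailure f = N → 1 ≤ N → N < σ * n →
          ((enc n σ A f).length : ℝ) ≤
              ((N : ℝ) - n) * Real.logb 2 n + C * (N * Real.logb 2 σ) ∧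
            ∀ w : ℕ, c * Real.logb 2 ((σ : ℝ) * n) ≤ w → ∀ x : List (Fin σ),
              WordRAM.Decides p w (enc n σ A f) x
                (C * (x.length * Real.logb 2 σ + 1)) (x ∈ A.accepts)) ∧
        (∀ (A B : DFA (Fin σ) (Fin n)) (f g : Fin n),
          A.InitiallyConnected → B.InitiallyConnected →
          1 ≤ A.numNonFailure f → A.numNonFailure f < σ * n →
          1 ≤ B.numNonFailure g → B.numNonFailure g < σ * n →
          enc n σ A f = enc n σ B g → A.Isomorphic B)) := by
  classical
  open WordRAM in
  constructor
  · have h : ∀ (n σ : ℕ) (A : DFA (Fin σ) (Fin n)), ∃ m : List Bool, 2 ≤ σ →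
        A.InitiallyConnected → (m.length : ℝ) ≤
          ((σ : ℝ) - 1) * n * Real.logb 2 n + 2044 * (n * Real.logb 2 σ) ∧
        Simulates denseStep (10 * ((fullProg denseStep).size : ℝ)) A m := by
      intro n σ A
      by_cases h : 2 ≤ σ ∧ A.InitiallyConnected
      · obtain ⟨m, hm⟩ := exists_dense_encoding h.1 A h.2
        exact ⟨m, fun _ _ => hm⟩
      · exact ⟨[], fun h1 h2 => absurd ⟨h1, h2⟩ h⟩
    choose enc henc using h
    generalize 10 * ((fullProg denseStep).size : ℝ) = K at henc
    refine ⟨3841, max 2044 K, 63, fullProg denseStep, enc, fun n σ hσ => ⟨fun A hA => ?_, ?_⟩⟩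
    · obtain ⟨h1, h2⟩ := henc n σ A hσ hA
      have h3 := one_le_logb hσ
      refine ⟨h1.trans ?_, fun w hw x => h2.decides hσ (le_max_right _ _) hw x⟩
      have := mul_le_mul_of_nonneg_right (le_max_left 2044 K)
        (show (0 : ℝ) ≤ n * Real.logb 2 σ by positivity)
      linarith
    · intro A B hA hB h
      have hA' := (henc n σ A hσ hA).2
      rw [h] at hA'
      exact hA'.isomorphic (henc n σ B hσ hB).2 hA
  · have h : ∀ (n σ : ℕ) (A : DFA (Fin σ) (Fin n)) (f : Fin n), ∃ m : List Bool, 2 ≤ σ →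
        A.InitiallyConnected → 1 ≤ A.numNonFailure f →
        (m.length : ℝ) ≤ ((A.numNonFailure f : ℝ) - n) * Real.logb 2 n +
          7300 * (A.numNonFailure f * Real.logb 2 σ) ∧
        Simulates sparseStep (10 * ((fullProg sparseStep).size : ℝ)) A m := by
      intro n σ A f
      by_cases h : 2 ≤ σ ∧ A.InitiallyConnected ∧ 1 ≤ A.numNonFailure f
      · obtain ⟨m, hm⟩ := exists_sparse_encoding h.1 A f h.2.1 h.2.2
        exact ⟨m, fun _ _ _ => hm⟩
      · exact ⟨[], fun h1 h2 h3 => absurd ⟨h1, h2, h3⟩ h⟩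
    choose enc henc using h
    generalize 10 * ((fullProg sparseStep).size : ℝ) = K at henc
    refine ⟨3841, max 7300 K, 63, fullProg sparseStep, enc, fun n σ hσ => ⟨?_, ?_⟩⟩
    · rintro A f N hA rfl hN -
      obtain ⟨h1, h2⟩ := henc n σ A f hσ hA hN
      have h3 := one_le_logb hσ
      refine ⟨h1.trans ?_, fun w hw x => h2.decides hσ (le_max_right _ _) hw x⟩
      have := mul_le_mul_of_nonneg_right (le_max_left 7300 K)
        (show (0 : ℝ) ≤ A.numNonFailure f * Real.logb 2 σ by positivity)
      linarith
    · intro A B f g hA hB hf _ hg _ h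
      have hA' := (henc n σ A f hσ hA hf).2
      rw [h] at hA'
      exact hA'.isomorphic (henc n σ B g hσ hB hg).2 hA
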